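/- Let $d\ge 2$, $0<\alpha\le\beta$, $Q_R=(-R,R)^d$, $Q=Q_1$, and let $\mathcal M_{\alpha\beta}$ be the set of real $d\times d$ matrices $M$ with $\xi\cdot M\xi\ge\alpha|\xi|^2$ and $|M\xi|\le\beta|\xi|$ for all $\xi\in\mathbb R^d$. Let $A\in L^\infty(\mathbb R^d,\mathcal M_{\alpha\beta})$ be $Q$-periodic (that is, $2\mathbb Z^d$-periodic; not necessarily symmetric), with transpose $A^*$. For $\xi\in\mathbb R^d$ let $\phi\in H^1_{\mathrm{per}}(Q)$ (the closure in $H^1(Q)$ of the smooth $Q$-periodic functions with zero mean) be the corrector, i.e. $\int_Q\nabla\psi\cdot A(\xi+\nabla\phi)=0$ for all $\psi\in H^1_{\mathrm{per}}(Q)$. For $T,R>0$ let $\phi_{T,R}\in H^1_0(Q_R)$ solve $\int_{Q_R}\big(T^{-1}\psi\phi_{T,R}+\nabla\psi\cdot A(\xi+\nabla\phi_{T,R})\big)=0$ for all $\psi\in H^1_0(Q_R)$; put $\phi_{T,1,R}=\phi_{T,R}$ and $\phi_{T,k+1,R}=\frac{1}{2^k-1}\big(2^k\phi_{2T,k,R}-\phi_{T,k,R}\big)$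 for $k\ge1$. For $\xi'\in\mathbb R^d$ let $\phi'$, $\phi'_{T,k,R}$ be the same objects for $A^*$ and $\xi'$. The homogenized matrix is given by $$\xi'\cdot A_{\mathrm{hom}}\xi=\frac1{|Q|}\int_Q(\xi'+\nabla\phi')\cdot A(\xi+\nabla\phi).$$ A filter of order $p\ge0$ is a continuous even function $\mu:[-1,1]\to[0,\infty)$, non-increasing on $[0,1]$, with $\int_{-1}^1\mu=1$ and, if $p\ge1$, such that $\mu\in C^{p-1}([-1,1])\cap W^{p,\infty}(-1,1)$, the derivative $\mu^{(p)}$ has bounded variation (as is the case if $\mu\in W^{p+1,\infty}(-1,1)$), and $\mu^{(j)}(\pm1)=0$ for $0\le j\le p-1$. Put $\mu_L(x)=L^{-d}\prod_{i=1}^d\mu(x_i/L)$ and $\langle\psi\rangle_{\mu_L}=\int_{Q_L}\psi\mu_L$, and define matrices by $$\xi'\cdot A'_{T,k,R,L,p}\,\xi=\int_{Q_L}(\xi'+\nabla\phi'_{T,k,R})\cdot A(\xi+\nabla\phi_{T,k,R})\,\mu_L ,$$ $$\xi'\cdot A_{T,k,R,L,p}\,\xi=\int_{Q_L}\big(\xi'+\nabla\phi'_{T,k,R}-\langle\nabla\phi'_{T,k,R}\rangle_{\mu_L}\big)\cdot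 A\big(\xi+\nabla\phi_{T,k,R}-\langle\nabla\phi_{T,k,R}\rangle_{\mu_L}\big)\,\mu_L .$$ Theorem. There is $c>0$ depending only on $\alpha,\beta,d$ such that for all integers $k\ge1$, $p\ge0$, all filters $\mu$ of order $p$ and all $\kappa>0$ there is a constant $C$, depending only on $\alpha,\beta,d,k,p,\mu$ and $\kappa$, such that for all $A$ as above and all $T,R,L>0$ with $$T\le\kappa R^2,\qquad R\le\kappa T,\qquad L\le R,\qquad R\le\kappa L,\qquad R\le\kappa(R-L),$$ one has, in the operator norm (the supremum of $|\xi'\cdot M\xi|$ over unit vectors $\xi,\xi'$), $$|A_{T,k,R,L,p}-A_{\mathrm{hom}}|,\ |A'_{T,k,R,L,p}-A_{\mathrm{hom}}|\ \le\ C\Big(L^{-(p+1)}+T^{-2k}+T^{1/4}\exp\Big(-c\,\frac{R-L}{\sqrt{2^{k-1}T}}\Big)\Big).$$ -/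

import Mathlib

open MeasureTheory
open scoped ContDiff

noncomputable section

namespace PeriodicHom

/-- The Euclidean space `ℝ^d`. -/
abbrev Sp (d : ℕ) : Type := EuclideanSpace ℝ (Fin d)

/-- The open box `Q_R = (-R, R)^d`. -/
def box (d : ℕ) (R : ℝ) : Set (Sp d) := {x | ∀ i, |x i| < R}

/-- A matrix acting on a vector of the Euclidean space. -/
def act {d : ℕ} (M : Matrix (Fin d) (Fin d) ℝ) (v : Sp d) : Sp d :=
  Matrix.toEuclideanLin M v

/-- The class `M_{αβ}`: `ξ ⬝ M ξ ≥ α |ξ|²` and `|M ξ| ≤ β |ξ|` for all `ξ`. -/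
def IsElliptic {d : ℕ} (α β : ℝ) (M : Matrix (Fin d) (Fin d) ℝ) : Prop :=
  ∀ ξ : Sp d, α * ‖ξ‖ ^ 2 ≤ inner ℝ ξ (act M ξ) ∧ ‖act M ξ‖ ≤ β * ‖ξ‖

/-- A coefficient field `x ↦ A x`. -/
abbrev Field (d : ℕ) : Type := Sp d → Matrix (Fin d) (Fin d) ℝ

/-- The field of transposed matrices. -/
def adj {d : ℕ} (A : Field d) : Field d := fun x => (A x).transpose

/-- `A ∈ L^∞(ℝ^d, M_{αβ})`. -/
def IsCoefficient {d : ℕ} (α β : ℝ) (A : Field d) : Prop :=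
  (∀ i j, AEMeasurable (fun x => A x i j) volume) ∧ ∀ᵐ x ∂volume, IsElliptic α β (A x)

/-- `f` is `Q`-periodic, `Q = (-1,1)^d`: invariant (everywhere) under the translations by `2 e_i`. -/
def IsPeriodicFun {d : ℕ} (f : Sp d → ℝ) : Prop :=
  ∀ (i : Fin d) (x : Sp d), f (x + EuclideanSpace.single i 2) = f x

/-- The coefficient field `A` is `Q`-periodic, `Q = (-1,1)^d` (almost everywhere). -/
def IsPeriodicField {d : ℕ} (A : Field d) : Prop :=
  ∀ i : Fin d, ∀ᵐ x ∂volume, A (x + EuclideanSpace.single i 2) = A x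

/-- An element of a Sobolev space of order one, recorded as the pair (function, weak gradient). -/
abbrev FunGrad (d : ℕ) : Type := (Sp d → ℝ) × (Sp d → Sp d)

/-- `w = (u, G)` belongs to the closure, for the norm of `H¹(U)`, of the set of all pairs
`(ψ, ∇ψ)` with `ψ` in the class `S` of smooth functions. -/
def MemH1Closure {d : ℕ} (U : Set (Sp d)) (S : Set (Sp d → ℝ)) (w : FunGrad d) : Prop :=
  MemLp w.1 2 (volume.restrict U) ∧ MemLp w.2 2 (volume.restrict U) ∧
    ∀ ε : ℝ, 0 < ε → ∃ ψ ∈ S,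
      eLpNorm (fun x => w.1 x - ψ x) 2 (volume.restrict U) ≤ ENNReal.ofReal ε ∧
      eLpNorm (fun x => w.2 x - gradient ψ x) 2 (volume.restrict U) ≤ ENNReal.ofReal ε

/-- Smooth functions with compact support contained in `U`. -/
def testFunctions {d : ℕ} (U : Set (Sp d)) : Set (Sp d → ℝ) :=
  {ψ | ContDiff ℝ ∞ ψ ∧ HasCompactSupport ψ ∧ tsupport ψ ⊆ U}

/-- Smooth `Q`-periodic functions with zero mean on `Q = (-1,1)^d`. -/
def periodicTestFunctions (d : ℕ) : Set (Sp d → ℝ) :=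
  {ψ | ContDiff ℝ ∞ ψ ∧ IsPeriodicFun ψ ∧ ∫ x in box d 1, ψ x = 0}

/-- `w ∈ H¹₀(Q_R)`. -/
def MemH10 {d : ℕ} (R : ℝ) (w : FunGrad d) : Prop :=
  MemH1Closure (box d R) (testFunctions (box d R)) w

/-- `w ∈ H¹_per(Q)`, the closure in `H¹(Q)` of the smooth `Q`-periodic functions with zero mean. -/
def MemH1per {d : ℕ} (w : FunGrad d) : Prop :=
  MemH1Closure (box d 1) (periodicTestFunctions d) w

/-- `w` is the periodic corrector in direction `ξ`: the weak solution in `H¹_per(Q)` of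
`-∇ ⬝ A (ξ + ∇φ) = 0`. -/
def IsCorrector {d : ℕ} (A : Field d) (ξ : Sp d) (w : FunGrad d) : Prop :=
  MemH1per w ∧ ∀ v : FunGrad d, MemH1per v →
    ∫ x in box d 1, inner ℝ (v.2 x) (act (A x) (ξ + w.2 x)) = 0

/-- `w` is the regularized corrector on `Q_R` in direction `ξ`: the weak solution in `H¹₀(Q_R)` of
`T⁻¹ φ - ∇ ⬝ A (ξ + ∇φ) = 0`. -/
def IsRegCorrector {d : ℕ} (A : Field d) (ξ : Sp d) (T R : ℝ) (w : FunGrad d) : Prop :=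
  MemH10 R w ∧ ∀ v : FunGrad d, MemH10 R v →
    ∫ x in box d R, (T⁻¹ * (v.1 x * w.1 x) + inner ℝ (v.2 x) (act (A x) (ξ + w.2 x))) = 0

/-- The periodic corrector `φ` (with `∇φ`). It exists and is unique, up to null subsets of `Q`,
for all periodic elliptic coefficients. -/
def corrector {d : ℕ} (A : Field d) (ξ : Sp d) : FunGrad d :=
  Classical.epsilon fun w => IsCorrector A ξ w

/-- The regularized corrector `φ_{T,R}` (with `∇φ_{T,R}`). It exists and is unique, up to null
subsets of `Q_R`, for all elliptic coefficients and all `T, R > 0`. -/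
def regCorrector {d : ℕ} (A : Field d) (ξ : Sp d) (T R : ℝ) : FunGrad d :=
  Classical.epsilon fun w => IsRegCorrector A ξ T R w

/-- Richardson extrapolation with respect to `T`: `f_{T,1} = f_T` and
`f_{T,k+1} = (2^k f_{2T,k} - f_{T,k}) / (2^k - 1)` for `k ≥ 1`. The index `0` is not used. -/
def richardson {V : Type*} [AddCommGroup V] [Module ℝ V] (f : ℝ → V) : ℕ → ℝ → V
  | 0, _ => 0
  | 1, T => f T
  | (n + 2), T =>
      ((2 : ℝ) ^ (n + 1) - 1)⁻¹ •
        ((2 : ℝ) ^ (n + 1) • richardson f (n + 1) (2 * T) - richardson f (n + 1) T)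

/-- The gradient `∇φ_{T,k,R}` of the Richardson extrapolation of the regularized correctors
on `Q_R`. -/
def gradExtrap {d : ℕ} (A : Field d) (ξ : Sp d) (T : ℝ) (k : ℕ) (R : ℝ) : Sp d → Sp d :=
  (richardson (fun S => regCorrector A ξ S R) k T).2

/-- `ξ' ⬝ A_hom ξ`, the average over the periodic cell of
`(ξ' + ∇φ') ⬝ A (ξ + ∇φ)`, with `φ'` the corrector of the transposed coefficients. -/
def homForm {d : ℕ} (A : Field d) (ξ' ξ : Sp d) : ℝ :=
  ⨍ x in box d 1,
    inner ℝ (ξ' + (corrector (adj A) ξ').2 x) (act (A x) (ξ + (corrector A ξ).2 x))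

/-- The rescaled filter `μ_L(x) = L^{-d} ∏ μ(x_i / L)`. -/
def scaledFilter (d : ℕ) (μ : ℝ → ℝ) (L : ℝ) (x : Sp d) : ℝ :=
  (L ^ d)⁻¹ * ∏ i, μ (x i / L)

/-- The filtered average over `Q_L` of a vector field. -/
def filteredMean {d : ℕ} (μ : ℝ → ℝ) (L : ℝ) (G : Sp d → Sp d) : Sp d :=
  ∫ x in box d L, scaledFilter d μ L x • G x

/-- `ξ' ⬝ A'_{T,k,R,L,p} ξ`. -/
def approxForm' {d : ℕ} (A : Field d) (μ : ℝ → ℝ) (T : ℝ) (k : ℕ) (R L : ℝ) (ξ' ξ : Sp d) : ℝ :=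
  ∫ x in box d L,
    inner ℝ (ξ' + gradExtrap (adj A) ξ' T k R x) (act (A x) (ξ + gradExtrap A ξ T k R x)) *
      scaledFilter d μ L x

/-- `ξ' ⬝ A_{T,k,R,L,p} ξ`, the variant in which the filtered averages of the gradients are
subtracted. -/
def approxForm {d : ℕ} (A : Field d) (μ : ℝ → ℝ) (T : ℝ) (k : ℕ) (R L : ℝ) (ξ' ξ : Sp d) : ℝ :=
  ∫ x in box d L,
    inner ℝ
        (ξ' + gradExtrap (adj A) ξ' T k R x - filteredMean μ L (gradExtrap (adj A) ξ' T k R))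
        (act (A x) (ξ + gradExtrap A ξ T k R x - filteredMean μ L (gradExtrap A ξ T k R))) *
      scaledFilter d μ L x

/-- `μ : [-1,1] → [0,∞)` is a filter of order (at least) `p`. Only the values of `μ` on `[-1,1]`
matter. For `p = q + 1` the field `regularity` says that `μ` is `C^{p-1}` on `[-1,1]` and that
`μ^{(p-1)}` is absolutely continuous with a derivative `g = μ^{(p)}` of bounded variation, hence
bounded; so `μ ∈ W^{p,∞}`. For `p = 0` the fields `regularity` and `vanish` are empty (and `μ` has
bounded variation by monotonicity). -/
structure IsFilter (p : ℕ) (μ : ℝ → ℝ) : Prop where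
  nonneg : ∀ x ∈ Set.Icc (-1 : ℝ) 1, 0 ≤ μ x
  continuous : ContinuousOn μ (Set.Icc (-1) 1)
  even : ∀ x ∈ Set.Icc (-1 : ℝ) 1, μ (-x) = μ x
  antitone : AntitoneOn μ (Set.Icc 0 1)
  mass : ∫ x in (-1 : ℝ)..1, μ x = 1
  regularity : ∀ q : ℕ, p = q + 1 →
    ContDiffOn ℝ q μ (Set.Icc (-1) 1) ∧
    ∃ g : ℝ → ℝ, BoundedVariationOn g (Set.Icc (-1) 1) ∧
      ∀ x ∈ Set.Icc (-1 : ℝ) 1,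
        iteratedDerivWithin q μ (Set.Icc (-1) 1) x =
          iteratedDerivWithin q μ (Set.Icc (-1) 1) (-1) + ∫ t in (-1 : ℝ)..x, g t
  vanish : ∀ j < p, iteratedDerivWithin j μ (Set.Icc (-1) 1) (-1) = 0 ∧
    iteratedDerivWithin j μ (Set.Icc (-1) 1) 1 = 0

end PeriodicHom

end

open MeasureTheory
open scoped ContDiff

noncomputable section

namespace PeriodicHom

/-! The Dirichlet correctors on `Q_R` are compared with the regularized correctors on the torus, and
the latter with the true correctors. Each term of the bound has its own mechanism.

Filtering, `L^{-(p+1)}`. Unfolding the integral of a periodic `ψ` against `μ_L` onto one cell leaves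
`ψ` times the periodization of `μ_L`, which is a product of one-dimensional Riemann sums of `μ` with
step `2/L`. For a function of bounded variation such sums are accurate to order `L^{-1}`. Each
integration that produces a function vanishing at `±1` gains one more power: as a function of the
offset, the sum has the exact mean, and its derivative is `L⁻¹` times the sum of the previous
function (`RiemannBound.integrate`). The outcome is `IsFilter.exists_average_bound`.

Regularization, `T^{-2k}`. On the torus the Poincaré inequality makes the energy form coercive
without the zero-order term, so that `φ_T = (1 + T⁻¹ K)⁻¹ φ` with a bounded operator `K`. The
Neumann expansion in powers of `T⁻¹` follows, and the extrapolation removes the powers `1, …, k -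
1`; an error `T^{-k}` in `H¹` is left (`norm_richardson_solution_sub_le`). In the bilinear formula
for `A_hom` the first-order errors vanish, by the equations of the corrector and of the adjoint
corrector, and only a product of two errors survives (`IsCellApprox.abs_average_sub_homForm_le`).

Truncation, the exponential. The Dirichlet solution and the periodic solution with the same `T`
differ by a solution of the homogeneous equation in `Q_R`. It is tested with itself times `η²`,
where `η` vanishes near the boundary of `Q_R`, satisfies `|∇η|² ≤ C T⁻¹ (η² + 4)` and is of size
`exp (c (R - L) / √T)` on `Q_L` (`exists_weight`, `IsRegular.caccioppoli`). The crude global energy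
bound of order `R^d` then gives `exists_decay`. The factor `R^d` is compensated by `μ_L ≤ C L^{-d}`,
because `R ≤ κ L`.

Assembly. `IsCellApprox` records a periodic field `g` close to the gradient of the corrector; the
extrapolated gradient is `g` plus an exponentially small field on `Q_L`. Since `g` has zero mean,
the filtered mean of the extrapolated gradient is small as well, and so both formulas are
perturbations of the same periodic expression. The conditions with `κ` bound `T` and `L` from below,
which makes quadratic errors linear and gives `E ≤ q T^{1/4} E` for the exponential `E`. -/

/-! ### The period lattice -/

/-- The vector `2 n` of the period lattice `2ℤ^d`. -/
def lat {d : ℕ} (n : Fin d → ℤ) : Sp d := WithLp.toLp 2 fun i => 2 * (n i : ℝ)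

/-- The index of the half-open cell `2 n + [-1,1)^d` that contains `x`. -/
def cellIndex {d : ℕ} (x : Sp d) : Fin d → ℤ := fun i => ⌊(x i + 1) / 2⌋

/-- The half-open cell `[-1,1)^d`. -/
def cell (d : ℕ) : Set (Sp d) := {x | ∀ i, -1 ≤ x i ∧ x i < 1}

/-- The representative of `x` in the half-open cell `[-1,1)^d`. -/
def rep {d : ℕ} (x : Sp d) : Sp d := x - lat (cellIndex x)

variable {d : ℕ}

@[simp] lemma lat_apply (n : Fin d → ℤ) (i : Fin d) : lat n i = 2 * (n i : ℝ) := rfl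

lemma lat_neg (n : Fin d → ℤ) : lat (-n) = -lat n := by
  ext i; simp

lemma cellIndex_add_lat (x : Sp d) (n : Fin d → ℤ) : cellIndex (x + lat n) = cellIndex x + n := by
  funext i
  have : ((x + lat n) i + 1) / 2 = (x i + 1) / 2 + (n i : ℝ) := by
    simp; ring
  simp only [cellIndex, this, Int.floor_add_intCast, Pi.add_apply]

lemma lat_add (m n : Fin d → ℤ) : lat (m + n) = lat m + lat n := by
  ext i; simp; ring

lemma rep_add_lat (x : Sp d) (n : Fin d → ℤ) : rep (x + lat n) = rep x := by
  rw [rep, cellIndex_add_lat, lat_add, rep]; abel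

lemma rep_add_lat_cellIndex (x : Sp d) : rep x + lat (cellIndex x) = x := by
  rw [rep]; abel

lemma mem_cell_iff (x : Sp d) : x ∈ cell d ↔ cellIndex x = 0 := by
  rw [funext_iff]
  refine forall_congr' fun i => ?_
  simp only [cellIndex, Pi.zero_apply, Int.floor_eq_iff]
  constructor
  · rintro ⟨h1, h2⟩; constructor <;> push_cast <;> linarith
  · rintro ⟨h1, h2⟩; push_cast at h1 h2; constructor <;> linarith

lemma rep_of_mem_cell {x : Sp d} (hx : x ∈ cell d) : rep x = x := by
  rw [mem_cell_iff] at hx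
  have h := rep_add_lat_cellIndex x
  rw [hx] at h
  have h0 : (lat 0 : Sp d) = 0 := by ext i; simp
  rwa [h0, add_zero] at h

lemma measurable_coord (i : Fin d) : Measurable fun x : Sp d => x i :=
  (EuclideanSpace.proj (𝕜 := ℝ) i).continuous.measurable

lemma measurable_toSp {X : Type*} [MeasurableSpace X] {f : X → Sp d}
    (h : ∀ i, Measurable fun x => f x i) : Measurable f := by
  have h1 : Measurable fun x => (MeasurableEquiv.toLp 2 (Fin d → ℝ)) (fun i => f x i) :=
    (MeasurableEquiv.toLp 2 (Fin d → ℝ)).measurable.comp (measurable_pi_lambda _ h)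
  exact h1

lemma measurable_cellIndex : Measurable (cellIndex : Sp d → Fin d → ℤ) :=
  measurable_pi_lambda _ fun i => (((measurable_coord i).add_const 1).div_const 2).floor

lemma measurable_rep : Measurable (rep : Sp d → Sp d) := by
  refine measurable_toSp fun i => ?_
  have : Measurable fun x : Sp d => x i - 2 * ((cellIndex x i : ℤ) : ℝ) :=
    (measurable_coord i).sub ((measurable_from_top.comp
      ((measurable_pi_apply i).comp measurable_cellIndex)).const_mul 2)
  exact this

lemma measurableSet_cell : MeasurableSet (cell d) := by
  have : cell d = cellIndex ⁻¹' {0} := by ext x; simpa using mem_cell_iff x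
  rw [this]; exact measurable_cellIndex (measurableSet_singleton _)

lemma isOpen_box (R : ℝ) : IsOpen (box d R) := by
  have : box d R = ⋂ i, {x : Sp d | |x i| < R} := by ext x; simp [box]
  rw [this]
  exact isOpen_iInter_of_finite fun i =>
    isOpen_lt (continuous_abs.comp (EuclideanSpace.proj (𝕜 := ℝ) i).continuous) continuous_const

lemma measurableSet_box (R : ℝ) : MeasurableSet (box d R) := (isOpen_box R).measurableSet

lemma box_subset_closedBall (R : ℝ) :
    box d R ⊆ Metric.closedBall 0 (Real.sqrt (d * R ^ 2)) := by
  intro x hx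
  rw [mem_closedBall_zero_iff, EuclideanSpace.norm_eq]
  refine Real.sqrt_le_sqrt ?_
  calc ∑ i, ‖x i‖ ^ 2 ≤ ∑ _i : Fin d, R ^ 2 := by
        refine Finset.sum_le_sum fun i _ => ?_
        have := hx i
        rw [Real.norm_eq_abs]
        gcongr
    _ = d * R ^ 2 := by simp

lemma volume_box_lt_top (R : ℝ) : volume (box d R) < ⊤ := by
  rcases le_or_gt 0 R with hR | hR
  · exact (measure_mono (box_subset_closedBall R)).trans_lt measure_closedBall_lt_top
  · rcases isEmpty_or_nonempty (Fin d) with h | ⟨⟨i⟩⟩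
    · exact (measure_mono (Set.subset_univ _)).trans_lt
        (by rw [show (Set.univ : Set (Sp d)) = Metric.closedBall 0 0 by
              ext x; simp [Subsingleton.elim x 0]]
            exact measure_closedBall_lt_top)
    · have : box d R = ∅ := by
        ext x; simp only [Set.mem_empty_iff_false, iff_false]
        intro hx
        have := hx i
        linarith [abs_nonneg (x i)]
      simp [this]

lemma volume_box {R : ℝ} (hR : 0 ≤ R) : volume (box d R) = ENNReal.ofReal ((2 * R) ^ d) := by
  have h : box d R = (MeasurableEquiv.toLp 2 (Fin d → ℝ)).symm ⁻¹'
      (Set.univ.pi fun _ => Set.Ioo (-R) R) := by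
    ext x; simp [box, abs_lt]
  rw [h, (EuclideanSpace.volume_preserving_symm_measurableEquiv_toLp (Fin d)).measure_preimage
    (MeasurableSet.univ_pi fun _ => measurableSet_Ioo).nullMeasurableSet, Real.volume_pi_Ioo]
  simp only [sub_neg_eq_add, Finset.prod_const, Finset.card_univ, Fintype.card_fin]
  rw [← ENNReal.ofReal_pow (by linarith)]
  congr 2; ring

lemma volume_cell : volume (cell d) = ENNReal.ofReal (2 ^ d) := by
  have h : cell d = (MeasurableEquiv.toLp 2 (Fin d → ℝ)).symm ⁻¹'
      (Set.univ.pi fun _ => Set.Ico (-1) 1) := by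
    ext x; simp [cell]
  rw [h, (EuclideanSpace.volume_preserving_symm_measurableEquiv_toLp (Fin d)).measure_preimage
    (MeasurableSet.univ_pi fun _ => measurableSet_Ico).nullMeasurableSet, Real.volume_pi_Ico]
  simp only [sub_neg_eq_add, Finset.prod_const, Finset.card_univ, Fintype.card_fin]
  rw [← ENNReal.ofReal_pow (by norm_num)]
  congr 2; ring

lemma box_one_subset_cell : box d 1 ⊆ cell d := fun _ hx i =>
  ⟨(abs_lt.1 (hx i)).1.le, (abs_lt.1 (hx i)).2⟩

lemma box_one_ae_eq_cell : (box d 1 : Set (Sp d)) =ᵐ[volume] cell d := by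
  refine ae_eq_of_subset_of_measure_ge box_one_subset_cell ?_
    (measurableSet_box 1).nullMeasurableSet ?_
  · rw [volume_box zero_le_one, volume_cell, mul_one]
  · rw [volume_cell]; exact ENNReal.ofReal_ne_top

/-- The correctors live on the open cube, whereas only the half-open cell is an exact fundamental
domain of the lattice. This equality allows passing from one to the other inside integrals. -/
lemma restrict_box_one : (volume : Measure (Sp d)).restrict (box d 1) = volume.restrict (cell d) :=
  Measure.restrict_congr_set box_one_ae_eq_cell

/-- Invariance under the period lattice. -/
def LatPeriodic {β : Type*} (f : Sp d → β) : Prop := ∀ x n, f (x + lat n) = f x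

lemma latPeriodic_of_single {β : Type*} {f : Sp d → β}
    (h : ∀ (i : Fin d) x, f (x + EuclideanSpace.single i 2) = f x) : LatPeriodic f := by
  let S : AddSubgroup (Sp d) :=
    { carrier := {v | ∀ x, f (x + v) = f x}
      zero_mem' := fun x => by simp
      add_mem' := fun {a b} ha hb x => by rw [← add_assoc, hb, ha]
      neg_mem' := fun {a} ha x => by rw [← ha (x + -a)]; simp }
  intro x n
  have hm : lat n ∈ S := by
    have : lat n = ∑ i, n i • (EuclideanSpace.single i (2 : ℝ) : Sp d) := by
      ext j
      simp [Finset.sum_apply, Pi.single_apply, mul_comm]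
    rw [this]
    exact S.sum_mem fun i _ => S.zsmul_mem (h i) _
  exact hm x

lemma LatPeriodic.single {β : Type*} {f : Sp d → β} (h : LatPeriodic f) (i : Fin d) (x : Sp d) :
    f (x + EuclideanSpace.single i 2) = f x := by
  have : (EuclideanSpace.single i 2 : Sp d) = lat (Pi.single i 1) := by
    ext j
    by_cases hj : j = i
    · subst hj; simp
    · simp [hj]
  rw [this, h]

lemma LatPeriodic.comp_rep {β : Type*} {f : Sp d → β} (h : LatPeriodic f) (x : Sp d) :
    f (rep x) = f x := by
  conv_rhs => rw [← rep_add_lat_cellIndex x, h]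

lemma latPeriodic_comp_rep {β : Type*} (f : Sp d → β) : LatPeriodic fun x => f (rep x) :=
  fun _ _ => by simp only [rep_add_lat]

/-! ### Unfolding of integrals -/

lemma lintegral_eq_tsum_cell (f : Sp d → ENNReal) :
    ∫⁻ x, f x = ∑' n : Fin d → ℤ, ∫⁻ x in cell d, f (x + lat n) := by
  have hU : (⋃ n : Fin d → ℤ, cellIndex ⁻¹' {n}) = (Set.univ : Set (Sp d)) := by
    ext x; simp
  rw [← setLIntegral_univ, ← hU, lintegral_iUnion
    (fun n => measurable_cellIndex (measurableSet_singleton n))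
    (fun m n hmn => Disjoint.preimage _ (by simpa using hmn))]
  refine tsum_congr fun n => ?_
  have hp : MeasurePreserving (fun x : Sp d => x + lat n) volume volume :=
    measurePreserving_add_right _ _
  have he : MeasurableEmbedding (fun x : Sp d => x + lat n) := measurableEmbedding_addRight _
  rw [← hp.setLIntegral_comp_preimage_emb he]
  congr 2
  ext x
  simp only [Set.mem_preimage, Set.mem_singleton_iff, cellIndex_add_lat, mem_cell_iff]
  simp

/-- The unfolding identity: the weight is replaced by its periodization. Indicators as weights give
translation invariance on the cell and the bound of integrals over `Q_R` by integrals over the cell.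
-/
lemma lintegral_periodic_mul (f W : Sp d → ENNReal) (hf : LatPeriodic f)
    (hfm : AEMeasurable f) (hW : Measurable W) :
    ∫⁻ x, f x * W x = ∫⁻ x in cell d, f x * ∑' n : Fin d → ℤ, W (x + lat n) := by
  rw [lintegral_eq_tsum_cell]
  simp_rw [hf _ _]
  have hm : ∀ n : Fin d → ℤ,
      AEMeasurable (fun x => f x * W (x + lat n)) (volume.restrict (cell d)) :=
    fun n => hfm.restrict.mul (hW.comp (measurable_add_const _)).aemeasurable
  rw [← lintegral_tsum hm]
  simp_rw [ENNReal.tsum_mul_left]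

lemma tsum_indicator_cell (y : Sp d) :
    ∑' n : Fin d → ℤ, (cell d).indicator (fun _ => (1 : ENNReal)) (y + lat n) = 1 := by
  rw [tsum_eq_single (-cellIndex y)]
  · rw [Set.indicator_of_mem]
    rw [mem_cell_iff, cellIndex_add_lat]; simp
  · intro n hn
    rw [Set.indicator_of_notMem]
    rw [mem_cell_iff, cellIndex_add_lat]
    intro h
    exact hn (by rw [eq_neg_iff_add_eq_zero, add_comm, h])

/-- The lattice translates of a shifted cell tile the space, so the periodization of its indicator
is `1`. -/
lemma lintegral_cell_translate (f : Sp d → ENNReal) (hf : LatPeriodic f) (hfm : AEMeasurable f)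
    (a : Sp d) : ∫⁻ x in cell d, f (x + a) = ∫⁻ x in cell d, f x := by
  have h1 : ∫⁻ x in cell d, f (x + a) =
      ∫⁻ x, f x * (cell d).indicator (fun _ => (1 : ENNReal)) (x - a) := by
    rw [← lintegral_indicator measurableSet_cell, ← lintegral_add_right_eq_self
      (fun x => f x * (cell d).indicator (fun _ => (1 : ENNReal)) (x - a)) a]
    refine lintegral_congr fun x => ?_
    by_cases hx : x ∈ cell d <;> simp [hx]
  rw [h1, lintegral_periodic_mul f (fun x => (cell d).indicator (fun _ => (1 : ENNReal)) (x - a))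
    hf hfm ((measurable_const.indicator measurableSet_cell).comp (measurable_sub_const a))]
  refine lintegral_congr fun x => ?_
  have := tsum_indicator_cell (x - a)
  simp_rw [sub_add_eq_add_sub] at this
  rw [this, mul_one]

/-- The number of period cells needed to cover `Q_R`. -/
lemma lintegral_box_le (f : Sp d → ENNReal) (hf : LatPeriodic f) (hfm : AEMeasurable f) {R : ℝ}
    (hR : 0 ≤ R) :
    ∫⁻ x in box d R, f x ≤ ENNReal.ofReal ((R + 2) ^ d) * ∫⁻ x in cell d, f x := by
  have h1 : ∫⁻ x in box d R, f x =
      ∫⁻ x, f x * (box d R).indicator (fun _ => (1 : ENNReal)) x := by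
    rw [← lintegral_indicator (measurableSet_box R)]
    refine lintegral_congr fun x => ?_
    by_cases hx : x ∈ box d R <;> simp [hx]
  rw [h1, lintegral_periodic_mul f _ hf hfm (measurable_const.indicator (measurableSet_box R)),
    ← lintegral_const_mul' _ _ ENNReal.ofReal_ne_top]
  refine setLIntegral_mono' measurableSet_cell fun x hx => ?_
  rw [mul_comm]
  gcongr
  -- For `x` in the cell, `x + 2n ∈ Q_R` forces `|n i| ≤ (R + 1) / 2`. This leaves `2N + 1 ≤ R + 2`
  -- values for each coordinate.
  set N : ℤ := ⌊(R + 1) / 2⌋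
  have hN : 0 ≤ N := Int.floor_nonneg.2 (by linarith)
  have hN' : (N : ℝ) ≤ (R + 1) / 2 := Int.floor_le _
  have hsupp : ∀ n : Fin d → ℤ, n ∉ Fintype.piFinset (fun _ : Fin d => Finset.Icc (-N) N) →
      (box d R).indicator (fun _ => (1 : ENNReal)) (x + lat n) = 0 := by
    intro n hn
    rw [Set.indicator_of_notMem]
    intro hb
    refine hn (Fintype.mem_piFinset.2 fun i => ?_)
    have h2 := abs_lt.1 (hb i)
    simp only [PiLp.add_apply, lat_apply] at h2
    have h3 := hx i
    rw [Finset.mem_Icc]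
    constructor
    · rw [neg_le, Int.le_floor]; push_cast; linarith
    · rw [Int.le_floor]; linarith
  rw [tsum_eq_sum fun n hn => hsupp n hn]
  calc ∑ n ∈ Fintype.piFinset (fun _ : Fin d => Finset.Icc (-N) N),
        (box d R).indicator (fun _ => (1 : ENNReal)) (x + lat n)
      ≤ ∑ n ∈ Fintype.piFinset (fun _ : Fin d => Finset.Icc (-N) N), (1 : ENNReal) :=
        Finset.sum_le_sum fun n _ => Set.indicator_le_self' (by simp) _
    _ = (((2 * N + 1).toNat ^ d : ℕ) : ENNReal) := by
        simp only [Finset.sum_const, Fintype.card_piFinset, Int.card_Icc, Finset.prod_const,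
          Finset.card_univ, Fintype.card_fin, nsmul_eq_mul, mul_one]
        congr 3; ring
    _ ≤ ENNReal.ofReal ((R + 2) ^ d) := by
        rw [← ENNReal.ofReal_natCast]
        refine ENNReal.ofReal_le_ofReal ?_
        push_cast
        have h5 : (((2 * N + 1).toNat : ℕ) : ℝ) = 2 * N + 1 := by
          have : (((2 * N + 1).toNat : ℕ) : ℤ) = 2 * N + 1 := Int.toNat_of_nonneg (by linarith)
          exact_mod_cast this
        rw [h5]
        have : (0 : ℝ) ≤ N := by exact_mod_cast hN
        exact pow_le_pow_left₀ (by linarith) (by linarith) _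

/-- Null sets of the cell propagate to null sets of the whole space. -/
lemma ae_rep {P : Sp d → Prop} (h : ∀ᵐ x ∂(volume.restrict (cell d)), P x) :
    ∀ᵐ x : Sp d, P (rep x) := by
  obtain ⟨s, hs, hsm, hs0⟩ := exists_measurable_superset_of_null (ae_iff.1 h)
  have h1 : (volume : Measure (Sp d)) (rep ⁻¹' s) = 0 := by
    rw [← lintegral_indicator_one (measurable_rep hsm), lintegral_eq_tsum_cell]
    refine ENNReal.tsum_eq_zero.2 fun n => ?_
    have : ∫⁻ x in cell d, (rep ⁻¹' s).indicator (1 : Sp d → ENNReal) (x + lat n) =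
        ∫⁻ x in cell d, s.indicator (1 : Sp d → ENNReal) x := by
      refine setLIntegral_congr_fun measurableSet_cell fun x hx => ?_
      have h2 : rep (x + lat n) = x := by rw [rep_add_lat, rep_of_mem_cell hx]
      by_cases hxs : x ∈ s <;> simp [Set.indicator, h2, hxs]
    rw [this, lintegral_indicator_one hsm, hs0]
  refine ae_iff.2 (measure_mono_null (fun x hx => ?_) h1)
  exact hs hx

/-! ### Filtered sums in one dimension -/

/-- The extension by zero of the restriction of `h` to `(-1,1)`. -/
def zext (h : ℝ → ℝ) : ℝ → ℝ := (Set.Ioo (-1) 1).indicator h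

/-- The Riemann sum of the zero extension of `h` with step `2 / L` through `x / L`. -/
def riemannSum (h : ℝ → ℝ) (L : ℝ) (N : ℕ) (x : ℝ) : ℝ :=
  ∑ j ∈ Finset.range (2 * N + 1), 2 / L * zext h ((x + 2 * ((j : ℝ) - N)) / L)

/-- The Riemann sums of `h` with step `2 / L` approximate the integral up to `B L^{-m}`. -/
def RiemannBound (h : ℝ → ℝ) (B : ℝ) (m : ℕ) : Prop :=
  ∀ (L : ℝ) (N : ℕ) (x : ℝ), 0 < L → L + 1 ≤ 2 * N → |x| ≤ 1 →
    |riemannSum h L N x - ∫ t in (-1 : ℝ)..1, h t| ≤ B * (L ^ m)⁻¹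

lemma integrable_zext {h : ℝ → ℝ} (hh : IntervalIntegrable h volume (-1) 1) :
    Integrable (zext h) := by
  rw [zext, integrable_indicator_iff measurableSet_Ioo]
  exact (intervalIntegrable_iff_integrableOn_Ioo_of_le (by norm_num)).1 hh

lemma integral_zext {h : ℝ → ℝ} {a b : ℝ} (ha : a ≤ -1) (hb : 1 ≤ b) :
    ∫ t in a..b, zext h t = ∫ t in (-1 : ℝ)..1, h t := by
  rw [intervalIntegral.integral_of_le (by linarith), intervalIntegral.integral_of_le (by norm_num),
    zext, setIntegral_indicator measurableSet_Ioo, integral_Ioc_eq_integral_Ioo]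
  congr 2
  ext t; simp only [Set.mem_inter_iff, Set.mem_Ioc, Set.mem_Ioo]
  constructor
  · rintro ⟨-, h⟩; exact h
  · rintro ⟨h1, h2⟩; exact ⟨⟨by linarith, by linarith⟩, h1, h2⟩

/-- On each step the sum and the integral differ by at most the step length times the increment of
`v`, and these increments telescope. -/
lemma riemannBound_of_dominated {g v : ℝ → ℝ} {V : ℝ} (hg : IntervalIntegrable g volume (-1) 1)
    (hv : ∀ a b, a ≤ b → |zext g b - zext g a| ≤ v b - v a) (h0 : ∀ t, 0 ≤ v t)
    (hV : ∀ t, v t ≤ V) : RiemannBound g (2 * V) 1 := by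
  intro L N x hL hN hx
  have hx' := abs_le.1 hx
  set t : ℕ → ℝ := fun j => (x + 2 * ((j : ℝ) - N)) / L with ht
  have hstep : ∀ j, t (j + 1) - t j = 2 / L := by
    intro j; simp only [ht]; push_cast; field_simp; ring
  have hle : ∀ j, t j ≤ t (j + 1) := fun j => by
    have := hstep j
    have h2 : 0 < 2 / L := by positivity
    linarith
  have hint := integrable_zext hg
  -- The condition `L + 1 ≤ 2 * N` and `|x| ≤ 1` place the first node at or below `-1` and the last
  -- at or above `1`, so the whole support is covered.
  have hI : ∫ s in (-1 : ℝ)..1, g s =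
      ∑ j ∈ Finset.range (2 * N + 1), ∫ s in t j..t (j + 1), zext g s := by
    rw [intervalIntegral.sum_integral_adjacent_intervals
      fun j _ => hint.intervalIntegrable, integral_zext]
    · simp only [ht]
      rw [div_le_iff₀ hL]; push_cast; linarith
    · simp only [ht]
      rw [le_div_iff₀ hL]; push_cast; linarith
  have hterm : ∀ j, |2 / L * zext g (t j) - ∫ s in t j..t (j + 1), zext g s| ≤
      2 / L * (v (t (j + 1)) - v (t j)) := by
    intro j
    have h1 : 2 / L * zext g (t j) - ∫ s in t j..t (j + 1), zext g s =
        ∫ s in t j..t (j + 1), (zext g (t j) - zext g s) := by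
      rw [intervalIntegral.integral_sub intervalIntegrable_const hint.intervalIntegrable,
        intervalIntegral.integral_const, hstep, smul_eq_mul]
    rw [h1, ← Real.norm_eq_abs]
    refine (intervalIntegral.norm_integral_le_of_norm_le_const
      (C := v (t (j + 1)) - v (t j)) fun s hs => ?_).trans ?_
    · rw [Set.uIoc_of_le (hle j)] at hs
      rw [Real.norm_eq_abs, abs_sub_comm]
      have h2 := hv _ _ hs.1.le
      have h3 := (abs_nonneg _).trans (hv _ _ hs.2)
      linarith
    · rw [hstep, abs_of_pos (by positivity), mul_comm]
  rw [hI, riemannSum, ← Finset.sum_sub_distrib]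
  refine (Finset.abs_sum_le_sum_abs _ _).trans ((Finset.sum_le_sum fun j _ => hterm j).trans ?_)
  rw [← Finset.mul_sum, Finset.sum_range_sub (fun j => v (t j))]
  have := hV (t (2 * N + 1))
  have := h0 (t 0)
  calc 2 / L * (v (t (2 * N + 1)) - v (t 0)) ≤ 2 / L * V := by gcongr; linarith
    _ = 2 * V * (L ^ 1)⁻¹ := by rw [pow_one]; ring

lemma intervalIntegrable_of_boundedVariationOn {g : ℝ → ℝ} {a b : ℝ} (hab : a ≤ b)
    (hg : BoundedVariationOn g (Set.Icc a b)) : IntervalIntegrable g volume a b := by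
  obtain ⟨p, q, hp, hq, rfl⟩ := hg.locallyBoundedVariationOn.exists_monotoneOn_sub_monotoneOn
  rw [← Set.uIcc_of_le hab] at hp hq
  exact hp.intervalIntegrable.sub hq.intervalIntegrable

/-- The zero extension still has bounded variation: to the Jordan decomposition of `g` one adds the
jumps at `±1`. -/
lemma exists_riemannBound_of_boundedVariationOn {g : ℝ → ℝ}
    (hg : BoundedVariationOn g (Set.Icc (-1) 1)) : ∃ B, RiemannBound g B 1 := by
  have hint := intervalIntegrable_of_boundedVariationOn (by norm_num) hg
  obtain ⟨p, q, hp, hq, rfl⟩ := hg.locallyBoundedVariationOn.exists_monotoneOn_sub_monotoneOn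
  have hm1 : (-1 : ℝ) ∈ Set.Icc (-1 : ℝ) 1 := by norm_num
  have h1 : (1 : ℝ) ∈ Set.Icc (-1 : ℝ) 1 := by norm_num
  set K : ℝ := |p 1| + |p (-1)| + |q 1| + |q (-1)| with hK
  have hK0 : 0 ≤ K := by positivity
  have hb : ∀ t ∈ Set.Ioo (-1 : ℝ) 1, |p t - q t| ≤ K := by
    intro t ht
    have ht' := Set.Ioo_subset_Icc_self ht
    have e1 := hp hm1 ht' ht.1.le
    have e2 := hp ht' h1 ht.2.le
    have e3 := hq hm1 ht' ht.1.le
    have e4 := hq ht' h1 ht.2.le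
    have := le_abs_self (p 1); have := le_abs_self (q 1)
    have := neg_abs_le (p (-1)); have := neg_abs_le (q (-1))
    have := abs_nonneg (p 1); have := abs_nonneg (q 1)
    have := abs_nonneg (p (-1)); have := abs_nonneg (q (-1))
    rw [abs_le]; constructor <;> linarith
  set w : ℝ → ℝ := fun t => p t + q t with hw
  have hwm : MonotoneOn w (Set.Icc (-1) 1) := hp.add hq
  set v : ℝ → ℝ := fun t =>
    -- The function `v` jumps by `K`, a bound for `|g|`, at both ends, where the zero extension may
    -- jump, and grows like `p + q` in between.
    if t ≤ -1 then 0 else if t < 1 then K + (w t - w (-1)) else 2 * K + (w 1 - w (-1)) with hvdef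
  have hw1 : 0 ≤ w 1 - w (-1) := sub_nonneg.2 (hwm hm1 h1 (by norm_num))
  have hz : ∀ t, -1 < t → t < 1 → zext (p - q) t = p t - q t := fun t h h' =>
    Set.indicator_of_mem (Set.mem_Ioo.2 ⟨h, h'⟩) _
  have hz1 : ∀ t, t ≤ -1 → zext (p - q) t = 0 := fun t h =>
    Set.indicator_of_notMem (fun hh => absurd hh.1 (not_lt.2 h)) _
  have hz2 : ∀ t, 1 ≤ t → zext (p - q) t = 0 := fun t h =>
    Set.indicator_of_notMem (fun hh => absurd hh.2 (not_lt.2 h)) _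
  have hv1 : ∀ t, t ≤ -1 → v t = 0 := fun t h => if_pos h
  have hv2 : ∀ t, -1 < t → t < 1 → v t = K + (w t - w (-1)) := fun t h h' => by
    simp only [hvdef]; rw [if_neg (not_le.2 h), if_pos h']
  have hv3 : ∀ t, 1 ≤ t → v t = 2 * K + (w 1 - w (-1)) := fun t h => by
    simp only [hvdef]; rw [if_neg (by linarith), if_neg (not_lt.2 h)]
  have hin : ∀ t, -1 < t → t < 1 → w (-1) ≤ w t ∧ w t ≤ w 1 := fun t h h' =>
    ⟨hwm hm1 ⟨h.le, h'.le⟩ h.le, hwm ⟨h.le, h'.le⟩ h1 h'.le⟩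
  refine ⟨2 * (2 * K + (w 1 - w (-1))), riemannBound_of_dominated (v := v) hint ?_ ?_ ?_⟩
  · intro a b hab
    rcases le_or_gt b (-1) with hb1 | hb1
    · rw [hz1 b hb1, hz1 a (hab.trans hb1), hv1 b hb1, hv1 a (hab.trans hb1)]; simp
    rcases le_or_gt 1 a with ha1 | ha1
    · rw [hz2 a ha1, hz2 b (ha1.trans hab), hv3 a ha1, hv3 b (ha1.trans hab)]; simp
    rcases le_or_gt a (-1) with ha2 | ha2 <;> rcases le_or_gt 1 b with hb2 | hb2
    · rw [hz1 a ha2, hz2 b hb2, hv1 a ha2, hv3 b hb2]; simp; linarith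
    · rw [hz1 a ha2, hz b hb1 hb2, hv1 a ha2, hv2 b hb1 hb2, sub_zero, sub_zero]
      have := hb b ⟨hb1, hb2⟩
      have := hin b hb1 hb2
      linarith
    · rw [hz2 b hb2, hz a ha2 ha1, hv3 b hb2, hv2 a ha2 ha1, zero_sub, abs_neg]
      have := hb a ⟨ha2, ha1⟩
      have := hin a ha2 ha1
      linarith
    · rw [hz a ha2 ha1, hz b hb1 hb2, hv2 b hb1 hb2, hv2 a ha2 ha1]
      have e1 := hp ⟨ha2.le, ha1.le⟩ ⟨hb1.le, hb2.le⟩ hab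
      have e2 := hq ⟨ha2.le, ha1.le⟩ ⟨hb1.le, hb2.le⟩ hab
      simp only [hw]
      rw [abs_le]; constructor <;> linarith
  · intro t
    rcases le_or_gt t (-1) with h | h
    · rw [hv1 t h]
    rcases le_or_gt 1 t with h' | h'
    · rw [hv3 t h']; positivity
    · rw [hv2 t h h']; have := hin t h h'; linarith
  · intro t
    rcases le_or_gt t (-1) with h | h
    · rw [hv1 t h]; positivity
    rcases le_or_gt 1 t with h' | h'
    · rw [hv3 t h']
    · rw [hv2 t h h']; have := hin t h h'; linarith

/-- Since `h` vanishes at both ends, its zero extension has no jumps and is a primitive of the zero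
extension of `g` on the whole line. This is where the vanishing conditions on the filter enter. -/
lemma zext_sub_zext {h g : ℝ → ℝ} (hg : IntervalIntegrable g volume (-1) 1)
    (hh : ∀ x ∈ Set.Icc (-1 : ℝ) 1, h x = ∫ t in (-1 : ℝ)..x, g t) (h1 : h 1 = 0) (a b : ℝ) :
    zext h b - zext h a = ∫ t in a..b, zext g t := by
  have hint := integrable_zext hg
  have key : ∀ x, zext h x = ∫ t in (-1 : ℝ)..x, zext g t := by
    intro x
    rcases le_or_gt x (-1) with hx | hx
    · rw [zext, Set.indicator_of_notMem (fun hh => absurd hh.1 (not_lt.2 hx))]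
      symm
      refine intervalIntegral.integral_zero_ae (Filter.Eventually.of_forall fun t ht => ?_)
      rw [Set.uIoc_of_ge hx] at ht
      exact Set.indicator_of_notMem (fun hh => absurd hh.1 (not_lt.2 ht.2)) _
    rcases le_or_gt 1 x with hx' | hx'
    · rw [zext, Set.indicator_of_notMem (fun hh => absurd hh.2 (not_lt.2 hx')),
        integral_zext le_rfl hx', ← hh 1 (by norm_num), h1]
    · rw [zext, Set.indicator_of_mem (Set.mem_Ioo.2 ⟨hx, hx'⟩), hh x ⟨hx.le, hx'.le⟩]
      rw [intervalIntegral.integral_of_le hx.le, intervalIntegral.integral_of_le hx.le]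
      refine setIntegral_congr_fun measurableSet_Ioc fun t ht => ?_
      exact (Set.indicator_of_mem (Set.mem_Ioo.2 ⟨ht.1, ht.2.trans_lt hx'⟩) _).symm
  rw [key, key, intervalIntegral.integral_interval_sub_left hint.intervalIntegrable
    hint.intervalIntegrable]

/-- As a function of the offset `x`, the sum of `h` is a primitive of `L⁻¹` times the sum of `g`.
The latter is `O(L^{-m})`, because `∫ g = h 1 = 0`. Thus the sum of `h` oscillates by `O(L^{-m-1})`,
and its mean over a period of offsets is exactly `∫ h`. -/
lemma RiemannBound.integrate {h g : ℝ → ℝ} {B : ℝ} {m : ℕ} (hB : RiemannBound g B m)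
    (hg : IntervalIntegrable g volume (-1) 1) (hhi : IntervalIntegrable h volume (-1) 1)
    (hh : ∀ x ∈ Set.Icc (-1 : ℝ) 1, h x = ∫ t in (-1 : ℝ)..x, g t) (h1 : h 1 = 0) :
    RiemannBound h (2 * B) (m + 1) := by
  intro L N x hL hN hx
  have hgi := integrable_zext hg
  have hhi' := integrable_zext hhi
  have hg0 : ∫ t in (-1 : ℝ)..1, g t = 0 := by rw [← hh 1 (by norm_num), h1]
  have hbound : ∀ t, |t| ≤ 1 → |riemannSum g L N t| ≤ B * (L ^ m)⁻¹ := by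
    intro t ht
    have := hB L N t hL hN ht
    rwa [hg0, sub_zero] at this
  have hscale : ∀ (f : ℝ → ℝ), ∀ y z c : ℝ, ∫ t in y..z, 2 / L * zext f ((t + c) / L) =
      2 * ∫ s in (y + c) / L..(z + c) / L, zext f s := by
    intro f y z c
    simp_rw [add_div]
    rw [intervalIntegral.integral_const_mul,
      intervalIntegral.integral_comp_div_add _ hL.ne', smul_eq_mul]
    field_simp
  have hii : ∀ f : ℝ → ℝ, Integrable (zext f) → ∀ y z c : ℝ,
      IntervalIntegrable (fun t => 2 / L * zext f ((t + c) / L)) volume y z := by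
    intro f hf y z c
    have : Integrable fun t => zext f ((t + c) / L) := (hf.comp_div hL.ne').comp_add_right c
    exact (this.const_mul _).intervalIntegrable
  have hdiff : ∀ y z, riemannSum h L N z - riemannSum h L N y =
      L⁻¹ * ∫ t in y..z, riemannSum g L N t := by
    intro y z
    simp only [riemannSum]
    rw [intervalIntegral.integral_finsetSum fun j _ => hii g hgi _ _ _, ← Finset.sum_sub_distrib,
      Finset.mul_sum]
    refine Finset.sum_congr rfl fun j _ => ?_
    rw [hscale, ← zext_sub_zext hg hh h1]
    field_simp
  have hosc : ∀ y, |y| ≤ 1 → |riemannSum h L N x - riemannSum h L N y| ≤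
      2 * B * (L ^ (m + 1))⁻¹ := by
    intro y hy
    rw [hdiff, abs_mul, abs_of_pos (inv_pos.2 hL), ← Real.norm_eq_abs]
    have e1 := intervalIntegral.norm_integral_le_of_norm_le_const (a := y) (b := x)
      (f := riemannSum g L N) (C := B * (L ^ m)⁻¹) fun t ht => by
        rw [Real.norm_eq_abs]
        refine hbound t ?_
        rw [abs_le] at hx hy ⊢
        rw [Set.mem_uIoc] at ht
        rcases ht with ht | ht <;> constructor <;> linarith
    have e0 : 0 ≤ B * (L ^ m)⁻¹ := (abs_nonneg _).trans (hbound 0 (by simp))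
    have e2 : |x - y| ≤ 2 := by
      rw [abs_le] at hx hy ⊢; constructor <;> linarith
    calc L⁻¹ * ‖∫ t in y..x, riemannSum g L N t‖
        ≤ L⁻¹ * (B * (L ^ m)⁻¹ * 2) := by
          refine mul_le_mul_of_nonneg_left (e1.trans ?_) (by positivity)
          exact mul_le_mul_of_nonneg_left e2 e0
      _ = 2 * B * (L ^ (m + 1))⁻¹ := by rw [pow_succ, mul_inv]; ring
  -- As the offset runs through `[-1,1]`, the node of index `j` sweeps the interval from `a j` to `a
  -- (j + 1)`; these intervals are adjacent and cover the support.
  have hmean : ∫ y in (-1 : ℝ)..1, riemannSum h L N y = 2 * ∫ t in (-1 : ℝ)..1, h t := by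
    simp only [riemannSum]
    rw [intervalIntegral.integral_finsetSum fun j _ => hii h hhi' _ _ _]
    simp_rw [hscale]
    rw [← Finset.mul_sum]
    set a : ℕ → ℝ := fun j => (-1 + 2 * ((j : ℝ) - N)) / L with ha
    have e1 : ∀ j : ℕ, (1 + 2 * ((j : ℝ) - N)) / L = a (j + 1) := by
      intro j; simp only [ha]; push_cast; ring
    simp_rw [e1]
    change 2 * ∑ j ∈ Finset.range (2 * N + 1), ∫ s in a j..a (j + 1), zext h s = _
    rw [intervalIntegral.sum_integral_adjacent_intervals
      fun j _ => hhi'.intervalIntegrable, integral_zext]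
    · simp only [ha]
      rw [div_le_iff₀ hL]; push_cast; linarith
    · simp only [ha]
      rw [le_div_iff₀ hL]; push_cast; linarith
  have hSi : IntervalIntegrable (riemannSum h L N) volume (-1) 1 := by
    have : riemannSum h L N = ∑ j ∈ Finset.range (2 * N + 1),
        fun t => 2 / L * zext h ((t + 2 * ((j : ℝ) - N)) / L) := by
      funext t; simp [riemannSum]
    rw [this]
    exact IntervalIntegrable.sum _ fun j _ => hii h hhi' _ _ _
  have e3 : 2 * (riemannSum h L N x - ∫ t in (-1 : ℝ)..1, h t) =
      ∫ y in (-1 : ℝ)..1, (riemannSum h L N x - riemannSum h L N y) := by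
    rw [intervalIntegral.integral_sub intervalIntegrable_const hSi, hmean,
      intervalIntegral.integral_const, smul_eq_mul]
    ring
  have e4 := intervalIntegral.norm_integral_le_of_norm_le_const (a := -1) (b := 1)
    (f := fun y => riemannSum h L N x - riemannSum h L N y) (C := 2 * B * (L ^ (m + 1))⁻¹)
    fun y hy => by
      rw [Real.norm_eq_abs]
      refine hosc y ?_
      rw [Set.uIoc_of_le (by norm_num)] at hy
      rw [abs_le]; exact ⟨hy.1.le, hy.2⟩
  rw [← e3, Real.norm_eq_abs, abs_mul, show |(1 : ℝ) - -1| = 2 by norm_num,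
    abs_of_pos (two_pos : (0 : ℝ) < 2)] at e4
  linarith

lemma IsFilter.boundedVariationOn {p : ℕ} {μ : ℝ → ℝ} (hμ : IsFilter p μ) :
    BoundedVariationOn μ (Set.Icc (-1) 1) := by
  have hm : MonotoneOn μ (Set.Icc (-1) 0) := by
    intro a ha b hb hab
    have h1 := hμ.antitone (a := -b) (b := -a) ⟨by linarith [hb.2], by linarith [hb.1]⟩
      ⟨by linarith [ha.2], by linarith [ha.1]⟩ (by linarith)
    rwa [hμ.even a ⟨ha.1, by linarith [ha.2]⟩, hμ.even b ⟨hb.1, by linarith [hb.2]⟩] at h1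
  have h1 : eVariationOn μ (Set.Icc (-1) 0) ≠ ⊤ := by
    have := hm.eVariationOn_eq (a := -1) (b := 0) (by simp) (by simp)
    rw [Set.inter_self] at this
    exact this ▸ ENNReal.ofReal_ne_top
  have h2 : eVariationOn μ (Set.Icc 0 1) ≠ ⊤ := by
    have hn : MonotoneOn (fun x => -μ x) (Set.Icc 0 1) := hμ.antitone.neg
    have := hn.eVariationOn_eq (a := 0) (b := 1) (by simp) (by simp)
    rw [Set.inter_self] at this
    have h3 : eVariationOn (fun x => -μ x) (Set.Icc 0 1) = eVariationOn μ (Set.Icc 0 1) := by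
      simp only [eVariationOn, edist_neg_neg]
    rw [h3] at this
    exact this ▸ ENNReal.ofReal_ne_top
  have h3 := eVariationOn.Icc_add_Icc μ (s := Set.univ) (a := -1) (b := 0) (c := 1)
    (by norm_num) (by norm_num) trivial
  simp only [Set.univ_inter] at h3
  rw [BoundedVariationOn, ← h3]
  exact ENNReal.add_ne_top.2 ⟨h1, h2⟩

/-- The Riemann sums of a filter of order `p` converge at the rate `L^{-(p+1)}`. -/
lemma IsFilter.exists_riemannBound {p : ℕ} {μ : ℝ → ℝ} (hμ : IsFilter p μ) :
    ∃ B, RiemannBound μ B (p + 1) := by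
  rcases p with _ | q
  · exact exists_riemannBound_of_boundedVariationOn hμ.boundedVariationOn
  obtain ⟨hC, g, hg, hgi⟩ := hμ.regularity q rfl
  set I : Set ℝ := Set.Icc (-1) 1 with hI
  set h : ℕ → ℝ → ℝ := fun j => iteratedDerivWithin j μ I with hh
  have hu : UniqueDiffOn ℝ I := uniqueDiffOn_Icc (by norm_num)
  have hcont : ∀ j ≤ q, ContinuousOn (h j) I := fun j hj =>
    hC.continuousOn_iteratedDerivWithin (by exact_mod_cast hj) hu
  have hint : ∀ j ≤ q, IntervalIntegrable (h j) volume (-1) 1 := fun j hj => by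
    refine ContinuousOn.intervalIntegrable ?_
    rw [Set.uIcc_of_le (by norm_num)]; exact hcont j hj
  -- The bounded variation of `g = μ^{(q+1)}` yields order one, and one integration yields order two
  -- for `μ^{(q)}`.
  have hq : ∃ B, RiemannBound (h q) B 2 := by
    obtain ⟨B, hB⟩ := exists_riemannBound_of_boundedVariationOn hg
    refine ⟨2 * B, hB.integrate (intervalIntegrable_of_boundedVariationOn (by norm_num) hg)
      (hint q le_rfl) (fun x hx => ?_) (hμ.vanish q (Nat.lt_succ_self q)).2⟩
    have := hgi x hx
    rw [(hμ.vanish q (Nat.lt_succ_self q)).1, zero_add] at this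
    exact this
  -- Descent from `μ^{(q)}` to `μ`: every integration lowers the order of the derivative by one and
  -- raises the rate by one.
  have hstep : ∀ i ≤ q, ∃ B, RiemannBound (h (q - i)) B (i + 2) := by
    intro i
    induction i with
    | zero => intro _; simpa using hq
    | succ i ih =>
      intro hi
      obtain ⟨B, hB⟩ := ih (by omega)
      obtain ⟨j, hj⟩ : ∃ j, j = q - (i + 1) := ⟨_, rfl⟩
      have hj1 : q - i = j + 1 := by omega
      rw [hj1] at hB
      rw [← hj]
      refine ⟨2 * B, hB.integrate (hint _ (by omega)) (hint _ (by omega)) (fun x hx => ?_)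
        (hμ.vanish j (by omega)).2⟩
      have h0 : h j (-1) = 0 := (hμ.vanish j (by omega)).1
      have hFT := intervalIntegral.integral_eq_sub_of_hasDerivAt_of_le (f := h j) (f' := h (j + 1))
        (a := -1) (b := x) hx.1 ((hcont j (by omega)).mono (Set.Icc_subset_Icc le_rfl hx.2))
        (fun t ht => ?_) ((hint (j + 1) (by omega)).mono_set ?_)
      · rw [hFT, h0, sub_zero]
      · have htI : t ∈ I := ⟨ht.1.le, ht.2.le.trans hx.2⟩
        have hnhds : I ∈ nhds t := Icc_mem_nhds ht.1 (ht.2.trans_le hx.2)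
        have hd : DifferentiableWithinAt ℝ (h j) I t :=
          (hC.differentiableOn_iteratedDerivWithin (by exact_mod_cast (by omega : j < q)) hu) t htI
        have h2 := hd.hasDerivWithinAt.hasDerivAt hnhds
        simpa only [hh, iteratedDerivWithin_succ] using h2
      · rw [Set.uIcc_of_le hx.1, Set.uIcc_of_le (by norm_num)]
        exact Set.Icc_subset_Icc le_rfl hx.2
  obtain ⟨B, hB⟩ := hstep q le_rfl
  refine ⟨B, ?_⟩
  simpa [hh] using hB

/-! ### Filtered averages of periodic functions -/

lemma IsFilter.zext_nonneg {p : ℕ} {μ : ℝ → ℝ} (hμ : IsFilter p μ) (t : ℝ) : 0 ≤ zext μ t :=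
  Set.indicator_nonneg (fun t ht => hμ.nonneg t (Set.Ioo_subset_Icc_self ht)) t

lemma IsFilter.zext_le {p : ℕ} {μ : ℝ → ℝ} (hμ : IsFilter p μ) (t : ℝ) : zext μ t ≤ μ 0 := by
  refine Set.indicator_le' (fun t ht => ?_) (fun t _ => hμ.nonneg 0 (by norm_num)) t
  rcases le_total 0 t with h | h
  · exact hμ.antitone (by norm_num) ⟨h, ht.2.le⟩ h
  · rw [← hμ.even t (Set.Ioo_subset_Icc_self ht)]
    exact hμ.antitone (by norm_num) ⟨by linarith, by linarith [ht.1]⟩ (by linarith)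

lemma IsFilter.measurable_zext {p : ℕ} {μ : ℝ → ℝ} (hμ : IsFilter p μ) : Measurable (zext μ) := by
  have h1 : Continuous (Set.IccExtend (by norm_num : (-1 : ℝ) ≤ 1) ((Set.Icc (-1) 1).domRestrict μ)) :=
    (continuousOn_iff_continuous_domRestrict.1 hμ.continuous).Icc_extend'
  have h2 : zext μ = (Set.Ioo (-1) 1).indicator
      (Set.IccExtend (by norm_num : (-1 : ℝ) ≤ 1) ((Set.Icc (-1) 1).domRestrict μ)) := by
    funext t
    by_cases ht : t ∈ Set.Ioo (-1 : ℝ) 1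
    · rw [zext, Set.indicator_of_mem ht, Set.indicator_of_mem ht,
        Set.IccExtend_of_mem _ _ (Set.Ioo_subset_Icc_self ht)]
      rfl
    · rw [zext, Set.indicator_of_notMem ht, Set.indicator_of_notMem ht]
  rw [h2]
  exact h1.measurable.indicator measurableSet_Ioo

/-- The rescaled filter, extended by zero outside `Q_L`. -/
def zextFilter (d : ℕ) (μ : ℝ → ℝ) (L : ℝ) (x : Sp d) : ℝ :=
  ∏ i, L⁻¹ * zext μ (x i / L)

lemma zextFilter_eq_indicator (μ : ℝ → ℝ) {L : ℝ} (hL : 0 < L) :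
    zextFilter d μ L = (box d L).indicator (scaledFilter d μ L) := by
  funext x
  have hmem : ∀ i, |x i| < L ↔ x i / L ∈ Set.Ioo (-1 : ℝ) 1 := fun i => by
    rw [abs_lt, Set.mem_Ioo, lt_div_iff₀ hL, div_lt_iff₀ hL]; simp
  by_cases hx : x ∈ box d L
  · rw [Set.indicator_of_mem hx, zextFilter, scaledFilter, Finset.prod_mul_distrib]
    congr 1
    · simp
    · exact Finset.prod_congr rfl fun i _ => Set.indicator_of_mem ((hmem i).1 (hx i)) _
  · rw [Set.indicator_of_notMem hx, zextFilter]
    obtain ⟨i, hi⟩ := not_forall.1 hx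
    refine Finset.prod_eq_zero (Finset.mem_univ i) ?_
    rw [zext, Set.indicator_of_notMem (fun h => hi ((hmem i).2 h)), mul_zero]

lemma IsFilter.measurable_zextFilter {p : ℕ} {μ : ℝ → ℝ} (hμ : IsFilter p μ) (L : ℝ) :
    Measurable (zextFilter d μ L) :=
  Finset.measurable_prod _ fun i _ =>
    (hμ.measurable_zext.comp ((measurable_coord i).div_const L)).const_mul _

lemma IsFilter.zextFilter_nonneg {p : ℕ} {μ : ℝ → ℝ} (hμ : IsFilter p μ) {L : ℝ} (hL : 0 < L)
    (x : Sp d) : 0 ≤ zextFilter d μ L x :=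
  Finset.prod_nonneg fun _ _ => mul_nonneg (inv_nonneg.2 hL.le) (hμ.zext_nonneg _)

lemma IsFilter.zextFilter_le {p : ℕ} {μ : ℝ → ℝ} (hμ : IsFilter p μ) {L : ℝ} (hL : 0 < L)
    (x : Sp d) : zextFilter d μ L x ≤ μ 0 ^ d * (L ^ d)⁻¹ := by
  calc zextFilter d μ L x ≤ ∏ _ : Fin d, L⁻¹ * μ 0 :=
        Finset.prod_le_prod (fun _ _ => mul_nonneg (inv_nonneg.2 hL.le) (hμ.zext_nonneg _))
          fun _ _ => mul_le_mul_of_nonneg_left (hμ.zext_le _) (inv_nonneg.2 hL.le)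
    _ = μ 0 ^ d * (L ^ d)⁻¹ := by simp [mul_pow, mul_comm]

lemma LatPeriodic.aestronglyMeasurable {E : Type*} [NormedAddCommGroup E] {f : Sp d → E}
    (hf : LatPeriodic f) (hm : AEStronglyMeasurable f (volume.restrict (cell d))) :
    AEStronglyMeasurable f volume := by
  refine ⟨fun x => hm.mk f (rep x), hm.stronglyMeasurable_mk.comp_measurable measurable_rep, ?_⟩
  filter_upwards [ae_rep hm.ae_eq_mk] with x hx
  rw [← hf.comp_rep x, hx]

lemma LatPeriodic.integrableOn_box {E : Type*} [NormedAddCommGroup E] {f : Sp d → E}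
    (hf : LatPeriodic f) (hi : IntegrableOn f (cell d)) {R : ℝ} (hR : 0 ≤ R) :
    IntegrableOn f (box d R) := by
  have hm := hf.aestronglyMeasurable hi.aestronglyMeasurable
  refine ⟨hm.restrict, ?_⟩
  have h1 := lintegral_box_le (fun x => ‖f x‖ₑ) (fun x n => by simp only [hf x n]) hm.enorm hR
  exact h1.trans_lt (ENNReal.mul_lt_top ENNReal.ofReal_lt_top hi.2)

/-- The lattice points in a cube. -/
def latCube (d N : ℕ) : Finset (Fin d → ℤ) :=
  Fintype.piFinset fun _ : Fin d => Finset.Icc (-(N : ℤ)) N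

lemma add_lat_notMem_box {R M : ℝ} {N : ℕ} (hN : R + M ≤ 2 * N) {x : Sp d} (hx : ∀ i, |x i| ≤ M)
    {n : Fin d → ℤ} (hn : n ∉ latCube d N) : x + lat n ∉ box d R := by
  intro hb
  refine hn (Fintype.mem_piFinset.2 fun i => ?_)
  have h2 := abs_lt.1 (hb i)
  simp only [PiLp.add_apply, lat_apply] at h2
  have h3 := abs_le.1 (hx i)
  rw [Finset.mem_Icc]
  have e1 : (-(N : ℝ)) ≤ n i := by linarith
  have e2 : ((n i : ℤ) : ℝ) ≤ N := by linarith
  exact ⟨by exact_mod_cast e1, by exact_mod_cast e2⟩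

lemma abs_le_one_of_mem_cell {x : Sp d} (hx : x ∈ cell d) (i : Fin d) : |x i| ≤ 1 :=
  abs_le.2 ⟨(hx i).1, (hx i).2.le⟩

lemma integral_eq_sum_cell {E : Type*} [NormedAddCommGroup E] [NormedSpace ℝ E] {F : Sp d → E}
    (hF : Integrable F) {R : ℝ} {N : ℕ} (hN : R + 1 ≤ 2 * N) (h0 : ∀ x, x ∉ box d R → F x = 0) :
    ∫ x, F x = ∫ x in cell d, ∑ n ∈ latCube d N, F (x + lat n) := by
  have hcellm : ∀ n : Fin d → ℤ, MeasurableSet (cellIndex ⁻¹' {n} : Set (Sp d)) :=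
    fun n => measurable_cellIndex (measurableSet_singleton n)
  have hU : (⋃ n : Fin d → ℤ, cellIndex ⁻¹' {n}) = (Set.univ : Set (Sp d)) := by
    ext x; simp
  have hsum := hasSum_integral_iUnion (f := F) (μ := volume) hcellm
    (fun m n hmn => Disjoint.preimage _ (by simpa using hmn)) (by rw [hU]; exact hF.integrableOn)
  rw [hU, setIntegral_univ] at hsum
  have hpull : ∀ n : Fin d → ℤ, ∫ x in cellIndex ⁻¹' {n}, F x =
      ∫ x in cell d, F (x + lat n) := by
    intro n
    have hp : MeasurePreserving (fun x : Sp d => x + lat n) volume volume :=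
      measurePreserving_add_right _ _
    have he : MeasurableEmbedding (fun x : Sp d => x + lat n) := measurableEmbedding_addRight _
    rw [← hp.setIntegral_preimage_emb he]
    have hs : (fun x : Sp d => x + lat n) ⁻¹' (cellIndex ⁻¹' {n}) = cell d := by
      ext x
      simp only [Set.mem_preimage, Set.mem_singleton_iff, cellIndex_add_lat, mem_cell_iff]
      simp
    rw [hs]
  rw [← hsum.tsum_eq, tsum_congr hpull, tsum_eq_sum (s := latCube d N),
    ← integral_finsetSum _ fun n _ => (hF.comp_add_right (lat n)).integrableOn]
  intro n hn
  rw [setIntegral_congr_fun (g := fun _ => 0) measurableSet_cell fun x hx =>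
    h0 _ (add_lat_notMem_box hN (abs_le_one_of_mem_cell hx) hn)]
  simp

/-- The product form of the filter makes its periodization factorize over the coordinates. Each
factor is a sum with weight `L⁻¹` instead of the step `2 / L`, which explains `2⁻¹`. -/
lemma integral_zextFilter_smul {p : ℕ} {μ : ℝ → ℝ} (hμ : IsFilter p μ) {E : Type*}
    [NormedAddCommGroup E] [NormedSpace ℝ E] {ψ : Sp d → E} (hψ : LatPeriodic ψ)
    (hi : IntegrableOn ψ (cell d)) {L : ℝ} (hL : 0 < L) {N : ℕ} (hN : L + 1 ≤ 2 * N) :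
    ∫ x in box d L, scaledFilter d μ L x • ψ x =
      ∫ x in cell d, (∏ i, (2⁻¹ * riemannSum μ L N (x i))) • ψ x := by
  set W := zextFilter d μ L with hW
  have hWi : IntegrableOn (fun x => W x • ψ x) (box d L) := by
    refine Integrable.bdd_smul (C := μ 0 ^ d * (L ^ d)⁻¹) (hψ.integrableOn_box hi hL.le)
      (hμ.measurable_zextFilter L).aestronglyMeasurable (Filter.Eventually.of_forall fun x => ?_)
    rw [Real.norm_of_nonneg (hμ.zextFilter_nonneg hL x)]
    exact hμ.zextFilter_le hL x
  have hind : (fun x => W x • ψ x) = (box d L).indicator fun x => scaledFilter d μ L x • ψ x := by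
    funext x
    simp only [hW]
    rw [zextFilter_eq_indicator μ hL]
    by_cases hx : x ∈ box d L <;> simp [hx]
  have h0 : ∀ x, x ∉ box d L → W x • ψ x = 0 := fun x hx => by
    rw [hW, zextFilter_eq_indicator μ hL, Set.indicator_of_notMem hx, zero_smul]
  have hWint : Integrable (fun x => W x • ψ x) :=
    (integrableOn_iff_integrable_of_support_subset fun x hx =>
      by_contra fun h => hx (h0 x h)).1 hWi
  have hLHS : ∫ x in box d L, scaledFilter d μ L x • ψ x = ∫ x, W x • ψ x := by
    rw [hind, integral_indicator (measurableSet_box L)]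
  rw [hLHS, integral_eq_sum_cell hWint hN h0]
  refine setIntegral_congr_fun measurableSet_cell fun x hx => ?_
  simp only [hψ x]
  rw [← Finset.sum_smul]
  congr 1
  simp only [hW, zextFilter, PiLp.add_apply, lat_apply]
  rw [latCube, ← Finset.prod_univ_sum (fun _ => Finset.Icc (-(N : ℤ)) N)
    (fun i k => L⁻¹ * zext μ ((x i + 2 * (k : ℝ)) / L))]
  refine Finset.prod_congr rfl fun i _ => ?_
  rw [riemannSum, Finset.mul_sum]
  symm
  -- The indices `0, …, 2N` of the Riemann sum correspond to the integers `-N, …, N`.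
  refine Finset.sum_bij (fun j _ => (j : ℤ) - N) (fun j hj => ?_) (fun a _ b _ h => by simpa using h)
    (fun k hk => ⟨(k + N).toNat, ?_, ?_⟩) fun j _ => ?_
  · rw [Finset.mem_range] at hj; rw [Finset.mem_Icc]; omega
  · rw [Finset.mem_Icc] at hk; rw [Finset.mem_range]; omega
  · rw [Finset.mem_Icc] at hk; omega
  · push_cast; ring

lemma abs_prod_sub_pow_le {ι : Type*} (s : Finset ι) (a : ι → ℝ) {b ε M : ℝ} (hM : 1 ≤ M)
    (hε : 0 ≤ ε) (hb : |b| ≤ M) (ha : ∀ i ∈ s, |a i| ≤ M) (hab : ∀ i ∈ s, |a i - b| ≤ ε) :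
    |∏ i ∈ s, a i - b ^ s.card| ≤ s.card * M ^ s.card * ε := by
  classical
  induction s using Finset.induction_on with
  | empty => simp
  | insert i s hi ih =>
    have ih' := ih (fun j hj => ha j (Finset.mem_insert_of_mem hj))
      fun j hj => hab j (Finset.mem_insert_of_mem hj)
    rw [Finset.prod_insert hi, Finset.card_insert_of_notMem hi, pow_succ]
    have e : a i * ∏ j ∈ s, a j - b ^ s.card * b =
        a i * (∏ j ∈ s, a j - b ^ s.card) + (a i - b) * b ^ s.card := by ring
    have hb' : |b| ^ s.card ≤ M ^ s.card := pow_le_pow_left₀ (abs_nonneg _) hb _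
    have hMp : M ^ s.card ≤ M ^ s.card * M := le_mul_of_one_le_right (by positivity) hM
    calc |a i * ∏ j ∈ s, a j - b ^ s.card * b|
        ≤ |a i| * |∏ j ∈ s, a j - b ^ s.card| + |a i - b| * |b| ^ s.card := by
          rw [e]; refine (abs_add_le _ _).trans ?_
          rw [abs_mul, abs_mul, abs_pow]
      _ ≤ M * (s.card * M ^ s.card * ε) + ε * (M ^ s.card * M) := by
          refine add_le_add (mul_le_mul (ha i (Finset.mem_insert_self _ _)) ih' (abs_nonneg _)
            (by linarith)) (mul_le_mul (hab i (Finset.mem_insert_self _ _)) (hb'.trans hMp)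
            (by positivity) hε)
      _ = ((s.card + 1 : ℕ) : ℝ) * (M ^ s.card * M) * ε := by push_cast; ring

/-- Filtered averages of periodic functions converge at the rate `L^{-(p+1)}`. -/
lemma IsFilter.exists_average_bound {p : ℕ} {μ : ℝ → ℝ} (hμ : IsFilter p μ) (d : ℕ) {L₀ : ℝ}
    (hL₀ : 0 < L₀) : ∃ C, 0 ≤ C ∧ ∀ {E : Type} [NormedAddCommGroup E] [NormedSpace ℝ E]
      [CompleteSpace E] (ψ : Sp d → E), LatPeriodic ψ → IntegrableOn ψ (cell d) →
      ∀ L, L₀ ≤ L →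
        ‖(∫ x in box d L, scaledFilter d μ L x • ψ x) - ⨍ x in cell d, ψ x‖ ≤
          C * (L ^ (p + 1))⁻¹ * ∫ x in cell d, ‖ψ x‖ := by
  obtain ⟨B, hB⟩ := hμ.exists_riemannBound
  -- A bound for all factors `2⁻¹ * riemannSum`, uniform in `L ≥ L₀`; it is needed to compare their
  -- product with `2⁻¹ ^ d`.
  set M : ℝ := 1 + |B| * (L₀ ^ (p + 1))⁻¹ with hM
  have hM1 : 1 ≤ M := by rw [hM]; have : 0 ≤ |B| * (L₀ ^ (p + 1))⁻¹ := by positivity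
                         linarith
  refine ⟨d * M ^ d * |B|, by positivity, ?_⟩
  intro E _ _ _ ψ hψ hi L hL
  have hLpos : 0 < L := hL₀.trans_le hL
  obtain ⟨N, hN⟩ := exists_nat_ge ((L + 1) / 2)
  have hN' : L + 1 ≤ 2 * N := by linarith
  rw [integral_zextFilter_smul hμ hψ hi hLpos hN']
  have hvol : (volume : Measure (Sp d)).real (cell d) = 2 ^ d := by
    rw [measureReal_def, volume_cell, ENNReal.toReal_ofReal (by positivity)]
  have hdev : ∀ x ∈ cell d, |∏ i, (2⁻¹ * riemannSum μ L N (x i)) - 2⁻¹ ^ d| ≤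
      d * M ^ d * |B| * (L ^ (p + 1))⁻¹ := by
    intro x hx
    have hr : ∀ i, |riemannSum μ L N (x i) - 1| ≤ |B| * (L ^ (p + 1))⁻¹ := fun i => by
      have := hB L N (x i) hLpos hN' (abs_le.2 ⟨(hx i).1, (hx i).2.le⟩)
      rw [hμ.mass] at this
      exact this.trans (mul_le_mul_of_nonneg_right (le_abs_self B) (by positivity))
    have hε : |B| * (L ^ (p + 1))⁻¹ ≤ |B| * (L₀ ^ (p + 1))⁻¹ := by gcongr
    have := abs_prod_sub_pow_le Finset.univ (fun i => 2⁻¹ * riemannSum μ L N (x i)) (b := 2⁻¹)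
      (ε := |B| * (L ^ (p + 1))⁻¹) hM1 (by positivity)
      (by rw [abs_of_pos (by norm_num)]; linarith) (fun i _ => ?_) (fun i _ => ?_)
    · simp only [Finset.card_univ, Fintype.card_fin] at this
      exact this.trans_eq (by ring)
    · have h1 := hr i
      rw [abs_le] at h1 ⊢
      constructor <;> linarith
    · have h1 := hr i
      have h0 : 0 ≤ |B| * (L ^ (p + 1))⁻¹ := by positivity
      rw [abs_le] at h1 ⊢
      constructor <;> linarith
  have hrm : Measurable (riemannSum μ L N) := by
    refine Finset.measurable_sum _ fun j _ => ?_
    exact (hμ.measurable_zext.comp ((measurable_id.add_const _).div_const L)).const_mul _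
  have hPm : Measurable fun x : Sp d => ∏ i, (2⁻¹ * riemannSum μ L N (x i)) - 2⁻¹ ^ d :=
    (Finset.measurable_prod _ fun i _ => (hrm.comp (measurable_coord i)).const_mul _).sub_const _
  have hPi : IntegrableOn (fun x : Sp d =>
      (∏ i, (2⁻¹ * riemannSum μ L N (x i)) - 2⁻¹ ^ d) • ψ x) (cell d) := by
    refine Integrable.bdd_smul (C := d * M ^ d * |B| * (L ^ (p + 1))⁻¹) hi
      hPm.aestronglyMeasurable ?_
    exact (ae_restrict_iff' measurableSet_cell).2 (Filter.Eventually.of_forall hdev)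
  have hsplit : (∫ x in cell d, (∏ i, (2⁻¹ * riemannSum μ L N (x i))) • ψ x) -
      ⨍ x in cell d, ψ x =
      ∫ x in cell d, (∏ i, (2⁻¹ * riemannSum μ L N (x i)) - 2⁻¹ ^ d) • ψ x := by
    have hi2 : IntegrableOn (fun x => (2 ^ d : ℝ)⁻¹ • ψ x) (cell d) := hi.smul _
    rw [setAverage_eq, hvol, ← integral_smul, sub_eq_iff_eq_add, ← integral_add hPi hi2]
    refine integral_congr_ae (Filter.Eventually.of_forall fun x => ?_)
    simp only
    rw [← add_smul, inv_pow, sub_add_cancel]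
  rw [hsplit]
  refine (norm_integral_le_integral_norm _).trans ?_
  rw [← integral_const_mul]
  refine setIntegral_mono_on hPi.norm (hi.norm.const_mul _) measurableSet_cell fun x hx => ?_
  rw [norm_smul]
  exact mul_le_mul_of_nonneg_right (hdev x hx) (norm_nonneg _)

/-! ### Richardson extrapolation -/

/-- The coefficients of the Richardson extrapolation. -/
def richardsonCoeff : ℕ → ℕ → ℝ
  | 0, _ => 0
  | 1, j => if j = 0 then 1 else 0
  | (n + 2), j => ((2 : ℝ) ^ (n + 1) - 1)⁻¹ *
      ((2 : ℝ) ^ (n + 1) * (if j = 0 then 0 else richardsonCoeff (n + 1) (j - 1)) -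
        richardsonCoeff (n + 1) j)

lemma richardsonCoeff_eq_zero (k : ℕ) : ∀ j, k ≤ j → richardsonCoeff k j = 0 := by
  induction k using Nat.strong_induction_on with
  | _ k ih =>
    match k with
    | 0 => intro j _; rfl
    | 1 => intro j hj; simp only [richardsonCoeff]; rw [if_neg (by omega)]
    | (n + 2) =>
      intro j hj
      simp only [richardsonCoeff]
      rw [if_neg (by omega), ih (n + 1) (by omega) (j - 1) (by omega),
        ih (n + 1) (by omega) j (by omega)]
      simp

/-- Only the parameters `T, 2T, …, 2^{k-1} T` occur. The largest of them determines the rate of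
exponential decay in the theorem. -/
lemma richardson_eq_sum {V : Type*} [AddCommGroup V] [Module ℝ V] (f : ℝ → V) (k : ℕ) :
    ∀ T, richardson f k T = ∑ j ∈ Finset.range k, richardsonCoeff k j • f (2 ^ j * T) := by
  induction k using Nat.strong_induction_on with
  | _ k ih =>
    match k with
    | 0 => intro T; simp [richardson]
    | 1 => intro T; simp [richardson, richardsonCoeff]
    | (n + 2) =>
      intro T
      simp only [richardson]
      rw [ih (n + 1) (by omega), ih (n + 1) (by omega)]
      have h1 : ∑ j ∈ Finset.range (n + 1), richardsonCoeff (n + 1) j • f (2 ^ j * (2 * T)) =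
          ∑ j ∈ Finset.range (n + 2),
            (if j = 0 then 0 else richardsonCoeff (n + 1) (j - 1)) • f (2 ^ j * T) := by
        rw [Finset.sum_range_succ' _ (n + 1)]
        simp only [if_true, zero_smul, add_zero, Nat.add_eq_zero_iff, one_ne_zero, and_false,
          if_false, Nat.add_sub_cancel]
        refine Finset.sum_congr rfl fun j _ => ?_
        rw [pow_succ, mul_assoc]
      have h2 : ∑ j ∈ Finset.range (n + 1), richardsonCoeff (n + 1) j • f (2 ^ j * T) =
          ∑ j ∈ Finset.range (n + 2), richardsonCoeff (n + 1) j • f (2 ^ j * T) := by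
        rw [Finset.sum_range_succ _ (n + 1), richardsonCoeff_eq_zero (n + 1) (n + 1) le_rfl]
        simp
      rw [h1, h2, Finset.smul_sum, ← Finset.sum_sub_distrib, Finset.smul_sum]
      refine Finset.sum_congr rfl fun j _ => ?_
      simp only [richardsonCoeff, smul_smul, ← sub_smul]

lemma richardson_const {V : Type*} [AddCommGroup V] [Module ℝ V] (v : V) (k : ℕ) (hk : 1 ≤ k) :
    ∀ T, richardson (fun _ => v) k T = v := by
  induction k, hk using Nat.le_induction with
  | base => intro T; rfl
  | succ n hn ih =>
    intro T
    obtain ⟨m, rfl⟩ : ∃ m, n = m + 1 := ⟨n - 1, by omega⟩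
    simp only [richardson]
    rw [ih, ih]
    have h2 : (2 : ℝ) ^ (m + 1) - 1 ≠ 0 := by
      have : (1 : ℝ) < 2 ^ (m + 1) := one_lt_pow₀ (by norm_num) (by omega)
      linarith
    have h3 : (2 : ℝ) ^ (m + 1) • v - v = ((2 : ℝ) ^ (m + 1) - 1) • v := by
      rw [sub_smul, one_smul]
    rw [h3, smul_smul, inv_mul_cancel₀ h2, one_smul]

lemma sum_richardsonCoeff (k : ℕ) (hk : 1 ≤ k) :
    ∑ j ∈ Finset.range k, richardsonCoeff k j = 1 := by
  have h1 := richardson_eq_sum (fun _ : ℝ => (1 : ℝ)) k 1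
  rw [richardson_const _ _ hk] at h1
  simpa using h1.symm

/-- The extrapolation of `T ↦ T^{-i}` is a multiple of `T^{-i}`. -/
lemma richardson_inv_pow (i k : ℕ) :
    ∃ c : ℝ, (∀ T, richardson (fun T : ℝ => (T⁻¹) ^ i) k T = c * (T⁻¹) ^ i) ∧
      (1 ≤ i → i < k → c = 0) := by
  induction k using Nat.strong_induction_on with
  | _ k ih =>
    match k with
    | 0 => exact ⟨0, fun T => by simp [richardson], fun _ h => absurd h (by omega)⟩
    | 1 => exact ⟨1, fun T => by simp [richardson], fun h h' => absurd h' (by omega)⟩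
    | (n + 2) =>
      obtain ⟨c, hc, hc0⟩ := ih (n + 1) (by omega)
      refine ⟨((2 : ℝ) ^ (n + 1) - 1)⁻¹ * ((2 : ℝ) ^ (n + 1) * (c * (2⁻¹) ^ i) - c), ?_, ?_⟩
      · intro T
        simp only [richardson, smul_eq_mul]
        rw [hc, hc, mul_inv, mul_pow]
        ring
      · intro hi hik
        rcases Nat.lt_or_ge i (n + 1) with h | h
        · rw [hc0 hi h]; simp
        -- The power newly removed at this level is `i = n + 1`, because `2^{n+1} * 2^{-(n+1)} - 1 =
        -- 0`.
        · have hin : i = n + 1 := by omega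
          subst hin
          rw [inv_pow]
          field_simp
          simp

lemma sum_richardsonCoeff_inv_pow (i k : ℕ) (hi : 1 ≤ i) (hik : i < k) (T : ℝ) :
    ∑ j ∈ Finset.range k, richardsonCoeff k j * ((2 ^ j * T)⁻¹) ^ i = 0 := by
  obtain ⟨c, hc, hc0⟩ := richardson_inv_pow i k
  have h1 := richardson_eq_sum (fun T : ℝ => (T⁻¹) ^ i) k T
  rw [hc, hc0 hi hik, zero_mul] at h1
  simpa using h1.symm

/-- The sum of the absolute values of the coefficients of the Richardson extrapolation. -/
def richardsonNorm (k : ℕ) : ℝ := ∑ j ∈ Finset.range k, |richardsonCoeff k j|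

lemma richardsonNorm_nonneg (k : ℕ) : 0 ≤ richardsonNorm k :=
  Finset.sum_nonneg fun _ _ => abs_nonneg _

/-- Extrapolation of a function with an asymptotic expansion in powers of `T^{-1}`. -/
lemma norm_richardson_sub_le {V : Type*} [NormedAddCommGroup V] [NormedSpace ℝ V] (f : ℝ → V)
    (g : ℕ → V) (r : ℝ → V) {k : ℕ} (hk : 1 ≤ k) {B : ℝ}
    (hf : ∀ T, 0 < T → f T = ∑ i ∈ Finset.range k, (T⁻¹) ^ i • g i + (T⁻¹) ^ k • r T)
    (hr : ∀ T, 0 < T → ‖r T‖ ≤ B) {T : ℝ} (hT : 0 < T) :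
    ‖richardson f k T - g 0‖ ≤ richardsonNorm k * B * (T ^ k)⁻¹ := by
  have hpos : ∀ j : ℕ, 0 < (2 : ℝ) ^ j * T := fun j => by positivity
  -- The coefficients sum to one and annihilate the powers `1, …, k - 1` of `T⁻¹`, so that besides
  -- `g 0` only the remainders survive.
  have h1 : richardson f k T - g 0 =
      ∑ j ∈ Finset.range k, richardsonCoeff k j • ((2 ^ j * T)⁻¹) ^ k • r (2 ^ j * T) := by
    rw [richardson_eq_sum]
    have h2 : ∀ j ∈ Finset.range k, richardsonCoeff k j • f (2 ^ j * T) =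
        ∑ i ∈ Finset.range k, (richardsonCoeff k j * ((2 ^ j * T)⁻¹) ^ i) • g i +
          richardsonCoeff k j • ((2 ^ j * T)⁻¹) ^ k • r (2 ^ j * T) := fun j _ => by
      rw [hf _ (hpos j), smul_add, Finset.smul_sum]
      simp_rw [smul_smul]
    rw [Finset.sum_congr rfl h2, Finset.sum_add_distrib, Finset.sum_comm]
    simp_rw [← Finset.sum_smul]
    obtain ⟨m, rfl⟩ : ∃ m, k = m + 1 := ⟨k - 1, by omega⟩
    rw [Finset.sum_range_succ' _ m, Finset.sum_eq_zero (s := Finset.range m)]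
    · simp [sum_richardsonCoeff (m + 1) hk]
    · intro i hi
      rw [sum_richardsonCoeff_inv_pow (i + 1) (m + 1) (by omega)
        (by rw [Finset.mem_range] at hi; omega), zero_smul]
  have hB : 0 ≤ B := (norm_nonneg _).trans (hr T hT)
  rw [h1, richardsonNorm, Finset.sum_mul, Finset.sum_mul]
  refine (norm_sum_le _ _).trans (Finset.sum_le_sum fun j _ => ?_)
  rw [norm_smul, norm_smul, Real.norm_eq_abs, mul_assoc]
  refine mul_le_mul_of_nonneg_left ?_ (abs_nonneg _)
  rw [mul_comm]
  refine mul_le_mul (hr _ (hpos j)) ?_ (norm_nonneg _) hB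
  rw [norm_pow, norm_inv, Real.norm_of_nonneg (hpos j).le, ← inv_pow]
  have h1 : (1 : ℝ) ≤ 2 ^ j := one_le_pow₀ (by norm_num)
  have h2 : T ≤ 2 ^ j * T := le_mul_of_one_le_left hT.le h1
  exact pow_le_pow_left₀ (by positivity) (inv_anti₀ hT h2) _

/-! ### Abstract regularized elliptic problems -/

section Abstract

variable {V : Type*} [NormedAddCommGroup V] [InnerProductSpace ℝ V] [CompleteSpace V]

/-- The Lax–Milgram theorem. -/
lemma exists_solution {a : V →L[ℝ] V →L[ℝ] ℝ} {c : ℝ} (hc : 0 < c)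
    (ha : ∀ u, c * ‖u‖ ^ 2 ≤ a u u) (ℓ : V →L[ℝ] ℝ) : ∃ u, ∀ v, a u v = ℓ v := by
  have hco : IsCoercive a := ⟨c, hc, fun u => by rw [mul_assoc, ← sq]; exact ha u⟩
  refine ⟨hco.continuousLinearEquivOfBilin.symm ((InnerProductSpace.toDual ℝ V).symm ℓ),
    fun v => ?_⟩
  rw [← hco.continuousLinearEquivOfBilin_apply, ContinuousLinearEquiv.apply_symm_apply,
    InnerProductSpace.toDual_symm_apply]

/-- Rate of convergence of the Richardson extrapolation of the solutions of
`T⁻¹ m(u_T, ·) + a(u_T, ·) = ℓ` to the solution of `a(u, ·) = ℓ`. -/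
lemma norm_richardson_solution_sub_le {m a : V →L[ℝ] V →L[ℝ] ℝ} {c M : ℝ} (hc : 0 < c)
    (ha : ∀ u, c * ‖u‖ ^ 2 ≤ a u u) (hm : ∀ u, 0 ≤ m u u) (hmb : ∀ u v, |m u v| ≤ ‖u‖ * ‖v‖)
    (hab : ∀ u v, |a u v| ≤ M * ‖u‖ * ‖v‖) {ℓ : V →L[ℝ] ℝ} {u : V} (hu : ∀ v, a u v = ℓ v)
    {f : ℝ → V} (hf : ∀ T, 0 < T → ∀ v, T⁻¹ * m (f T) v + a (f T) v = ℓ v) {k : ℕ} (hk : 1 ≤ k)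
    {T : ℝ} (hT : 0 < T) :
    ‖richardson f k T - u‖ ≤ richardsonNorm k * (c⁻¹ * M * (c⁻¹ ^ k * ‖u‖)) * (T ^ k)⁻¹ := by
  have hex : ∀ w : V, ∃ w', ∀ v, a w' v = m w v := fun w => exists_solution hc ha (m w)
  -- `K` is the solution operator `a⁻¹ m`. Formally `f T = (1 + T⁻¹ K)⁻¹ u`, and the terms `h i =
  -- K^i u` are the coefficients of its Neumann series up to sign.
  choose K hK using hex
  have hKn : ∀ w, ‖K w‖ ≤ c⁻¹ * ‖w‖ := by
    intro w
    rw [inv_mul_eq_div, le_div_iff₀' hc]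
    rcases eq_or_ne ‖K w‖ 0 with h0 | h0
    · rw [h0]; simp
    · have hpos : 0 < ‖K w‖ := lt_of_le_of_ne (norm_nonneg _) (Ne.symm h0)
      refine le_of_mul_le_mul_right ?_ hpos
      calc c * ‖K w‖ * ‖K w‖ = c * ‖K w‖ ^ 2 := by ring
        _ ≤ a (K w) (K w) := ha _
        _ = m w (K w) := hK w _
        _ ≤ |m w (K w)| := le_abs_self _
        _ ≤ ‖w‖ * ‖K w‖ := hmb _ _
  set h : ℕ → V := fun i => K^[i] u with hh
  have hhs : ∀ i v, a (h (i + 1)) v = m (h i) v := fun i v => by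
    simp only [hh, Function.iterate_succ_apply']; exact hK _ _
  have hhn : ∀ i, ‖h i‖ ≤ c⁻¹ ^ i * ‖u‖ := by
    intro i
    induction i with
    | zero => simp [hh]
    | succ i ih =>
      simp only [hh, Function.iterate_succ_apply']
      refine (hKn _).trans ?_
      rw [pow_succ', mul_assoc]
      exact mul_le_mul_of_nonneg_left ih (by positivity)
  -- The rescaled remainders, chosen so that `r i = h i - T⁻¹ r (i + 1)`. Each solves the same
  -- regularized problem, now with source `a (h i)`.
  set r : ℕ → ℝ → V := fun i T => Nat.rec (f T) (fun i r => (-T) • (r - h i)) i with hrdef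
  have hrs : ∀ i T, r (i + 1) T = (-T) • (r i T - h i) := fun i T => rfl
  have hr : ∀ T, 0 < T → ∀ i v, T⁻¹ * m (r i T) v + a (r i T) v = a (h i) v := by
    intro T hT i
    induction i with
    | zero => intro v; rw [show h 0 = u from rfl, hu]; exact hf T hT v
    | succ i ih =>
      intro v
      rw [hrs, hhs]
      have e := ih v
      simp only [map_smul, map_sub, smul_apply, sub_apply,
        smul_eq_mul]
      have e2 : T⁻¹ * (-T * (m (r i T) v - m (h i) v)) + -T * (a (r i T) v - a (h i) v) =
          -T * (T⁻¹ * m (r i T) v + a (r i T) v - a (h i) v) + T * T⁻¹ * m (h i) v := by ring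
      rw [e2, e, mul_inv_cancel₀ hT.ne']; ring
  -- The term with `T⁻¹` is nonnegative and is dropped, so the bound does not depend on `T`.
  have hrn : ∀ T, 0 < T → ‖r k T‖ ≤ c⁻¹ * M * (c⁻¹ ^ k * ‖u‖) := by
    intro T hT
    have hM : 0 ≤ M * ‖h k‖ := by
      rcases eq_or_ne (h k) 0 with h0 | h0
      · rw [h0]; simp
      · have := (abs_nonneg _).trans (hab (h k) (h k))
        have hp := norm_pos_iff.2 h0
        exact nonneg_of_mul_nonneg_left this hp
    have h1 : ‖r k T‖ ≤ c⁻¹ * (M * ‖h k‖) := by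
      rw [inv_mul_eq_div, le_div_iff₀' hc]
      rcases eq_or_ne ‖r k T‖ 0 with h0 | h0
      · rw [h0]; simpa using hM
      · have hpos : 0 < ‖r k T‖ := lt_of_le_of_ne (norm_nonneg _) (Ne.symm h0)
        refine le_of_mul_le_mul_right ?_ hpos
        calc c * ‖r k T‖ * ‖r k T‖ = c * ‖r k T‖ ^ 2 := by ring
          _ ≤ a (r k T) (r k T) := ha _
          _ ≤ T⁻¹ * m (r k T) (r k T) + a (r k T) (r k T) :=
            le_add_of_nonneg_left (mul_nonneg (inv_nonneg.2 hT.le) (hm _))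
          _ = a (h k) (r k T) := hr T hT k _
          _ ≤ M * ‖h k‖ * ‖r k T‖ := (le_abs_self _).trans (hab _ _)
    rcases le_or_gt 0 M with hM0 | hM0
    · refine h1.trans ?_
      rw [mul_assoc]
      gcongr
      exact hhn k
    -- A negative `M` is compatible with the continuity bound only on the trivial space.
    · have hz : ∀ w : V, w = 0 := fun w => by
        by_contra hw
        have h3 := (abs_nonneg _).trans (hab w w)
        have hp := norm_pos_iff.2 hw
        have : M * ‖w‖ * ‖w‖ < 0 := mul_neg_of_neg_of_pos (mul_neg_of_neg_of_pos hM0 hp) hp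
        linarith
      rw [hz (r k T), hz u]; simp
  have hexp : ∀ T, 0 < T → ∀ j, f T = ∑ i ∈ Finset.range j, (T⁻¹) ^ i • ((-1 : ℝ) ^ i • h i) +
      (T⁻¹) ^ j • ((-1 : ℝ) ^ j • r j T) := by
    intro T hT j
    induction j with
    | zero => simp [hrdef]
    | succ j ih =>
      rw [Finset.sum_range_succ, ih, hrs, add_assoc]
      congr 1
      simp only [smul_smul, smul_sub]
      have e : (T⁻¹) ^ (j + 1) * ((-1) ^ (j + 1) * -T) = (T⁻¹) ^ j * (-1) ^ j := by
        rw [pow_succ, pow_succ]; field_simp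
      rw [e]; abel
  have := norm_richardson_sub_le f (fun i => (-1 : ℝ) ^ i • h i) (fun T => (-1 : ℝ) ^ k • r k T)
    hk (B := c⁻¹ * M * (c⁻¹ ^ k * ‖u‖)) (fun T hT => hexp T hT k)
    (fun T hT => by rw [norm_smul]; simpa using hrn T hT) hT
  simpa [hh] using this

end Abstract

/-! ### Coefficient fields -/

lemma act_add (M : Matrix (Fin d) (Fin d) ℝ) (v w : Sp d) : act M (v + w) = act M v + act M w :=
  map_add _ _ _

lemma act_sub (M : Matrix (Fin d) (Fin d) ℝ) (v w : Sp d) : act M (v - w) = act M v - act M w :=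
  map_sub _ _ _

lemma act_smul (M : Matrix (Fin d) (Fin d) ℝ) (c : ℝ) (v : Sp d) : act M (c • v) = c • act M v :=
  map_smul _ _ _

lemma act_apply (M : Matrix (Fin d) (Fin d) ℝ) (v : Sp d) (i : Fin d) :
    act M v i = ∑ j, M i j * v j := by
  simp [act, Matrix.toLpLin_apply, Matrix.mulVec, dotProduct]

lemma inner_act_transpose (M : Matrix (Fin d) (Fin d) ℝ) (v w : Sp d) :
    inner ℝ v (act M.transpose w) = inner ℝ w (act M v) := by
  simp only [PiLp.inner_apply, act_apply, RCLike.inner_apply, conj_trivial, Matrix.transpose_apply,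
    Finset.sum_mul]
  rw [Finset.sum_comm]
  exact Finset.sum_congr rfl fun i _ => Finset.sum_congr rfl fun j _ => by ring

/-- The upper bound passes to the transpose through `|Mᵀ v|² = v ⬝ M Mᵀ v`. -/
lemma IsElliptic.transpose {α β : ℝ} {M : Matrix (Fin d) (Fin d) ℝ} (h : IsElliptic α β M) :
    IsElliptic α β M.transpose := by
  intro v
  refine ⟨by rw [inner_act_transpose]; exact (h v).1, ?_⟩
  rcases eq_or_ne (act M.transpose v) 0 with h0 | h0
  · rw [h0, norm_zero]; exact (norm_nonneg _).trans (h v).2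
  · refine le_of_mul_le_mul_right ?_ (norm_pos_iff.2 h0)
    rw [← real_inner_self_eq_norm_mul_norm, inner_act_transpose]
    calc inner ℝ v (act M (act M.transpose v)) ≤ ‖v‖ * ‖act M (act M.transpose v)‖ :=
          real_inner_le_norm _ _
      _ ≤ ‖v‖ * (β * ‖act M.transpose v‖) := by gcongr; exact (h _).2
      _ = β * ‖v‖ * ‖act M.transpose v‖ := by ring

/-- A coefficient field that is elliptic and periodic everywhere. -/
structure IsRegular (α β : ℝ) (A : Field d) : Prop where
  pos : 0 < α
  le : α ≤ β
  aemeasurable : ∀ i j, AEMeasurable (fun x => A x i j) volume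
  elliptic : ∀ x, IsElliptic α β (A x)
  periodic : LatPeriodic A

lemma IsRegular.adj {α β : ℝ} {A : Field d} (hA : IsRegular α β A) : IsRegular α β (adj A) where
  pos := hA.pos
  le := hA.le
  aemeasurable i j := hA.aemeasurable j i
  elliptic x := (hA.elliptic x).transpose
  periodic x n := by simp only [PeriodicHom.adj, hA.periodic x n]

lemma IsRegular.beta_pos {α β : ℝ} {A : Field d} (hA : IsRegular α β A) : 0 < β :=
  hA.pos.trans_le hA.le

lemma IsRegular.norm_act_le {α β : ℝ} {A : Field d} (hA : IsRegular α β A) (x v : Sp d) :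
    ‖act (A x) v‖ ≤ β * ‖v‖ := (hA.elliptic x v).2

lemma IsRegular.abs_inner_act_le {α β : ℝ} {A : Field d} (hA : IsRegular α β A) (x v w : Sp d) :
    |inner ℝ v (act (A x) w)| ≤ β * (‖v‖ * ‖w‖) := by
  calc |inner ℝ v (act (A x) w)| ≤ ‖v‖ * ‖act (A x) w‖ := abs_real_inner_le_norm _ _
    _ ≤ ‖v‖ * (β * ‖w‖) := by gcongr; exact hA.norm_act_le x w
    _ = β * (‖v‖ * ‖w‖) := by ring

lemma IsRegular.aestronglyMeasurable_act {α β : ℝ} {A : Field d} (hA : IsRegular α β A)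
    {s : Set (Sp d)} {G : Sp d → Sp d} (hG : AEStronglyMeasurable G (volume.restrict s)) :
    AEStronglyMeasurable (fun x => act (A x) (G x)) (volume.restrict s) := by
  have h1 : AEMeasurable (fun x i => ∑ j, A x i j * G x j) (volume.restrict s) := by
    refine aemeasurable_pi_lambda _ fun i => Finset.aemeasurable_fun_sum _ fun j _ => ?_
    exact (hA.aemeasurable i j).restrict.mul ((measurable_coord j).comp_aemeasurable hG.aemeasurable)
  have h2 := (MeasurableEquiv.toLp 2 (Fin d → ℝ)).measurable.comp_aemeasurable h1
  refine AEMeasurable.aestronglyMeasurable (h2.congr (Filter.Eventually.of_forall fun x => ?_))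
  ext i
  simp only [Function.comp_apply, MeasurableEquiv.coe_toLp]
  rw [act_apply]

lemma IsRegular.memLp_act {α β : ℝ} {A : Field d} (hA : IsRegular α β A) {s : Set (Sp d)}
    {G : Sp d → Sp d} (hG : MemLp G 2 (volume.restrict s)) :
    MemLp (fun x => act (A x) (G x)) 2 (volume.restrict s) :=
  hG.of_le_mul (c := β) (hA.aestronglyMeasurable_act hG.1)
    (Filter.Eventually.of_forall fun x => hA.norm_act_le x _)

/-! ### Sobolev spaces as closed subspaces of a Hilbert space -/

/-- Pairs of a square integrable function and a square integrable vector field. -/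
abbrev PairSpace (ν : Measure (Sp d)) : Type := WithLp 2 (Lp ℝ 2 ν × Lp (Sp d) 2 ν)

/-- The pairs `(ψ, ∇ψ)` with `ψ` smooth and in `S`. -/
def gradPairs (ν : Measure (Sp d)) (S : Submodule ℝ (Sp d → ℝ)) : Submodule ℝ (PairSpace ν) where
  carrier := {h | ∃ ψ ∈ S, ContDiff ℝ ∞ ψ ∧ h.fst =ᵐ[ν] ψ ∧ h.snd =ᵐ[ν] gradient ψ}
  zero_mem' := by
    refine ⟨0, S.zero_mem, contDiff_const, Lp.coeFn_zero _ _ _, ?_⟩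
    have : gradient (0 : Sp d → ℝ) = 0 := by
      funext x; exact gradient_fun_const x 0
    rw [this]; exact Lp.coeFn_zero _ _ _
  add_mem' := by
    rintro a b ⟨ψ, hψ, hc, h1, h2⟩ ⟨ψ', hψ', hc', h1', h2'⟩
    refine ⟨ψ + ψ', S.add_mem hψ hψ', hc.add hc', ?_, ?_⟩
    · filter_upwards [Lp.coeFn_add a.fst b.fst, h1, h1'] with x e1 e2 e3
      rw [WithLp.add_fst, e1, Pi.add_apply, e2, e3, Pi.add_apply]
    · filter_upwards [Lp.coeFn_add a.snd b.snd, h2, h2'] with x e1 e2 e3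
      rw [WithLp.add_snd, e1, Pi.add_apply, e2, e3]
      simp only [gradient]
      rw [fderiv_add (hc.differentiable (by simp) x) (hc'.differentiable (by simp) x), map_add]
  smul_mem' := by
    rintro c a ⟨ψ, hψ, hc, h1, h2⟩
    refine ⟨c • ψ, S.smul_mem c hψ, hc.const_smul c, ?_, ?_⟩
    · filter_upwards [Lp.coeFn_smul c a.fst, h1] with x e1 e2
      rw [WithLp.smul_fst, e1, Pi.smul_apply, e2, Pi.smul_apply]
    · filter_upwards [Lp.coeFn_smul c a.snd, h2] with x e1 e2
      rw [WithLp.smul_snd, e1, Pi.smul_apply, e2]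
      simp only [gradient]
      rw [fderiv_const_smul (hc.differentiable (by simp) x)]
      simp

/-- The closure of the pairs `(ψ, ∇ψ)`. -/
def sobolev (ν : Measure (Sp d)) (S : Submodule ℝ (Sp d → ℝ)) : Submodule ℝ (PairSpace ν) :=
  (gradPairs ν S).topologicalClosure

instance (ν : Measure (Sp d)) (S : Submodule ℝ (Sp d → ℝ)) : CompleteSpace (sobolev ν S) :=
  (Submodule.isClosed_topologicalClosure _).completeSpace_coe

lemma contDiff_gradient {ψ : Sp d → ℝ} (h : ContDiff ℝ ∞ ψ) : ContDiff ℝ ∞ (gradient ψ) := by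
  have h1 : ContDiff ℝ ∞ (fderiv ℝ ψ) := h.fderiv_right (by simp)
  exact (InnerProductSpace.toDual ℝ (Sp d)).symm.contDiff.comp h1

lemma norm_pairSpace_le {ν : Measure (Sp d)} (h : PairSpace ν) : ‖h‖ ≤ ‖h.fst‖ + ‖h.snd‖ := by
  have := WithLp.prod_norm_sq_eq_of_L2 h
  nlinarith [norm_nonneg h.fst, norm_nonneg h.snd, norm_nonneg h]

lemma norm_fst_le {ν : Measure (Sp d)} (h : PairSpace ν) : ‖h.fst‖ ≤ ‖h‖ := by
  have := WithLp.prod_norm_sq_eq_of_L2 h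
  nlinarith [norm_nonneg h.fst, sq_nonneg ‖h.snd‖, norm_nonneg h]

lemma norm_snd_le {ν : Measure (Sp d)} (h : PairSpace ν) : ‖h.snd‖ ≤ ‖h‖ := by
  have := WithLp.prod_norm_sq_eq_of_L2 h
  nlinarith [norm_nonneg h.snd, sq_nonneg ‖h.fst‖, norm_nonneg h]

/-- With its converse below, this identifies the closure expressed by functions and `eLpNorm` with a
closed subspace of a Hilbert space, where the Lax–Milgram theorem applies. -/
lemma MemH1Closure.exists_mem_sobolev {U : Set (Sp d)} {S : Submodule ℝ (Sp d → ℝ)}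
    (hS : ∀ ψ ∈ S, ContDiff ℝ ∞ ψ) {w : FunGrad d} (hw : MemH1Closure U (S : Set (Sp d → ℝ)) w) :
    ∃ h ∈ sobolev (volume.restrict U) S,
      h.fst =ᵐ[volume.restrict U] w.1 ∧ h.snd =ᵐ[volume.restrict U] w.2 := by
  obtain ⟨h1, h2, happ⟩ := hw
  refine ⟨WithLp.toLp 2 (h1.toLp w.1, h2.toLp w.2), ?_, h1.coeFn_toLp, h2.coeFn_toLp⟩
  refine Metric.mem_closure_iff.2 fun ε hε => ?_
  obtain ⟨ψ, hψ, e1, e2⟩ := happ (ε / 4) (by positivity)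
  have hc := hS ψ hψ
  have m1 : MemLp (fun x => w.1 x - ψ x) 2 (volume.restrict U) :=
    ⟨h1.1.sub hc.continuous.aestronglyMeasurable, e1.trans_lt ENNReal.ofReal_lt_top⟩
  have m2 : MemLp (fun x => w.2 x - gradient ψ x) 2 (volume.restrict U) :=
    ⟨h2.1.sub (contDiff_gradient hc).continuous.aestronglyMeasurable,
      e2.trans_lt ENNReal.ofReal_lt_top⟩
  -- Smoothness does not give integrability on a general `U`; it comes from `ψ = w - (w - ψ)`.
  have n1 : MemLp ψ 2 (volume.restrict U) := by
    have := h1.sub m1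
    rwa [show w.1 - (fun x => w.1 x - ψ x) = ψ by funext x; simp] at this
  have n2 : MemLp (gradient ψ) 2 (volume.restrict U) := by
    have := h2.sub m2
    rwa [show w.2 - (fun x => w.2 x - gradient ψ x) = gradient ψ by funext x; simp] at this
  refine ⟨WithLp.toLp 2 (n1.toLp ψ, n2.toLp (gradient ψ)),
    ⟨ψ, hψ, hc, n1.coeFn_toLp, n2.coeFn_toLp⟩, ?_⟩
  rw [dist_eq_norm]
  refine (norm_pairSpace_le _).trans_lt ?_
  simp only [WithLp.sub_fst, WithLp.sub_snd]
  change ‖h1.toLp w.1 - n1.toLp ψ‖ + ‖h2.toLp w.2 - n2.toLp (gradient ψ)‖ < ε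
  rw [← MemLp.toLp_sub h1 n1, ← MemLp.toLp_sub h2 n2, Lp.norm_toLp, Lp.norm_toLp]
  have f1 := ENNReal.toReal_mono ENNReal.ofReal_ne_top e1
  have f2 := ENNReal.toReal_mono ENNReal.ofReal_ne_top e2
  rw [ENNReal.toReal_ofReal (by positivity)] at f1 f2
  change (eLpNorm (fun x => w.1 x - ψ x) 2 (volume.restrict U)).toReal +
    (eLpNorm (fun x => w.2 x - gradient ψ x) 2 (volume.restrict U)).toReal < ε
  linarith

lemma memH1Closure_of_mem_sobolev {U : Set (Sp d)} {S : Submodule ℝ (Sp d → ℝ)}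
    {h : PairSpace (volume.restrict U)} (hh : h ∈ sobolev (volume.restrict U) S) {w : FunGrad d}
    (h1 : h.fst =ᵐ[volume.restrict U] w.1) (h2 : h.snd =ᵐ[volume.restrict U] w.2) :
    MemH1Closure U (S : Set (Sp d → ℝ)) w := by
  refine ⟨(memLp_congr_ae h1).1 (Lp.memLp _), (memLp_congr_ae h2).1 (Lp.memLp _), fun ε hε => ?_⟩
  obtain ⟨g, ⟨ψ, hψ, -, g1, g2⟩, hg⟩ := Metric.mem_closure_iff.1 hh ε hε
  rw [dist_eq_norm] at hg
  refine ⟨ψ, hψ, ?_, ?_⟩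
  · have e : (fun x => w.1 x - ψ x) =ᵐ[volume.restrict U] ⇑((h - g).fst) := by
      filter_upwards [h1, g1, Lp.coeFn_sub h.fst g.fst] with x e1 e2 e3
      rw [WithLp.sub_fst, e3, Pi.sub_apply, e1, e2]
    rw [eLpNorm_congr_ae e, ← ENNReal.ofReal_toReal (Lp.eLpNorm_ne_top _), ← Lp.norm_def]
    exact ENNReal.ofReal_le_ofReal ((norm_fst_le _).trans hg.le)
  · have e : (fun x => w.2 x - gradient ψ x) =ᵐ[volume.restrict U] ⇑((h - g).snd) := by
      filter_upwards [h2, g2, Lp.coeFn_sub h.snd g.snd] with x e1 e2 e3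
      rw [WithLp.sub_snd, e3, Pi.sub_apply, e1, e2]
    rw [eLpNorm_congr_ae e, ← ENNReal.ofReal_toReal (Lp.eLpNorm_ne_top _), ← Lp.norm_def]
    exact ENNReal.ofReal_le_ofReal ((norm_snd_le _).trans hg.le)

/-- The test functions as a linear space. -/
def testSubmodule (U : Set (Sp d)) : Submodule ℝ (Sp d → ℝ) where
  carrier := testFunctions U
  zero_mem' := ⟨contDiff_const, HasCompactSupport.zero, by simp [tsupport]⟩
  add_mem' := by
    rintro a b ⟨h1, h2, h3⟩ ⟨h1', h2', h3'⟩
    exact ⟨h1.add h1', h2.add h2', (tsupport_add a b).trans (Set.union_subset h3 h3')⟩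
  smul_mem' := by
    rintro c a ⟨h1, h2, h3⟩
    refine ⟨h1.const_smul c, h2.smul_left (f := fun _ => c), ?_⟩
    exact (tsupport_smul_subset_right (fun _ => c) a).trans h3

lemma integrableOn_box_of_continuous {E : Type*} [NormedAddCommGroup E] {ψ : Sp d → E}
    (h : Continuous ψ) (R : ℝ) : IntegrableOn ψ (box d R) :=
  (h.continuousOn.integrableOn_compact (isCompact_closedBall _ _)).mono_set
    (box_subset_closedBall R)

/-- The smooth periodic functions with zero mean as a linear space. -/
def periodicSubmodule (d : ℕ) : Submodule ℝ (Sp d → ℝ) where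
  carrier := periodicTestFunctions d
  zero_mem' := ⟨contDiff_const, fun _ _ => rfl, by simp⟩
  add_mem' := by
    rintro a b ⟨h1, h2, h3⟩ ⟨h1', h2', h3'⟩
    refine ⟨h1.add h1', fun i x => by simp only [Pi.add_apply, h2 i x, h2' i x], ?_⟩
    simp only [Pi.add_apply]
    rw [integral_add (integrableOn_box_of_continuous h1.continuous 1)
      (integrableOn_box_of_continuous h1'.continuous 1), h3, h3', add_zero]
  smul_mem' := by
    rintro c a ⟨h1, h2, h3⟩
    refine ⟨h1.const_smul c, fun i x => by simp only [Pi.smul_apply, h2 i x], ?_⟩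
    simp only [Pi.smul_apply]
    rw [integral_smul, h3, smul_zero]

/-! ### Bilinear forms -/

/-- The form `∫ u v`. -/
def massForm (ν : Measure (Sp d)) : PairSpace ν →L[ℝ] PairSpace ν →L[ℝ] ℝ :=
  LinearMap.mkContinuous₂ (LinearMap.mk₂ ℝ (fun u v : PairSpace ν => inner ℝ u.fst v.fst)
    (fun a b c => by simp [inner_add_left]) (fun a b c => by simp [inner_smul_left])
    (fun a b c => by simp [inner_add_right]) (fun a b c => by simp [inner_smul_right])) 1
    (fun u v => by
      rw [one_mul]
      exact (norm_inner_le_norm _ _).trans (mul_le_mul (norm_fst_le u) (norm_fst_le v)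
        (norm_nonneg _) (norm_nonneg _)))

lemma massForm_apply (ν : Measure (Sp d)) (u v : PairSpace ν) :
    massForm ν u v = inner ℝ u.fst v.fst := rfl

/-- Multiplication by the coefficient field. -/
def IsRegular.mulOp {α β : ℝ} {A : Field d} (hA : IsRegular α β A) (s : Set (Sp d)) :
    Lp (Sp d) 2 (volume.restrict s) →L[ℝ] Lp (Sp d) 2 (volume.restrict s) :=
  LinearMap.mkContinuous
    { toFun := fun G => (hA.memLp_act (Lp.memLp G)).toLp _
      map_add' := fun F G => by
        rw [← MemLp.toLp_add]
        refine MemLp.toLp_congr _ _ ?_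
        filter_upwards [Lp.coeFn_add F G] with x hx
        rw [hx, Pi.add_apply, act_add, Pi.add_apply]
      map_smul' := fun c G => by
        rw [RingHom.id_apply, ← MemLp.toLp_const_smul]
        refine MemLp.toLp_congr _ _ ?_
        filter_upwards [Lp.coeFn_smul c G] with x hx
        rw [hx, Pi.smul_apply, act_smul, Pi.smul_apply] } β
    (fun G => by
      refine Lp.norm_le_mul_norm_of_ae_le_mul ?_
      filter_upwards [(hA.memLp_act (Lp.memLp G)).coeFn_toLp] with x hx
      simp only [LinearMap.coe_mk, AddHom.coe_mk]
      rw [hx]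
      exact hA.norm_act_le x _)

lemma IsRegular.coeFn_mulOp {α β : ℝ} {A : Field d} (hA : IsRegular α β A) (s : Set (Sp d))
    (G : Lp (Sp d) 2 (volume.restrict s)) :
    hA.mulOp s G =ᵐ[volume.restrict s] fun x => act (A x) (G x) :=
  (hA.memLp_act (Lp.memLp G)).coeFn_toLp

lemma IsRegular.norm_mulOp_le {α β : ℝ} {A : Field d} (hA : IsRegular α β A) (s : Set (Sp d))
    (G : Lp (Sp d) 2 (volume.restrict s)) : ‖hA.mulOp s G‖ ≤ β * ‖G‖ :=
  LinearMap.mkContinuous_norm_le _ hA.beta_pos.le _ |> fun h =>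
    (ContinuousLinearMap.le_opNorm _ _).trans (mul_le_mul_of_nonneg_right h (norm_nonneg _))

/-- The form `∫ ∇v ⬝ A ∇u`. -/
def IsRegular.energyForm {α β : ℝ} {A : Field d} (hA : IsRegular α β A) (s : Set (Sp d)) :
    PairSpace (volume.restrict s) →L[ℝ] PairSpace (volume.restrict s) →L[ℝ] ℝ :=
  LinearMap.mkContinuous₂ (LinearMap.mk₂ ℝ
    (fun u v : PairSpace (volume.restrict s) => inner ℝ (hA.mulOp s u.snd) v.snd)
    (fun a b c => by simp [inner_add_left]) (fun a b c => by simp [inner_smul_left])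
    (fun a b c => by simp [inner_add_right]) (fun a b c => by simp [inner_smul_right])) β
    (fun u v => by
      refine (norm_inner_le_norm _ _).trans (mul_le_mul ((hA.norm_mulOp_le s _).trans ?_)
        (norm_snd_le v) (norm_nonneg _) (mul_nonneg hA.beta_pos.le (norm_nonneg _)))
      exact mul_le_mul_of_nonneg_left (norm_snd_le u) hA.beta_pos.le)

lemma IsRegular.energyForm_apply {α β : ℝ} {A : Field d} (hA : IsRegular α β A) (s : Set (Sp d))
    (u v : PairSpace (volume.restrict s)) :
    hA.energyForm s u v = ∫ x in s, inner ℝ (v.snd x) (act (A x) (u.snd x)) := by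
  change inner ℝ (hA.mulOp s u.snd) v.snd = _
  rw [L2.inner_def]
  refine integral_congr_ae ?_
  filter_upwards [hA.coeFn_mulOp s u.snd] with x hx
  rw [hx, real_inner_comm]

lemma norm_sq_eq_integral {E : Type*} [NormedAddCommGroup E] [InnerProductSpace ℝ E]
    {ν : Measure (Sp d)} (f : Lp E 2 ν) : ‖f‖ ^ 2 = ∫ x, ‖f x‖ ^ 2 ∂ν := by
  rw [← real_inner_self_eq_norm_sq, L2.inner_def]
  simp_rw [real_inner_self_eq_norm_sq]

lemma integrable_norm_sq {E : Type*} [NormedAddCommGroup E] {ν : Measure (Sp d)} {f : Sp d → E}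
    (hf : MemLp f 2 ν) : Integrable (fun x => ‖f x‖ ^ 2) ν := by
  simpa using (memLp_two_iff_integrable_sq_norm hf.1).1 hf

lemma integrable_inner_of_memLp {ν : Measure (Sp d)} {F G : Sp d → Sp d} (hF : MemLp F 2 ν)
    (hG : MemLp G 2 ν) : Integrable (fun x => inner ℝ (F x) (G x)) ν := by
  have h1 : Integrable (fun x => ‖F x‖ * ‖G x‖) ν := hF.norm.integrable_mul hG.norm
  exact h1.mono (hF.1.inner hG.1) (Filter.Eventually.of_forall fun x => by
    rw [Real.norm_of_nonneg (by positivity : 0 ≤ ‖F x‖ * ‖G x‖)]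
    exact norm_inner_le_norm _ _)

lemma IsRegular.energyForm_self {α β : ℝ} {A : Field d} (hA : IsRegular α β A) (s : Set (Sp d))
    (u : PairSpace (volume.restrict s)) : α * ‖u.snd‖ ^ 2 ≤ hA.energyForm s u u := by
  rw [hA.energyForm_apply, norm_sq_eq_integral, ← integral_const_mul]
  refine integral_mono ((integrable_norm_sq (Lp.memLp _)).const_mul _)
    (integrable_inner_of_memLp (Lp.memLp _) (hA.memLp_act (Lp.memLp _))) fun x => ?_
  exact (hA.elliptic x _).1

lemma IsRegular.abs_energyForm_le {α β : ℝ} {A : Field d} (hA : IsRegular α β A) (s : Set (Sp d))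
    (u v : PairSpace (volume.restrict s)) : |hA.energyForm s u v| ≤ β * ‖u‖ * ‖v‖ :=
  (norm_inner_le_norm (𝕜 := ℝ) _ _).trans (mul_le_mul ((hA.norm_mulOp_le s _).trans
    (mul_le_mul_of_nonneg_left (norm_snd_le u) hA.beta_pos.le)) (norm_snd_le v) (norm_nonneg _)
    (mul_nonneg hA.beta_pos.le (norm_nonneg _)))

lemma memLp_two_const {s : Set (Sp d)} (hs : volume s < ⊤) (ξ : Sp d) :
    MemLp (fun _ : Sp d => ξ) 2 (volume.restrict s) :=
  have : IsFiniteMeasure (volume.restrict s) := ⟨by simpa using hs⟩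
  memLp_const ξ

/-- The functional `v ↦ - ∫ ∇v ⬝ A ξ`. -/
def IsRegular.source {α β : ℝ} {A : Field d} (hA : IsRegular α β A) {s : Set (Sp d)}
    (hs : volume s < ⊤) (ξ : Sp d) : PairSpace (volume.restrict s) →L[ℝ] ℝ :=
  (-innerSL ℝ ((hA.memLp_act (memLp_two_const hs ξ)).toLp _)).comp (WithLp.sndL 2 ℝ _ _)

lemma IsRegular.source_apply {α β : ℝ} {A : Field d} (hA : IsRegular α β A) {s : Set (Sp d)}
    (hs : volume s < ⊤) (ξ : Sp d) (v : PairSpace (volume.restrict s)) :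
    hA.source hs ξ v = -∫ x in s, inner ℝ (v.snd x) (act (A x) ξ) := by
  have hm := hA.memLp_act (memLp_two_const hs ξ)
  change -inner ℝ (hm.toLp _) v.snd = _
  rw [L2.inner_def]
  congr 1
  refine integral_congr_ae ?_
  filter_upwards [hm.coeFn_toLp] with x hx
  rw [hx, real_inner_comm]

/-- The weak formulation in terms of functions. -/
lemma IsRegular.weak_form_eq {α β : ℝ} {A : Field d} (hA : IsRegular α β A) {s : Set (Sp d)}
    (hs : volume s < ⊤) (ξ : Sp d) (τ : ℝ) (u v : PairSpace (volume.restrict s)) {w z : FunGrad d}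
    (hu1 : u.fst =ᵐ[volume.restrict s] w.1) (hu2 : u.snd =ᵐ[volume.restrict s] w.2)
    (hv1 : v.fst =ᵐ[volume.restrict s] z.1) (hv2 : v.snd =ᵐ[volume.restrict s] z.2) :
    ∫ x in s, (τ * (z.1 x * w.1 x) + inner ℝ (z.2 x) (act (A x) (ξ + w.2 x))) =
      τ * massForm _ u v + hA.energyForm s u v - hA.source hs ξ v := by
  rw [massForm_apply, L2.inner_def, hA.energyForm_apply, hA.source_apply, sub_neg_eq_add,
    ← integral_const_mul, ← integral_add, ← integral_add]
  · refine integral_congr_ae ?_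
    filter_upwards [hu1, hu2, hv1, hv2] with x e1 e2 e3 e4
    rw [e1, e2, e3, e4, act_add, inner_add_right]
    simp only [RCLike.inner_apply, conj_trivial]
    ring
  · exact ((L2.integrable_inner u.fst v.fst).const_mul _).add
      (integrable_inner_of_memLp (Lp.memLp _) (hA.memLp_act (Lp.memLp _)))
  · exact integrable_inner_of_memLp (Lp.memLp _) (hA.memLp_act (memLp_two_const hs ξ))
  · exact (L2.integrable_inner u.fst v.fst).const_mul _
  · exact integrable_inner_of_memLp (Lp.memLp _) (hA.memLp_act (Lp.memLp _))

/-! ### The Poincaré inequality for periodic functions -/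

lemma integrableOn_cell_of_continuous {E : Type*} [NormedAddCommGroup E] {f : Sp d → E}
    (hf : Continuous f) : IntegrableOn f (cell d) := by
  rw [IntegrableOn, ← restrict_box_one]
  exact integrableOn_box_of_continuous hf 1

lemma integral_cell_translate {f : Sp d → ℝ} (hf : LatPeriodic f) (hc : Continuous f) (a : Sp d) :
    ∫ x in cell d, f (x + a) = ∫ x in cell d, f x := by
  have hc' : Continuous fun x => f (x + a) := hc.comp (continuous_add_const a)
  rw [integral_eq_lintegral_pos_part_sub_lintegral_neg_part (integrableOn_cell_of_continuous hc),
    integral_eq_lintegral_pos_part_sub_lintegral_neg_part (integrableOn_cell_of_continuous hc'),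
    lintegral_cell_translate (fun x => ENNReal.ofReal (f x)) (fun x n => by simp only [hf x n])
      hc.measurable.ennreal_ofReal.aemeasurable a,
    lintegral_cell_translate (fun x => ENNReal.ofReal (-f x)) (fun x n => by simp only [hf x n])
      hc.measurable.neg.ennreal_ofReal.aemeasurable a]

/-- The variance of `f` on the unit interval is nonnegative. -/
lemma sq_integral_le {f : ℝ → ℝ} (hf : Continuous f) :
    (∫ t in (0 : ℝ)..1, f t) ^ 2 ≤ ∫ t in (0 : ℝ)..1, f t ^ 2 := by
  set c := ∫ t in (0 : ℝ)..1, f t with hc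
  have h0 : 0 ≤ ∫ t in (0 : ℝ)..1, (f t - c) ^ 2 :=
    intervalIntegral.integral_nonneg (by norm_num) fun t _ => sq_nonneg _
  have h1 : ∫ t in (0 : ℝ)..1, (f t - c) ^ 2 =
      (∫ t in (0 : ℝ)..1, f t ^ 2) - 2 * c * c + c ^ 2 := by
    have e : ∀ t, (f t - c) ^ 2 = f t ^ 2 - 2 * c * f t + c ^ 2 := fun t => by ring
    simp_rw [e]
    rw [intervalIntegral.integral_add, intervalIntegral.integral_sub,
      intervalIntegral.integral_const_mul, ← hc]
    · simp
    all_goals exact Continuous.intervalIntegrable (by fun_prop) _ _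
  nlinarith

lemma norm_sq_le_of_mem_cell {z : Sp d} (hz : z ∈ cell d) : ‖z‖ ^ 2 ≤ d := by
  rw [EuclideanSpace.norm_sq_eq]
  calc ∑ i, ‖z i‖ ^ 2 ≤ ∑ _i : Fin d, (1 : ℝ) := by
        refine Finset.sum_le_sum fun i _ => ?_
        rw [Real.norm_eq_abs, sq_abs, sq_le_one_iff_abs_le_one, abs_le]
        exact ⟨(hz i).1, (hz i).2.le⟩
    _ = d := by simp

lemma LatPeriodic.gradient {ψ : Sp d → ℝ} (h : LatPeriodic ψ) : LatPeriodic (gradient ψ) := by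
  intro x n
  have : (fun y => ψ (y + lat n)) = ψ := funext fun y => h y n
  simp only [_root_.gradient]
  conv_rhs => rw [← this]
  rw [fderiv_comp_add_right]

lemma norm_gradient (ψ : Sp d → ℝ) (x : Sp d) : ‖gradient ψ x‖ = ‖fderiv ℝ ψ x‖ := by
  simp [gradient]

/-- The fundamental theorem of calculus along the segment from `y` to `y + z`; the factor `d` bounds
`|z|²` on the cell. -/
lemma sq_sub_le_integral_gradient {ψ : Sp d → ℝ} (hψ : ContDiff ℝ ∞ ψ) (y : Sp d) {z : Sp d}
    (hz : z ∈ cell d) :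
    (ψ (y + z) - ψ y) ^ 2 ≤ d * ∫ t in (0 : ℝ)..1, ‖gradient ψ (y + t • z)‖ ^ 2 := by
  have hg := (contDiff_gradient hψ).continuous
  have hfd : Continuous (fderiv ℝ ψ) := hψ.continuous_fderiv (by simp)
  have hline : Continuous fun t : ℝ => y + t • z := by fun_prop
  have hd : ∀ t : ℝ, HasDerivAt (fun t : ℝ => ψ (y + t • z)) (fderiv ℝ ψ (y + t • z) z) t := by
    intro t
    have h1 : HasDerivAt (fun t : ℝ => y + t • z) z t := by
      simpa using ((hasDerivAt_id t).smul_const z).const_add y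
    exact (hψ.differentiable (by simp) _).hasFDerivAt.comp_hasDerivAt t h1
  have hcont : Continuous fun t : ℝ => fderiv ℝ ψ (y + t • z) z :=
    (hfd.comp hline).clm_apply continuous_const
  have hFT := intervalIntegral.integral_eq_sub_of_hasDerivAt (a := 0) (b := 1) (fun t _ => hd t)
    (hcont.intervalIntegrable _ _)
  simp only [one_smul, zero_smul, add_zero] at hFT
  rw [← hFT, ← intervalIntegral.integral_const_mul]
  refine (sq_integral_le hcont).trans ?_
  refine intervalIntegral.integral_mono_on (by norm_num) ((hcont.pow 2).intervalIntegrable _ _)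
    (Continuous.intervalIntegrable (continuous_const.mul ((hg.comp hline).norm.pow 2)) _ _)
    fun t _ => ?_
  have h1 := (fderiv ℝ ψ (y + t • z)).le_opNorm z
  rw [norm_gradient, ← sq_abs, ← Real.norm_eq_abs]
  calc ‖fderiv ℝ ψ (y + t • z) z‖ ^ 2 ≤ (‖fderiv ℝ ψ (y + t • z)‖ * ‖z‖) ^ 2 := by gcongr
    _ = ‖z‖ ^ 2 * ‖fderiv ℝ ψ (y + t • z)‖ ^ 2 := by ring
    _ ≤ d * ‖fderiv ℝ ψ (y + t • z)‖ ^ 2 := by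
      gcongr
      exact norm_sq_le_of_mem_cell hz

lemma volume_real_cell : (volume : Measure (Sp d)).real (cell d) = 2 ^ d := by
  rw [measureReal_def, volume_cell, ENNReal.toReal_ofReal (by positivity)]

/-- When the square is expanded, the cross term integrates to zero because the mean vanishes on
every translated cell. -/
lemma volume_mul_sq_le {ψ : Sp d → ℝ} (hψ : ContDiff ℝ ∞ ψ) (hp : LatPeriodic ψ)
    (h0 : ∫ x in cell d, ψ x = 0) (y : Sp d) :
    2 ^ d * ψ y ^ 2 ≤ ∫ z in cell d, (ψ (y + z) - ψ y) ^ 2 := by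
  have hc := hψ.continuous
  have hc' : Continuous fun z => ψ (y + z) := hc.comp (continuous_const_add y)
  have h1 : ∫ z in cell d, ψ (y + z) = 0 := by
    rw [← h0, ← integral_cell_translate hp hc y]
    simp_rw [add_comm]
  have h2 : ∫ z in cell d, (ψ y ^ 2 - 2 * ψ y * ψ (y + z)) = 2 ^ d * ψ y ^ 2 := by
    have hi : IntegrableOn (fun z => 2 * ψ y * ψ (y + z)) (cell d) :=
      integrableOn_cell_of_continuous (continuous_const.mul hc')
    rw [integral_sub (integrableOn_cell_of_continuous continuous_const) hi, integral_const_mul, h1,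
      setIntegral_const, volume_real_cell]
    simp
  rw [← h2]
  refine integral_mono (integrableOn_cell_of_continuous (by fun_prop))
    (integrableOn_cell_of_continuous (by fun_prop)) fun z => ?_
  simp only
  nlinarith [sq_nonneg (ψ (y + z))]

/-- The pointwise bound by increments is integrated in `y`. By translation invariance the integral
of `|∇ψ (y + t z)|²` over `y` depends on neither `t` nor `z`. -/
lemma lintegral_poincare {ψ : Sp d → ℝ} (hψ : ContDiff ℝ ∞ ψ) (hp : LatPeriodic ψ)
    (h0 : ∫ x in cell d, ψ x = 0) :
    ∫⁻ y in cell d, ENNReal.ofReal (ψ y ^ 2) ≤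
      d * ∫⁻ y in cell d, ENNReal.ofReal (‖gradient ψ y‖ ^ 2) := by
  have hc := hψ.continuous
  have hg := (contDiff_gradient hψ).continuous
  set g : Sp d → ENNReal := fun y => ENNReal.ofReal (‖gradient ψ y‖ ^ 2) with hgdef
  have hgm : Measurable g := (hg.norm.pow 2).measurable.ennreal_ofReal
  have hgp : LatPeriodic g := fun x n => by simp only [hgdef, hp.gradient x n]
  set I := ∫⁻ y in cell d, g y with hI
  have hA : ∀ y, ENNReal.ofReal (2 ^ d) * ENNReal.ofReal (ψ y ^ 2) ≤
      ∫⁻ z in cell d, d * ∫⁻ t in Set.Ioc (0 : ℝ) 1, g (y + t • z) := by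
    intro y
    rw [← ENNReal.ofReal_mul (by positivity)]
    refine (ENNReal.ofReal_le_ofReal (volume_mul_sq_le hψ hp h0 y)).trans ?_
    rw [ofReal_integral_eq_lintegral_ofReal
      (integrableOn_cell_of_continuous (by fun_prop)) (Filter.Eventually.of_forall fun z => sq_nonneg _)]
    refine setLIntegral_mono' measurableSet_cell fun z hz => ?_
    refine (ENNReal.ofReal_le_ofReal (sq_sub_le_integral_gradient hψ y hz)).trans ?_
    rw [ENNReal.ofReal_mul (Nat.cast_nonneg d), ENNReal.ofReal_natCast,
      intervalIntegral.integral_of_le zero_le_one, ofReal_integral_eq_lintegral_ofReal]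
    · have : Continuous fun t : ℝ => ‖gradient ψ (y + t • z)‖ ^ 2 := by fun_prop
      exact (this.intervalIntegrable 0 1).1
    · exact Filter.Eventually.of_forall fun t => by positivity
  have hm3 : Measurable fun q : (Sp d × Sp d) × ℝ => g (q.1.1 + q.2 • q.1.2) :=
    hgm.comp (by fun_prop)
  have hB : ∫⁻ y in cell d, ∫⁻ z in cell d, ∫⁻ t in Set.Ioc (0 : ℝ) 1, g (y + t • z) =
      ENNReal.ofReal (2 ^ d) * I := by
    rw [lintegral_lintegral_swap]
    · have h1 : ∀ z, ∫⁻ y in cell d, ∫⁻ t in Set.Ioc (0 : ℝ) 1, g (y + t • z) = I := by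
        intro z
        rw [lintegral_lintegral_swap]
        · simp_rw [lintegral_cell_translate g hgp hgm.aemeasurable]
          simp [hI]
        · exact (hgm.comp (by fun_prop : Measurable fun q : Sp d × ℝ => q.1 + q.2 • z)).aemeasurable
      simp_rw [h1]
      rw [lintegral_const, Measure.restrict_apply_univ, volume_cell, mul_comm]
    · exact (Measurable.lintegral_prod_right' hm3).aemeasurable
  have h2 : ENNReal.ofReal (2 ^ d) * ∫⁻ y in cell d, ENNReal.ofReal (ψ y ^ 2) ≤
      ENNReal.ofReal (2 ^ d) * (d * I) := by
    calc ENNReal.ofReal (2 ^ d) * ∫⁻ y in cell d, ENNReal.ofReal (ψ y ^ 2)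
        = ∫⁻ y in cell d, ENNReal.ofReal (2 ^ d) * ENNReal.ofReal (ψ y ^ 2) := by
          rw [lintegral_const_mul' _ _ ENNReal.ofReal_ne_top]
      _ ≤ ∫⁻ y in cell d, ∫⁻ z in cell d, d * ∫⁻ t in Set.Ioc (0 : ℝ) 1, g (y + t • z) :=
          lintegral_mono fun y => hA y
      _ = d * ∫⁻ y in cell d, ∫⁻ z in cell d, ∫⁻ t in Set.Ioc (0 : ℝ) 1, g (y + t • z) := by
          simp_rw [lintegral_const_mul' (d : ENNReal) _ (ENNReal.natCast_ne_top d)]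
      _ = ENNReal.ofReal (2 ^ d) * (d * I) := by rw [hB]; ring
  have hne : ENNReal.ofReal (2 ^ d) ≠ 0 := by simp
  exact (ENNReal.mul_le_mul_iff_right hne ENNReal.ofReal_ne_top).1 h2

lemma poincare {ψ : Sp d → ℝ} (hψ : ContDiff ℝ ∞ ψ) (hp : LatPeriodic ψ)
    (h0 : ∫ x in cell d, ψ x = 0) :
    ∫ y in cell d, ψ y ^ 2 ≤ d * ∫ y in cell d, ‖gradient ψ y‖ ^ 2 := by
  have hc := hψ.continuous
  have hg := (contDiff_gradient hψ).continuous
  have i1 : IntegrableOn (fun y => ψ y ^ 2) (cell d) := integrableOn_cell_of_continuous (hc.pow 2)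
  have i2 : IntegrableOn (fun y => ‖gradient ψ y‖ ^ 2) (cell d) :=
    integrableOn_cell_of_continuous (hg.norm.pow 2)
  have hn : 0 ≤ ∫ y in cell d, ‖gradient ψ y‖ ^ 2 := integral_nonneg fun y => by positivity
  rw [← ENNReal.ofReal_le_ofReal_iff (by positivity), ENNReal.ofReal_mul (Nat.cast_nonneg d),
    ENNReal.ofReal_natCast, ofReal_integral_eq_lintegral_ofReal i1
      (Filter.Eventually.of_forall fun z => sq_nonneg _),
    ofReal_integral_eq_lintegral_ofReal i2
      (Filter.Eventually.of_forall fun z => by positivity)]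
  exact lintegral_poincare hψ hp h0

lemma IsPeriodicFun.latPeriodic {ψ : Sp d → ℝ} (h : IsPeriodicFun ψ) : LatPeriodic ψ :=
  latPeriodic_of_single h

lemma contDiff_of_mem_periodicSubmodule (ψ : Sp d → ℝ) (h : ψ ∈ periodicSubmodule d) :
    ContDiff ℝ ∞ ψ := h.1

lemma contDiff_of_mem_testSubmodule {U : Set (Sp d)} (ψ : Sp d → ℝ) (h : ψ ∈ testSubmodule U) :
    ContDiff ℝ ∞ ψ := h.1

/-- The space `H¹_per(Q)`. -/
abbrev PerSpace (d : ℕ) : Type := sobolev (volume.restrict (box d 1)) (periodicSubmodule d)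

/-- The inequality is a closed condition on the pair, hence extends from smooth functions to the
closure. -/
lemma norm_fst_sq_le_of_mem_periodic {h : PairSpace (volume.restrict (box d 1))}
    (hh : h ∈ sobolev (volume.restrict (box d 1)) (periodicSubmodule d)) :
    ‖h.fst‖ ^ 2 ≤ d * ‖h.snd‖ ^ 2 := by
  have hcl : IsClosed {h : PairSpace (volume.restrict (box d 1)) |
      ‖h.fst‖ ^ 2 ≤ d * ‖h.snd‖ ^ 2} :=
    isClosed_le (((WithLp.fstL 2 ℝ _ _).continuous).norm.pow 2)
      (continuous_const.mul (((WithLp.sndL 2 ℝ _ _).continuous).norm.pow 2))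
  refine closure_minimal ?_ hcl hh
  rintro g ⟨ψ, ⟨hψ1, hψ2, hψ3⟩, -, g1, g2⟩
  rw [Set.mem_ofPred_eq, norm_sq_eq_integral, norm_sq_eq_integral]
  have e1 : ∫ x in box d 1, ‖g.fst x‖ ^ 2 = ∫ x in box d 1, ψ x ^ 2 :=
    integral_congr_ae (by filter_upwards [g1] with x hx; rw [hx, Real.norm_eq_abs, sq_abs])
  have e2 : ∫ x in box d 1, ‖g.snd x‖ ^ 2 = ∫ x in box d 1, ‖gradient ψ x‖ ^ 2 :=
    integral_congr_ae (by filter_upwards [g2] with x hx; rw [hx])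
  rw [e1, e2, restrict_box_one]
  rw [restrict_box_one] at hψ3
  exact poincare hψ1 hψ2.latPeriodic hψ3

/-! ### Existence of the correctors -/

/-- The functions underlying a pair of classes. -/
def toFunGrad {ν : Measure (Sp d)} (h : PairSpace ν) : FunGrad d := (h.fst, h.snd)

/-- The bilinear form restricted to a closed subspace. -/
def restrictForm {H : Type*} [NormedAddCommGroup H] [InnerProductSpace ℝ H]
    (b : H →L[ℝ] H →L[ℝ] ℝ) (V : Submodule ℝ H) : V →L[ℝ] V →L[ℝ] ℝ :=
  b.bilinearComp V.subtypeL V.subtypeL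

/-- The Poincaré inequality gives `‖u‖² ≤ (d + 1) ‖∇u‖²`. The constant does not involve `T`, which
is what allows an expansion in powers of `T⁻¹`. -/
lemma IsRegular.energyForm_coercive {α β : ℝ} {A : Field d} (hA : IsRegular α β A)
    (u : PerSpace d) :
    α / (d + 1) * ‖u‖ ^ 2 ≤ restrictForm (hA.energyForm (box d 1)) _ u u := by
  refine le_trans ?_ (hA.energyForm_self (box d 1) u.1)
  have h1 := norm_fst_sq_le_of_mem_periodic u.2
  have h2 := WithLp.prod_norm_sq_eq_of_L2 u.1
  rw [Submodule.coe_norm, h2, div_mul_eq_mul_div, div_le_iff₀ (by positivity), mul_assoc]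
  refine mul_le_mul_of_nonneg_left ?_ hA.pos.le
  linarith

lemma massForm_self_nonneg {ν : Measure (Sp d)} (u : PairSpace ν) : 0 ≤ massForm ν u u := by
  rw [massForm_apply]; exact real_inner_self_nonneg

lemma abs_massForm_le {ν : Measure (Sp d)} (u v : PairSpace ν) :
    |massForm ν u v| ≤ ‖u‖ * ‖v‖ :=
  (norm_inner_le_norm (𝕜 := ℝ) _ _).trans (mul_le_mul (norm_fst_le u) (norm_fst_le v)
        (norm_nonneg _) (norm_nonneg _))

/-- The weak formulation of `τ u - ∇ ⬝ A (ξ + ∇u) = 0` in the closure of a class of smooth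
functions. -/
def IsRegular.IsSolution {α β : ℝ} {A : Field d} (hA : IsRegular α β A) {s : Set (Sp d)}
    (hs : volume s < ⊤) (S : Submodule ℝ (Sp d → ℝ)) (ξ : Sp d) (τ : ℝ)
    (u : sobolev (volume.restrict s) S) : Prop :=
  ∀ v : sobolev (volume.restrict s) S, τ * restrictForm (massForm _) _ u v +
    restrictForm (hA.energyForm s) _ u v = (hA.source hs ξ).comp (Submodule.subtypeL _) v

/-- The dictionary between weak solutions given as functions and elements of the Hilbert space. It
serves the periodic problem and the Dirichlet problem alike. -/
lemma IsRegular.weak_iff_exists_isSolution {α β : ℝ} {A : Field d} (hA : IsRegular α β A)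
    {s : Set (Sp d)} (hs : volume s < ⊤) {S : Submodule ℝ (Sp d → ℝ)}
    (hS : ∀ ψ ∈ S, ContDiff ℝ ∞ ψ) (ξ : Sp d) (τ : ℝ) (w : FunGrad d) :
    (MemH1Closure s (S : Set (Sp d → ℝ)) w ∧ ∀ v, MemH1Closure s (S : Set (Sp d → ℝ)) v →
      ∫ x in s, (τ * (v.1 x * w.1 x) + inner ℝ (v.2 x) (act (A x) (ξ + w.2 x))) = 0) ↔
      ∃ u, hA.IsSolution hs S ξ τ u ∧ u.1.fst =ᵐ[volume.restrict s] w.1 ∧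
        u.1.snd =ᵐ[volume.restrict s] w.2 := by
  constructor
  · rintro ⟨hw, heq⟩
    obtain ⟨h, hh, h1, h2⟩ := hw.exists_mem_sobolev hS
    refine ⟨⟨h, hh⟩, fun v => ?_, h1, h2⟩
    have hv : MemH1Closure s (S : Set (Sp d → ℝ)) (toFunGrad v.1) :=
      memH1Closure_of_mem_sobolev v.2 .rfl .rfl
    have e := hA.weak_form_eq hs ξ τ h v.1 h1 h2 (z := toFunGrad v.1) .rfl .rfl
    rw [heq _ hv] at e
    exact (sub_eq_zero.1 e.symm)
  · rintro ⟨u, hu, h1, h2⟩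
    refine ⟨memH1Closure_of_mem_sobolev u.2 h1 h2, fun v hv => ?_⟩
    obtain ⟨h, hh, g1, g2⟩ := hv.exists_mem_sobolev hS
    rw [hA.weak_form_eq hs ξ τ u.1 h h1 h2 g1 g2, sub_eq_zero]
    exact hu ⟨h, hh⟩

/-- The weak formulation of the equation for the (regularized) periodic corrector. -/
def IsRegular.IsPerSolution {α β : ℝ} {A : Field d} (hA : IsRegular α β A) (ξ : Sp d) (τ : ℝ)
    (u : PerSpace d) : Prop :=
  hA.IsSolution (volume_box_lt_top 1) (periodicSubmodule d) ξ τ u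

lemma IsRegular.exists_isPerSolution {α β : ℝ} {A : Field d} (hA : IsRegular α β A) (ξ : Sp d)
    {τ : ℝ} (hτ : 0 ≤ τ) : ∃ u, hA.IsPerSolution ξ τ u := by
  have hd : (0 : ℝ) < α / (d + 1) := div_pos hA.pos (by positivity)
  obtain ⟨u, hu⟩ := exists_solution (V := PerSpace d)
    (a := τ • restrictForm (massForm _) _ + restrictForm (hA.energyForm (box d 1)) _) hd
    (fun u => (hA.energyForm_coercive u).trans
      (le_add_of_nonneg_left (mul_nonneg hτ (massForm_self_nonneg u.1))))
    ((hA.source (volume_box_lt_top 1) ξ).comp (Submodule.subtypeL _))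
  exact ⟨u, hu⟩

lemma IsRegular.isCorrector_iff {α β : ℝ} {A : Field d} (hA : IsRegular α β A) (ξ : Sp d)
    (w : FunGrad d) : IsCorrector A ξ w ↔ ∃ u, hA.IsPerSolution ξ 0 u ∧
      u.1.fst =ᵐ[volume.restrict (box d 1)] w.1 ∧ u.1.snd =ᵐ[volume.restrict (box d 1)] w.2 := by
  refine Iff.trans ?_ (hA.weak_iff_exists_isSolution (volume_box_lt_top 1)
    contDiff_of_mem_periodicSubmodule ξ 0 w)
  simp only [zero_mul, zero_add]
  rfl

/-- Existence suffices for the element picked by `Classical.epsilon` to solve the problem. -/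
lemma IsRegular.isCorrector_corrector {α β : ℝ} {A : Field d} (hA : IsRegular α β A) (ξ : Sp d) :
    IsCorrector A ξ (corrector A ξ) := by
  obtain ⟨u, hu⟩ := hA.exists_isPerSolution ξ le_rfl
  exact Classical.epsilon_spec (p := fun w => IsCorrector A ξ w)
    ⟨toFunGrad u.1, (hA.isCorrector_iff ξ _).2 ⟨u, hu, .rfl, .rfl⟩⟩

/-- The zero-order term controls the function itself, so no Poincaré inequality is needed on `Q_R`.
The constant depends on `τ`, but it is used only for existence. -/
lemma IsRegular.regularizedForm_coercive {α β : ℝ} {A : Field d} (hA : IsRegular α β A)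
    {s : Set (Sp d)} (S : Submodule ℝ (Sp d → ℝ)) (τ : ℝ)
    (u : sobolev (volume.restrict s) S) :
    min τ α * ‖u‖ ^ 2 ≤
      (τ • restrictForm (massForm _) _ + restrictForm (hA.energyForm s) _ :
        sobolev (volume.restrict s) S →L[ℝ] sobolev (volume.restrict s) S →L[ℝ] ℝ) u u := by
  have h2 := WithLp.prod_norm_sq_eq_of_L2 u.1
  have h3 := hA.energyForm_self s u.1
  have h4 : massForm _ u.1 u.1 = ‖u.1.fst‖ ^ 2 := by
    rw [massForm_apply]; exact real_inner_self_eq_norm_sq _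
  change _ ≤ τ * massForm _ u.1 u.1 + hA.energyForm s u.1 u.1
  rw [Submodule.coe_norm, h2, h4, mul_add]
  exact add_le_add (mul_le_mul_of_nonneg_right (min_le_left _ _) (sq_nonneg _))
    (le_trans (mul_le_mul_of_nonneg_right (min_le_right _ _) (sq_nonneg _)) h3)

lemma IsRegular.isRegCorrector_regCorrector {α β : ℝ} {A : Field d} (hA : IsRegular α β A)
    (ξ : Sp d) {T : ℝ} (hT : 0 < T) (R : ℝ) : IsRegCorrector A ξ T R (regCorrector A ξ T R) := by
  obtain ⟨u, hu⟩ := exists_solution (lt_min (inv_pos.2 hT) hA.pos)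
    (hA.regularizedForm_coercive (testSubmodule (box d R)) T⁻¹)
    ((hA.source (volume_box_lt_top R) ξ).comp (Submodule.subtypeL _))
  have h := (hA.weak_iff_exists_isSolution (volume_box_lt_top R) contDiff_of_mem_testSubmodule
    ξ T⁻¹ (toFunGrad u.1)).2 ⟨u, hu, .rfl, .rfl⟩
  exact Classical.epsilon_spec (p := fun w => IsRegCorrector A ξ T R w) ⟨_, h⟩

/-! ### Periodic extension -/

lemma eLpNorm_box_le {E : Type*} [NormedAddCommGroup E] {f : Sp d → E} (hf : LatPeriodic f)
    (hm : AEStronglyMeasurable f volume) {R : ℝ} (hR : 0 ≤ R) :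
    eLpNorm f 2 (volume.restrict (box d R)) ≤
      ENNReal.ofReal ((R + 2) ^ d) ^ (1 / 2 : ℝ) * eLpNorm f 2 (volume.restrict (box d 1)) := by
  have h := lintegral_box_le (fun x => ‖f x‖ₑ ^ (2 : ℝ)) (fun x n => by simp only [hf x n])
    (hm.enorm.pow_const 2) hR
  rw [restrict_box_one, eLpNorm_eq_lintegral_rpow_enorm_toReal (by simp) (by simp),
    eLpNorm_eq_lintegral_rpow_enorm_toReal (by simp) (by simp), ENNReal.toReal_ofNat,
    ← ENNReal.mul_rpow_of_nonneg _ _ (by norm_num)]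
  exact ENNReal.rpow_le_rpow h (by norm_num)

/-- The periodic extension of a pair given on the cell. -/
def perExt (u : PairSpace (volume.restrict (box d 1))) : FunGrad d :=
  (fun x => u.fst (rep x), fun x => u.snd (rep x))

lemma latPeriodic_perExt_fst (u : PairSpace (volume.restrict (box d 1))) :
    LatPeriodic (perExt u).1 := latPeriodic_comp_rep _

lemma latPeriodic_perExt_snd (u : PairSpace (volume.restrict (box d 1))) :
    LatPeriodic (perExt u).2 := latPeriodic_comp_rep _

lemma aestronglyMeasurable_perExt_fst (u : PairSpace (volume.restrict (box d 1))) :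
    AEStronglyMeasurable (perExt u).1 volume :=
  ((Lp.stronglyMeasurable u.fst).comp_measurable measurable_rep).aestronglyMeasurable

lemma aestronglyMeasurable_perExt_snd (u : PairSpace (volume.restrict (box d 1))) :
    AEStronglyMeasurable (perExt u).2 volume :=
  ((Lp.stronglyMeasurable u.snd).comp_measurable measurable_rep).aestronglyMeasurable

lemma perExt_of_mem_cell (u : PairSpace (volume.restrict (box d 1))) {x : Sp d} (hx : x ∈ cell d) :
    (perExt u).1 x = u.fst x ∧ (perExt u).2 x = u.snd x := by
  simp only [perExt, rep_of_mem_cell hx, and_self]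

lemma perExt_ae_eq (u : PairSpace (volume.restrict (box d 1))) :
    u.fst =ᵐ[volume.restrict (box d 1)] (perExt u).1 ∧
      u.snd =ᵐ[volume.restrict (box d 1)] (perExt u).2 := by
  have h : ∀ᵐ x ∂(volume.restrict (box d 1)), x ∈ cell d := by
    rw [restrict_box_one]; exact ae_restrict_mem measurableSet_cell
  exact ⟨h.mono fun x hx => (perExt_of_mem_cell u hx).1.symm,
    h.mono fun x hx => (perExt_of_mem_cell u hx).2.symm⟩

lemma memLp_perExt (u : PairSpace (volume.restrict (box d 1))) (R : ℝ) :
    MemLp (perExt u).1 2 (volume.restrict (box d R)) ∧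
      MemLp (perExt u).2 2 (volume.restrict (box d R)) := by
  have hmono : box d R ⊆ box d (max R 0) := fun x hx i => (hx i).trans_le (le_max_left _ _)
  have hms := Measure.restrict_mono hmono (le_refl (volume : Measure (Sp d)))
  constructor
  · refine MemLp.mono_measure hms ⟨(aestronglyMeasurable_perExt_fst u).restrict, ?_⟩
    refine (eLpNorm_box_le (latPeriodic_perExt_fst u) (aestronglyMeasurable_perExt_fst u)
      (le_max_right R 0)).trans_lt (ENNReal.mul_lt_top ?_ ?_)
    · exact ENNReal.rpow_lt_top_of_nonneg (by norm_num) ENNReal.ofReal_ne_top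
    · rw [← eLpNorm_congr_ae (perExt_ae_eq u).1]; exact Lp.eLpNorm_lt_top _
  · refine MemLp.mono_measure hms ⟨(aestronglyMeasurable_perExt_snd u).restrict, ?_⟩
    refine (eLpNorm_box_le (latPeriodic_perExt_snd u) (aestronglyMeasurable_perExt_snd u)
      (le_max_right R 0)).trans_lt (ENNReal.mul_lt_top ?_ ?_)
    · exact ENNReal.rpow_lt_top_of_nonneg (by norm_num) ENNReal.ofReal_ne_top
    · rw [← eLpNorm_congr_ae (perExt_ae_eq u).2]; exact Lp.eLpNorm_lt_top _

/-- The smooth functions as a linear space. -/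
def smoothSubmodule (d : ℕ) : Submodule ℝ (Sp d → ℝ) where
  carrier := {ψ | ContDiff ℝ ∞ ψ}
  zero_mem' := (contDiff_const : ContDiff ℝ ∞ fun _ : Sp d => (0 : ℝ))
  add_mem' := fun {a b} (h : ContDiff ℝ ∞ a) (h' : ContDiff ℝ ∞ b) => h.add h'
  smul_mem' := fun c a (h : ContDiff ℝ ∞ a) => h.const_smul c

/-- The periodic extension is locally a limit of smooth functions in `H¹`. -/
lemma memH1Closure_perExt (u : PerSpace d) {R : ℝ} (hR : 0 ≤ R) :
    MemH1Closure (box d R) (smoothSubmodule d : Set (Sp d → ℝ)) (perExt u.1) := by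
  refine ⟨(memLp_perExt u.1 R).1, (memLp_perExt u.1 R).2, fun ε hε => ?_⟩
  have hper : MemH1per (perExt u.1) :=
    memH1Closure_of_mem_sobolev u.2 (perExt_ae_eq u.1).1 (perExt_ae_eq u.1).2
  set K : ℝ := ((R + 2) ^ d) ^ (1 / 2 : ℝ) with hK
  have hKpos : 0 < K := by positivity
  -- Passing from the cell to `Q_R` costs at most the factor `K` in the `L²` norm; the accuracy on
  -- the cell is chosen accordingly.
  obtain ⟨ψ, ⟨hψ1, hψ2, -⟩, e1, e2⟩ := hper.2.2 (K⁻¹ * ε) (by positivity)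
  have hKe : ENNReal.ofReal ((R + 2) ^ d) ^ (1 / 2 : ℝ) = ENNReal.ofReal K := by
    rw [ENNReal.ofReal_rpow_of_nonneg (by positivity) (by norm_num)]
  have hmul : ENNReal.ofReal K * ENNReal.ofReal (K⁻¹ * ε) = ENNReal.ofReal ε := by
    rw [← ENNReal.ofReal_mul hKpos.le, mul_inv_cancel_left₀ hKpos.ne']
  have hp := hψ2.latPeriodic
  refine ⟨ψ, hψ1, ?_, ?_⟩
  · refine (eLpNorm_box_le (fun x n => ?_) ((aestronglyMeasurable_perExt_fst u.1).sub
      hψ1.continuous.aestronglyMeasurable) hR).trans ?_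
    · simp only [latPeriodic_perExt_fst u.1 x n, hp x n, Pi.sub_apply]
    · rw [hKe, ← hmul]; gcongr; exact e1
  · refine (eLpNorm_box_le (fun x n => ?_) ((aestronglyMeasurable_perExt_snd u.1).sub
      (contDiff_gradient hψ1).continuous.aestronglyMeasurable) hR).trans ?_
    · simp only [latPeriodic_perExt_snd u.1 x n, hp.gradient x n, Pi.sub_apply]
    · rw [hKe, ← hmul]; gcongr; exact e2

lemma memLp_box_of_continuous {E : Type*} [NormedAddCommGroup E] {f : Sp d → E}
    (hf : Continuous f) (R : ℝ) : MemLp f 2 (volume.restrict (box d R)) :=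
  (memLp_two_iff_integrable_sq_norm hf.aestronglyMeasurable).2
    (integrableOn_box_of_continuous (hf.norm.pow 2) R)

/-! ### Periodization of test functions -/

/-- The periodization of a compactly supported function. -/
def periodize (v : Sp d → ℝ) (x : Sp d) : ℝ := ∑' n : Fin d → ℤ, v (x + lat n)

lemma latPeriodic_periodize (v : Sp d → ℝ) : LatPeriodic (periodize v) := by
  intro x m
  simp only [periodize, add_assoc, ← lat_add]
  exact (Equiv.addLeft m).tsum_eq fun n => v (x + lat n)

lemma periodize_eq_sum {v : Sp d → ℝ} {R M : ℝ} {N : ℕ} (hN : R + M ≤ 2 * N)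
    (hv : ∀ x, x ∉ box d R → v x = 0) {x : Sp d} (hx : ∀ i, |x i| ≤ M) :
    periodize v x = ∑ n ∈ latCube d N, v (x + lat n) :=
  tsum_eq_sum fun _ hn => hv _ (add_lat_notMem_box hN hx hn)

/-- Near a point the series is a finite sum over a fixed set of lattice vectors, so it can be
differentiated term by term. -/
lemma periodize_eventuallyEq {v : Sp d → ℝ} {R M : ℝ} {N : ℕ} (hN : R + (M + 1) ≤ 2 * N)
    (hv : ∀ x, x ∉ box d R → v x = 0) {x : Sp d} (hx : ∀ i, |x i| ≤ M) :
    periodize v =ᶠ[nhds x] fun y => ∑ n ∈ latCube d N, v (y + lat n) := by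
  have hbox : box d (M + 1) ∈ nhds x :=
    (isOpen_box _).mem_nhds fun i => lt_of_le_of_lt (hx i) (by linarith)
  filter_upwards [hbox] with y hy
  exact periodize_eq_sum hN hv fun i => (hy i).le

lemma contDiff_periodize {v : Sp d → ℝ} (hc : ContDiff ℝ ∞ v) {R : ℝ}
    (hv : ∀ x, x ∉ box d R → v x = 0) : ContDiff ℝ ∞ (periodize v) := by
  rw [contDiff_iff_contDiffAt]
  intro x
  obtain ⟨N, hN⟩ := exists_nat_ge ((R + (‖x‖ + 1)) / 2)
  refine ContDiffAt.congr_of_eventuallyEq ?_ (periodize_eventuallyEq (N := N) (by linarith) hv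
    fun i => PiLp.norm_apply_le x i)
  exact (ContDiff.sum fun n _ => hc.comp (contDiff_id.add contDiff_const)).contDiffAt

lemma gradient_periodize {v : Sp d → ℝ} (hc : ContDiff ℝ ∞ v) {R : ℝ}
    (hv : ∀ x, x ∉ box d R → v x = 0) {N : ℕ} (hN : R + 2 ≤ 2 * N) {x : Sp d}
    (hx : ∀ i, |x i| ≤ 1) :
    gradient (periodize v) x = ∑ n ∈ latCube d N, gradient v (x + lat n) := by
  rw [(periodize_eventuallyEq (M := 1) (by linarith) hv hx).gradient_eq]
  simp only [gradient]
  rw [fderiv_fun_sum, map_sum]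
  · refine Finset.sum_congr rfl fun n _ => ?_
    rw [fderiv_comp_add_right]
  · intro n _
    exact ((hc.differentiable (by simp)).comp (differentiable_id.add_const _)) x

/-- The mean of an element of `H¹_per(Q)` vanishes. -/
lemma integral_fst_eq_zero (u : PerSpace d) : ∫ x in box d 1, u.1.fst x = 0 := by
  have hper : MemH1per (toFunGrad u.1) := memH1Closure_of_mem_sobolev u.2 .rfl .rfl
  set ν := (volume : Measure (Sp d)).restrict (box d 1) with hν
  have : IsFiniteMeasure ν := ⟨by simpa [hν] using volume_box_lt_top (d := d) 1⟩
  have h1 : MemLp (fun _ : Sp d => (1 : ℝ)) 2 ν := memLp_const 1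
  have hcl : IsClosed {h : PairSpace ν | inner ℝ (h1.toLp _) h.fst = 0} :=
    isClosed_eq ((continuous_const.inner (WithLp.fstL 2 ℝ _ _).continuous)) continuous_const
  have hin : ∀ h : PairSpace ν, inner ℝ (h1.toLp _) h.fst = ∫ x, h.fst x ∂ν := by
    intro h
    rw [L2.inner_def]
    refine integral_congr_ae ?_
    filter_upwards [h1.coeFn_toLp] with x hx
    rw [hx]; simp
  have hmem := closure_minimal (s := (gradPairs ν (periodicSubmodule d) : Set (PairSpace ν)))
    (fun g hg => ?_) hcl u.2
  · rw [← hin]; exact hmem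
  · obtain ⟨ψ, ⟨-, -, h0⟩, -, g1, -⟩ := hg
    change inner ℝ (h1.toLp _) g.fst = 0
    rw [hin, integral_congr_ae g1, h0]

/-- A periodic solution solves the equation in the whole space. -/
lemma IsRegular.IsPerSolution.integral_test_eq_zero {α β : ℝ} {A : Field d}
    {hA : IsRegular α β A} {ξ : Sp d} {τ : ℝ} {u : PerSpace d} (hu : hA.IsPerSolution ξ τ u)
    {R : ℝ} {v : Sp d → ℝ} (hv : v ∈ testFunctions (box d R)) :
    ∫ x in box d R, (τ * (v x * (perExt u.1).1 x) +
      inner ℝ (gradient v x) (act (A x) (ξ + (perExt u.1).2 x))) = 0 := by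
  obtain ⟨hc, hcs, hsupp⟩ := hv
  set U := (perExt u.1).1 with hU
  set B : Sp d → Sp d := fun x => act (A x) (ξ + (perExt u.1).2 x) with hB
  have hUp : LatPeriodic U := latPeriodic_perExt_fst u.1
  have hBp : LatPeriodic B := fun x n => by
    simp only [hB, hA.periodic x n, latPeriodic_perExt_snd u.1 x n]
  have hU2 : ∀ R, MemLp U 2 (volume.restrict (box d R)) := fun R => (memLp_perExt u.1 R).1
  have hB2 : ∀ R, MemLp B 2 (volume.restrict (box d R)) := fun R =>
    hA.memLp_act ((memLp_two_const (volume_box_lt_top R) ξ).add (memLp_perExt u.1 R).2)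
  set F : Sp d → ℝ := fun x => τ * (v x * U x) + inner ℝ (gradient v x) (B x) with hF
  have hv0 : ∀ x, x ∉ box d R → v x = 0 := fun x hx =>
    image_eq_zero_of_notMem_tsupport fun h => hx (hsupp h)
  have hg0 : ∀ x, x ∉ box d R → gradient v x = 0 := fun x hx => by
    have : fderiv ℝ v x = 0 :=
      image_eq_zero_of_notMem_tsupport fun h => hx (hsupp (tsupport_fderiv_subset ℝ h))
    simp [gradient, this]
  have hF0 : ∀ x, x ∉ box d R → F x = 0 := fun x hx => by
    simp only [hF]; rw [hv0 x hx, hg0 x hx, inner_zero_left]; ring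
  have hgc := (contDiff_gradient hc).continuous
  have hgcs : HasCompactSupport (gradient v) := by
    have := hcs.fderiv (𝕜 := ℝ)
    exact this.comp_left (g := (InnerProductSpace.toDual ℝ (Sp d)).symm) (map_zero _)
  have hvL : MemLp v 2 (volume.restrict (box d R)) :=
    (hc.continuous.memLp_of_hasCompactSupport hcs).restrict _
  have hgL : MemLp (gradient v) 2 (volume.restrict (box d R)) :=
    (hgc.memLp_of_hasCompactSupport hgcs).restrict _
  have hFi : IntegrableOn F (box d R) :=
    ((hvL.integrable_mul (hU2 R)).const_mul τ).add (integrable_inner_of_memLp hgL (hB2 R))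
  have hFint : Integrable F :=
    (integrableOn_iff_integrable_of_support_subset fun x hx =>
      by_contra fun h => hx (hF0 x h)).1 hFi
  have e0 : ∫ x in box d R, F x = ∫ x, F x :=
    setIntegral_eq_integral_of_forall_compl_eq_zero fun x hx => hF0 x hx
  obtain ⟨N, hN⟩ := exists_nat_ge ((R + 2) / 2)
  have hN' : R + 2 ≤ 2 * N := by linarith
  change ∫ x in box d R, F x = 0
  rw [e0, integral_eq_sum_cell hFint (by linarith) hF0]
  set Ψ := periodize v with hΨ
  have hΨc : ContDiff ℝ ∞ Ψ := contDiff_periodize hc hv0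
  have hΨp : LatPeriodic Ψ := latPeriodic_periodize v
  -- The periodization is an admissible periodic test function only after its mean is subtracted.
  -- This leaves the gradient unchanged, and the additional term `τ m ∫ U` vanishes since `U` has
  -- zero mean.
  set m : ℝ := (2 ^ d)⁻¹ * ∫ x in cell d, Ψ x with hm
  have hΨt : (fun x => Ψ x - m) ∈ periodicSubmodule d := by
    refine ⟨hΨc.sub contDiff_const, fun i x => ?_, ?_⟩
    · simp only [hΨp.single i x]
    · rw [restrict_box_one, integral_sub (integrableOn_cell_of_continuous hΨc.continuous)
        (integrableOn_cell_of_continuous continuous_const), setIntegral_const, volume_real_cell, hm,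
        smul_eq_mul, mul_inv_cancel_left₀ (by positivity), sub_self]
  have hgm : gradient (fun x => Ψ x - m) = gradient Ψ := by
    funext x; simp only [gradient]; rw [fderiv_sub_const]
  have hweak := ((hA.weak_iff_exists_isSolution (volume_box_lt_top 1)
    contDiff_of_mem_periodicSubmodule ξ τ (perExt u.1)).2
      ⟨u, hu, (perExt_ae_eq u.1).1, (perExt_ae_eq u.1).2⟩).2
      (fun x => Ψ x - m, gradient fun x => Ψ x - m) ⟨?_, ?_, fun ε hε => ⟨_, hΨt, ?_, ?_⟩⟩
  rotate_left
  · exact memLp_box_of_continuous (hΨc.continuous.sub continuous_const) 1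
  · rw [hgm]
    exact memLp_box_of_continuous (contDiff_gradient hΨc).continuous 1
  · simp
  · simp
  simp only [hgm] at hweak
  replace hweak : ∫ x in cell d, (τ * ((Ψ x - m) * U x) + inner ℝ (gradient Ψ x) (B x)) = 0 :=
    (setIntegral_congr_set box_one_ae_eq_cell).symm.trans hweak
  have hUmean : ∫ x in cell d, U x = 0 := by
    rw [← restrict_box_one, ← integral_fst_eq_zero u]
    exact (integral_congr_ae (perExt_ae_eq u.1).1).symm
  have hUi : IntegrableOn U (cell d) := by
    have h1 := hU2 1
    rw [restrict_box_one] at h1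
    have : IsFiniteMeasure (volume.restrict (cell d)) :=
      ⟨by rw [Measure.restrict_apply_univ, volume_cell]; exact ENNReal.ofReal_lt_top⟩
    exact h1.integrable (by norm_num)
  have hsum : ∀ x ∈ cell d, ∑ n ∈ latCube d N, F (x + lat n) =
      τ * ((Ψ x - m) * U x) + inner ℝ (gradient Ψ x) (B x) + τ * m * U x := by
    intro x hx
    have hx1 := abs_le_one_of_mem_cell hx
    simp only [hF, hUp x, hBp x]
    rw [Finset.sum_add_distrib, ← Finset.mul_sum, ← Finset.sum_mul, ← sum_inner, hΨ,
      gradient_periodize hc hv0 hN' hx1, periodize_eq_sum (by linarith) hv0 hx1]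
    ring
  rw [setIntegral_congr_fun measurableSet_cell hsum, integral_add, hweak, integral_const_mul,
    hUmean, mul_zero, add_zero]
  · rw [← restrict_box_one]
    exact ((MemLp.integrable_mul (memLp_box_of_continuous (hΨc.continuous.sub continuous_const) 1)
      (hU2 1)).const_mul τ).add (integrable_inner_of_memLp
        (memLp_box_of_continuous (contDiff_gradient hΨc).continuous 1) (hB2 1))
  · exact hUi.const_mul _

/-- A periodic solution can be tested with `H¹₀(Q_R)`. -/
lemma IsRegular.IsPerSolution.integral_memH10_eq_zero {α β : ℝ} {A : Field d}
    {hA : IsRegular α β A} {ξ : Sp d} {τ : ℝ} {u : PerSpace d} (hu : hA.IsPerSolution ξ τ u)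
    {R : ℝ} {v : FunGrad d} (hv : MemH10 R v) :
    ∫ x in box d R, (τ * (v.1 x * (perExt u.1).1 x) +
      inner ℝ (v.2 x) (act (A x) (ξ + (perExt u.1).2 x))) = 0 := by
  obtain ⟨h, hh, h1, h2⟩ := MemH1Closure.exists_mem_sobolev (S := testSubmodule (box d R))
    contDiff_of_mem_testSubmodule hv
  obtain ⟨m1, m2⟩ := memLp_perExt u.1 R
  set g : PairSpace (volume.restrict (box d R)) := WithLp.toLp 2 (m1.toLp _, m2.toLp _) with hg
  have key : ∀ (k : PairSpace (volume.restrict (box d R))) (z : FunGrad d), _ → _ → _ :=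
    fun k z hk1 hk2 => hA.weak_form_eq (volume_box_lt_top R) ξ τ g k (z := z) (w := perExt u.1)
      m1.coeFn_toLp m2.coeFn_toLp hk1 hk2
  rw [key h v h1 h2]
  -- The identity is continuous in the test pair, so it extends from test functions to their
  -- closure.
  have hcl : IsClosed {k : PairSpace (volume.restrict (box d R)) | τ * massForm _ g k +
      hA.energyForm (box d R) g k - hA.source (volume_box_lt_top R) ξ k = 0} :=
    isClosed_eq (((continuous_const.mul (massForm _ g).continuous).add
      (hA.energyForm (box d R) g).continuous).sub
        (hA.source (volume_box_lt_top R) ξ).continuous) continuous_const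
  refine closure_minimal (s := (gradPairs (volume.restrict (box d R)) (testSubmodule (box d R)) :
    Set (PairSpace (volume.restrict (box d R))))) (fun k hk => ?_) hcl hh
  obtain ⟨ψ, hψ, -, g1, g2⟩ := hk
  change τ * massForm _ g k + hA.energyForm (box d R) g k -
    hA.source (volume_box_lt_top R) ξ k = 0
  rw [← key k (ψ, gradient ψ) g1 g2]
  exact hu.integral_test_eq_zero hψ

/-! ### Localization -/

lemma gradient_mul {ζ ψ : Sp d → ℝ} (hζ : ContDiff ℝ ∞ ζ) (hψ : ContDiff ℝ ∞ ψ) (x : Sp d) :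
    gradient (fun x => ζ x * ψ x) x = ζ x • gradient ψ x + ψ x • gradient ζ x := by
  simp only [gradient]
  rw [fderiv_fun_mul (hζ.differentiable (by simp) x) (hψ.differentiable (by simp) x), map_add,
    map_smul, map_smul]

lemma exists_bound_of_mem_testFunctions {U : Set (Sp d)} {ζ : Sp d → ℝ} (hζ : ζ ∈ testFunctions U) :
    ∃ K, 0 < K ∧ ∀ x, ‖ζ x‖ ≤ K ∧ ‖gradient ζ x‖ ≤ K := by
  obtain ⟨hc, hcs, -⟩ := hζ
  have hgcs : HasCompactSupport (gradient ζ) := by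
    have := hcs.fderiv (𝕜 := ℝ)
    exact this.comp_left (g := (InnerProductSpace.toDual ℝ (Sp d)).symm) (map_zero _)
  obtain ⟨K₁, h1⟩ := hcs.exists_bound_of_continuous hc.continuous
  obtain ⟨K₂, h2⟩ := hgcs.exists_bound_of_continuous (contDiff_gradient hc).continuous
  refine ⟨max 1 (max K₁ K₂), lt_max_of_lt_left one_pos, fun x => ⟨(h1 x).trans ?_, (h2 x).trans ?_⟩⟩
  · exact (le_max_left _ _).trans (le_max_right _ _)
  · exact (le_max_right _ _).trans (le_max_right _ _)

/-- A cutoff turns a function without boundary condition into an admissible test function on `Q_R`.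
This is needed for the periodic extension, which does not vanish on the boundary. -/
lemma MemH1Closure.mul_test {R : ℝ} {w : FunGrad d}
    (hw : MemH1Closure (box d R) (smoothSubmodule d : Set (Sp d → ℝ)) w) {ζ : Sp d → ℝ}
    (hζ : ζ ∈ testFunctions (box d R)) :
    MemH10 R (fun x => ζ x * w.1 x, fun x => ζ x • w.2 x + w.1 x • gradient ζ x) := by
  obtain ⟨K, hK, hb⟩ := exists_bound_of_mem_testFunctions hζ
  obtain ⟨hc, hcs, hsupp⟩ := hζ
  have hgc := (contDiff_gradient hc).continuous
  obtain ⟨m1, m2, happ⟩ := hw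
  set ν := (volume : Measure (Sp d)).restrict (box d R) with hν
  have n1 : MemLp (fun x => ζ x * w.1 x) 2 ν :=
    m1.of_le_mul (c := K) (hc.continuous.aestronglyMeasurable.mul m1.1)
      (Filter.Eventually.of_forall fun x => by
        rw [norm_mul]; exact mul_le_mul_of_nonneg_right (hb x).1 (norm_nonneg _))
  have n2 : MemLp (fun x => ζ x • w.2 x) 2 ν :=
    m2.of_le_mul (c := K) (hc.continuous.aestronglyMeasurable.smul m2.1)
      (Filter.Eventually.of_forall fun x => by
        rw [norm_smul]; exact mul_le_mul_of_nonneg_right (hb x).1 (norm_nonneg _))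
  have n3 : MemLp (fun x => w.1 x • gradient ζ x) 2 ν :=
    m1.of_le_mul (c := K) (m1.1.smul hgc.aestronglyMeasurable)
      (Filter.Eventually.of_forall fun x => by
        rw [norm_smul, mul_comm]; exact mul_le_mul_of_nonneg_right (hb x).2 (norm_nonneg _))
  refine ⟨n1, n2.add n3, fun ε hε => ?_⟩
  -- The product rule produces two gradient errors, each amplified by at most `K`.
  obtain ⟨ψ, hψ, e1, e2⟩ := happ (ε / (2 * K)) (by positivity)
  have hψ' : ContDiff ℝ ∞ ψ := hψ
  have hgψ := (contDiff_gradient hψ').continuous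
  have hmul : ENNReal.ofReal K * ENNReal.ofReal (ε / (2 * K)) = ENNReal.ofReal (ε / 2) := by
    rw [← ENNReal.ofReal_mul hK.le]; congr 1; field_simp
  have f1 : ∀ {E : Type} [NormedAddCommGroup E] (f : Sp d → E) {g : Sp d → ℝ},
      (∀ x, ‖f x‖ ≤ K * ‖g x‖) → eLpNorm g 2 ν ≤ ENNReal.ofReal (ε / (2 * K)) →
      eLpNorm f 2 ν ≤ ENNReal.ofReal (ε / 2) := fun f g hfg hg => by
    refine (eLpNorm_le_mul_eLpNorm_of_ae_le_mul (Filter.Eventually.of_forall hfg) 2).trans ?_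
    rw [← hmul]; gcongr
  refine ⟨fun x => ζ x * ψ x, ⟨hc.mul hψ', hcs.mul_right, ?_⟩, ?_, ?_⟩
  · exact (tsupport_mul_subset_left).trans hsupp
  · refine (f1 (fun x => ζ x * w.1 x - ζ x * ψ x) (fun x => ?_) e1).trans
      (ENNReal.ofReal_le_ofReal (by linarith))
    rw [← mul_sub, norm_mul]; exact mul_le_mul_of_nonneg_right (hb x).1 (norm_nonneg _)
  · have hsplit : (fun x => ζ x • w.2 x + w.1 x • gradient ζ x - gradient (fun x => ζ x * ψ x) x) =
        (fun x => ζ x • (w.2 x - gradient ψ x)) + fun x => (w.1 x - ψ x) • gradient ζ x := by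
      funext x
      rw [gradient_mul hc hψ', Pi.add_apply, smul_sub, sub_smul]; abel
    simp only
    rw [hsplit]
    refine (eLpNorm_add_le ?_ ?_ (by norm_num)).trans ?_
    · exact hc.continuous.aestronglyMeasurable.smul (m2.1.sub hgψ.aestronglyMeasurable)
    · exact (m1.1.sub hψ'.continuous.aestronglyMeasurable).smul hgc.aestronglyMeasurable
    · have hhalf : ENNReal.ofReal ε = ENNReal.ofReal (ε / 2) + ENNReal.ofReal (ε / 2) := by
        rw [← ENNReal.ofReal_add (by positivity) (by positivity)]; congr 1; ring
      rw [hhalf]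
      refine add_le_add (f1 _ (g := fun x => ‖w.2 x - gradient ψ x‖) (fun x => ?_) ?_)
        (f1 _ (fun x => ?_) e1)
      · rw [norm_smul, norm_norm]; exact mul_le_mul_of_nonneg_right (hb x).1 (norm_nonneg _)
      · rw [eLpNorm_norm]; exact e2
      · rw [norm_smul, mul_comm]; exact mul_le_mul_of_nonneg_right (hb x).2 (norm_nonneg _)

lemma MemH1Closure.sub {U : Set (Sp d)} {S : Submodule ℝ (Sp d → ℝ)}
    (hS : ∀ ψ ∈ S, ContDiff ℝ ∞ ψ) {w z : FunGrad d}
    (hw : MemH1Closure U (S : Set (Sp d → ℝ)) w) (hz : MemH1Closure U (S : Set (Sp d → ℝ)) z) :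
    MemH1Closure U (S : Set (Sp d → ℝ)) (w - z) := by
  obtain ⟨h, hh, h1, h2⟩ := hw.exists_mem_sobolev hS
  obtain ⟨g, hg, g1, g2⟩ := hz.exists_mem_sobolev hS
  refine memH1Closure_of_mem_sobolev (Submodule.sub_mem _ hh hg) ?_ ?_
  · filter_upwards [h1, g1, Lp.coeFn_sub h.fst g.fst] with x e1 e2 e3
    rw [WithLp.sub_fst, e3, Pi.sub_apply, e1, e2]; rfl
  · filter_upwards [h2, g2, Lp.coeFn_sub h.snd g.snd] with x e1 e2 e3
    rw [WithLp.sub_snd, e3, Pi.sub_apply, e1, e2]; rfl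

lemma MemH1Closure.mono {U : Set (Sp d)} {S S' : Set (Sp d → ℝ)} (h : S ⊆ S') {w : FunGrad d}
    (hw : MemH1Closure U S w) : MemH1Closure U S' w :=
  ⟨hw.1, hw.2.1, fun ε hε => by
    obtain ⟨ψ, hψ, h'⟩ := hw.2.2 ε hε
    exact ⟨ψ, h hψ, h'⟩⟩

/-- The Caccioppoli inequality with a weight whose gradient is controlled by the weight. -/
lemma IsRegular.caccioppoli {α β : ℝ} {A : Field d} (hA : IsRegular α β A) {T R : ℝ}
    {w : FunGrad d} (hw : MemH1Closure (box d R) (smoothSubmodule d : Set (Sp d → ℝ)) w)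
    (heq : ∀ v, MemH10 R v →
      ∫ x in box d R, (T⁻¹ * (v.1 x * w.1 x) + inner ℝ (v.2 x) (act (A x) (w.2 x))) = 0)
    {η : Sp d → ℝ} (hη : η ∈ testFunctions (box d R))
    (hg : ∀ x, 2 * β ^ 2 / α * ‖gradient η x‖ ^ 2 ≤ T⁻¹ * (η x ^ 2 + 4)) :
    α / 2 * ∫ x in box d R, η x ^ 2 * ‖w.2 x‖ ^ 2 ≤ 4 * T⁻¹ * ∫ x in box d R, w.1 x ^ 2 := by
  -- The equation is tested with `η² w`.
  have hζ : (fun x => η x * η x) ∈ testFunctions (box d R) :=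
    ⟨hη.1.mul hη.1, hη.2.1.mul_right, tsupport_mul_subset_left.trans hη.2.2⟩
  have hv := hw.mul_test hζ
  have h0 := heq _ hv
  obtain ⟨K, hK, hb⟩ := exists_bound_of_mem_testFunctions hη
  obtain ⟨m1, m2, -⟩ := hw
  have hI : IntegrableOn (fun x => T⁻¹ * ((η x * η x * w.1 x) * w.1 x) +
      inner ℝ ((η x * η x) • w.2 x + w.1 x • gradient (fun x => η x * η x) x)
        (act (A x) (w.2 x))) (box d R) :=
    ((hv.1.integrable_mul m1).const_mul _).add (integrable_inner_of_memLp hv.2.1 (hA.memLp_act m2))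
  have i1 : IntegrableOn (fun x => w.1 x ^ 2) (box d R) := m1.integrable_sq
  have i2 : IntegrableOn (fun x => η x ^ 2 * ‖w.2 x‖ ^ 2) (box d R) := by
    have h1 : MemLp (fun x => η x • w.2 x) 2 (volume.restrict (box d R)) :=
      m2.of_le_mul (c := K) (hη.1.continuous.aestronglyMeasurable.smul m2.1)
        (Filter.Eventually.of_forall fun x => by
          rw [norm_smul]; exact mul_le_mul_of_nonneg_right (hb x).1 (norm_nonneg _))
    refine (integrable_norm_sq h1).congr (Filter.Eventually.of_forall fun x => ?_)
    simp only
    rw [norm_smul, mul_pow, Real.norm_eq_abs, sq_abs]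
  have hpt : ∀ x, α / 2 * (η x ^ 2 * ‖w.2 x‖ ^ 2) - 4 * T⁻¹ * w.1 x ^ 2 ≤
      T⁻¹ * ((η x * η x * w.1 x) * w.1 x) +
      inner ℝ ((η x * η x) • w.2 x + w.1 x • gradient (fun x => η x * η x) x)
        (act (A x) (w.2 x)) := by
    intro x
    rw [gradient_mul hη.1 hη.1, inner_add_left, inner_smul_left, inner_smul_left, inner_add_left,
      inner_smul_left]
    simp only [conj_trivial]
    have e1 := (hA.elliptic x (w.2 x)).1
    have e2 := hA.abs_inner_act_le x (gradient η x) (w.2 x)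
    have e3 := hg x
    set G := ‖w.2 x‖
    set g := ‖gradient η x‖
    set p := inner ℝ (gradient η x) (act (A x) (w.2 x))
    set q := inner ℝ (w.2 x) (act (A x) (w.2 x))
    set e := η x
    set a := w.1 x
    have hα := hA.pos
    -- Young's inequality for the cross term `2 η w ∇η ⬝ A ∇w`, using half of the ellipticity. In
    -- the resulting `2 β² / α |∇η|² w² ≤ T⁻¹ (η² + 4) w²` the part with `η²` is absorbed by the
    -- zero-order term of the equation.
    have f1 : 0 ≤ α / 2 * (|e| * G - 2 * β / α * (|a| * g)) ^ 2 := by positivity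
    have f2 : α / 2 * (|e| * G - 2 * β / α * (|a| * g)) ^ 2 =
        α / 2 * (|e| ^ 2 * G ^ 2) - 2 * (|e| * |a|) * (β * (g * G)) +
          2 * β ^ 2 / α * g ^ 2 * |a| ^ 2 := by
      field_simp; ring
    rw [f2, sq_abs, sq_abs] at f1
    have f3 : -(2 * (|e| * |a|) * (β * (g * G))) ≤ 2 * (e * a) * p := by
      have h1 : |2 * (e * a) * p| ≤ 2 * (|e| * |a|) * (β * (g * G)) := by
        rw [abs_mul, abs_mul, abs_mul, abs_two]
        exact mul_le_mul_of_nonneg_left e2 (by positivity)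
      exact (neg_le_neg h1).trans (neg_abs_le _)
    have f4 : 2 * β ^ 2 / α * g ^ 2 * a ^ 2 ≤ T⁻¹ * (e ^ 2 + 4) * a ^ 2 :=
      mul_le_mul_of_nonneg_right e3 (sq_nonneg a)
    have f5 : α * G ^ 2 * e ^ 2 ≤ q * e ^ 2 := mul_le_mul_of_nonneg_right e1 (sq_nonneg e)
    nlinarith
  have hle := integral_mono ((i2.const_mul (α / 2)).sub (i1.const_mul (4 * T⁻¹))) hI hpt
  simp only [Pi.sub_apply] at hle
  rw [h0, integral_sub (i2.const_mul (α / 2)) (i1.const_mul (4 * T⁻¹)), integral_const_mul,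
    integral_const_mul] at hle
  linarith

/-! ### The exponential weight -/

/-- A smooth function that vanishes for `t ≤ 1` and equals `t` for `t ≥ 2`. -/
def cutProfile (t : ℝ) : ℝ := t * Real.smoothTransition (t - 1)

lemma contDiff_cutProfile : ContDiff ℝ ∞ cutProfile :=
  contDiff_id.mul (Real.smoothTransition.contDiff.comp (contDiff_id.sub contDiff_const))

lemma cutProfile_of_le_one {t : ℝ} (h : t ≤ 1) : cutProfile t = 0 := by
  rw [cutProfile, Real.smoothTransition.zero_of_nonpos (by linarith), mul_zero]

lemma cutProfile_of_two_le {t : ℝ} (h : 2 ≤ t) : cutProfile t = t := by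
  rw [cutProfile, Real.smoothTransition.one_of_one_le (by linarith), mul_one]

/-- Beyond `2` the profile is the identity and `t * deriv cutProfile t` equals the profile; on
`[0,2]` that product is bounded. The summand `4` covers the range where the profile vanishes. -/
lemma exists_deriv_cutProfile_le :
    ∃ C, 0 < C ∧ ∀ t, 0 ≤ t → (deriv cutProfile t * t) ^ 2 ≤ C * (cutProfile t ^ 2 + 4) := by
  have hcont : Continuous fun t => deriv cutProfile t * t :=
    (contDiff_cutProfile.continuous_deriv (by simp)).mul continuous_id
  obtain ⟨K, hK⟩ := isCompact_Icc.exists_bound_of_continuousOn (s := Set.Icc (0 : ℝ) 2)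
    hcont.continuousOn
  refine ⟨K ^ 2 + 1, by positivity, fun t ht => ?_⟩
  rcases le_or_gt t 2 with h | h
  · have h1 := hK t ⟨ht, h⟩
    have h2 : (deriv cutProfile t * t) ^ 2 ≤ K ^ 2 := by
      rw [← sq_abs]; exact pow_le_pow_left₀ (abs_nonneg _) h1 2
    nlinarith [sq_nonneg (cutProfile t), sq_nonneg K, mul_nonneg (sq_nonneg K) (sq_nonneg (cutProfile t))]
  · have h1 : cutProfile =ᶠ[nhds t] id := by
      filter_upwards [lt_mem_nhds h] with s hs
      exact cutProfile_of_two_le hs.le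
    rw [h1.deriv_eq, deriv_id, one_mul, cutProfile_of_two_le h.le]
    nlinarith [sq_nonneg K, mul_nonneg (sq_nonneg K) (sq_nonneg t)]

/-- The function `∑ cosh (a x_i)`. -/
def coshSum (a : ℝ) (x : Sp d) : ℝ := ∑ i, Real.cosh (a * x i)

lemma contDiff_coshSum (a : ℝ) : ContDiff ℝ ∞ (coshSum a : Sp d → ℝ) :=
  ContDiff.sum fun i _ => Real.contDiff_cosh.comp
    (contDiff_const.mul (EuclideanSpace.proj (𝕜 := ℝ) i).contDiff)

lemma coshSum_pos (hd : 2 ≤ d) (a : ℝ) (x : Sp d) : 0 < coshSum a x :=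
  Finset.sum_pos (fun i _ => Real.cosh_pos _) ⟨⟨0, by omega⟩, Finset.mem_univ _⟩

/-- From `|sinh| ≤ cosh`: this is a smooth substitute for `exp (a max |x_i|)` with the same
logarithmic growth bound. -/
lemma norm_fderiv_coshSum_le {a : ℝ} (ha : 0 ≤ a) (x : Sp d) :
    ‖fderiv ℝ (coshSum a : Sp d → ℝ) x‖ ≤ a * coshSum a x := by
  have h1 : ∀ i : Fin d, HasFDerivAt (fun x : Sp d => Real.cosh (a * x i))
      ((Real.sinh (a * x i) * a) • (EuclideanSpace.proj (𝕜 := ℝ) i : Sp d →L[ℝ] ℝ)) x := by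
    intro i
    have e1 : HasFDerivAt (fun x : Sp d => a * x i)
        (a • (EuclideanSpace.proj (𝕜 := ℝ) i : Sp d →L[ℝ] ℝ)) x :=
      (EuclideanSpace.proj (𝕜 := ℝ) i : Sp d →L[ℝ] ℝ).hasFDerivAt.const_mul a
    have := (Real.hasDerivAt_cosh (a * x i)).comp_hasFDerivAt x e1
    rwa [smul_smul] at this
  have h2 : HasFDerivAt (coshSum a : Sp d → ℝ)
      (∑ i, (Real.sinh (a * x i) * a) • (EuclideanSpace.proj (𝕜 := ℝ) i : Sp d →L[ℝ] ℝ)) x := by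
    have := HasFDerivAt.fun_sum (u := Finset.univ) fun i _ => h1 i
    exact this
  rw [h2.fderiv]
  refine ContinuousLinearMap.opNorm_le_bound _
    (mul_nonneg ha (Finset.sum_nonneg fun i _ => (Real.cosh_pos _).le)) fun v => ?_
  rw [sum_apply, coshSum, Finset.mul_sum, Finset.sum_mul]
  refine (norm_sum_le _ _).trans (Finset.sum_le_sum fun i _ => ?_)
  rw [smul_apply, smul_eq_mul, norm_mul, norm_mul, mul_comm ‖Real.sinh _‖,
    Real.norm_of_nonneg ha]
  have e1 : ‖Real.sinh (a * x i)‖ ≤ Real.cosh (a * x i) := by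
    rw [Real.norm_eq_abs, Real.abs_sinh, ← Real.cosh_abs (a * x i)]
    exact (Real.sinh_lt_cosh _).le
  have e2 : ‖(EuclideanSpace.proj (𝕜 := ℝ) i : Sp d →L[ℝ] ℝ) v‖ ≤ ‖v‖ := PiLp.norm_apply_le v i
  have := Real.cosh_pos (a * x i)
  gcongr

/-- A weight that vanishes near the boundary of `Q_R` and is exponentially large inside. -/
lemma exists_weight (d : ℕ) (hd : 2 ≤ d) : ∃ C, 0 < C ∧ ∀ a R : ℝ, 0 < a → 0 < R →
    ∃ η ∈ testFunctions (box d R), (∀ x, ‖gradient η x‖ ^ 2 ≤ C * a ^ 2 * (η x ^ 2 + 4)) ∧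
      ∀ L, 0 < L → 4 * d ≤ Real.exp (a * (R - L)) → ∀ x ∈ box d L,
        Real.exp (a * (R - L)) / (2 * d) ≤ η x := by
  obtain ⟨C, hC, hCb⟩ := exists_deriv_cutProfile_le
  refine ⟨C, hC, fun a R ha hR => ?_⟩
  set S := Real.cosh (a * R) with hS
  have hSpos : 0 < S := Real.cosh_pos _
  have hs := coshSum_pos hd a
  have hsc := contDiff_coshSum (d := d) a
  -- Up to a dimensional factor the quotient is at least `exp (a (R - max |x_i|))`, and the profile
  -- removes the region where it is at most `1`.
  set η : Sp d → ℝ := fun x => cutProfile (S / coshSum a x) with hη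
  have hηc : ContDiff ℝ ∞ η :=
    contDiff_cutProfile.comp (contDiff_const.div hsc fun x => (hs x).ne')
  have hsub : tsupport η ⊆ {x | coshSum a x ≤ S} := by
    refine closure_minimal (fun x hx => ?_) (isClosed_le hsc.continuous continuous_const)
    by_contra h
    rw [Set.mem_ofPred_eq, not_le] at h
    exact hx (cutProfile_of_le_one ((div_le_one (hs x)).2 h.le))
  -- Since `d ≥ 2`, a second positive summand gives the strict inequality `cosh (a x_i) < cosh (a
  -- R)`. The closed support therefore lies inside the open box.
  have hbox : {x : Sp d | coshSum a x ≤ S} ⊆ box d R := by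
    intro x hx i
    obtain ⟨j, hj⟩ : ∃ j : Fin d, j ≠ i := by
      by_cases h : i = ⟨0, by omega⟩
      · exact ⟨⟨1, by omega⟩, by rw [h]; simp⟩
      · exact ⟨⟨0, by omega⟩, Ne.symm h⟩
    have h1 : Real.cosh (a * x j) + Real.cosh (a * x i) ≤ coshSum a x := by
      rw [← Finset.sum_pair (f := fun k => Real.cosh (a * x k)) hj]
      exact Finset.sum_le_sum_of_subset_of_nonneg (Finset.subset_univ _)
        fun k _ _ => (Real.cosh_pos _).le
    have h2 : Real.cosh (a * x i) < Real.cosh (a * R) := by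
      have := Real.cosh_pos (a * x j)
      have h3 : coshSum a x ≤ S := hx
      linarith
    rw [Real.cosh_lt_cosh, abs_mul, abs_mul, abs_of_pos ha, abs_of_pos hR] at h2
    exact lt_of_mul_lt_mul_left h2 ha.le
  refine ⟨η, ⟨hηc, ?_, hsub.trans hbox⟩, fun x => ?_, fun L hL hexp x hx => ?_⟩
  · exact (isCompact_closedBall _ _).of_isClosed_subset (isClosed_tsupport η)
      ((hsub.trans hbox).trans (box_subset_closedBall R))
  · set s := coshSum a x with hsx
    have hspos : 0 < s := hs x
    have hq : 0 ≤ S / s := by positivity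
    have e1 : HasDerivAt (fun y : ℝ => S / y) (-S / s ^ 2) s := by
      have := (hasDerivAt_inv hspos.ne').const_mul S
      refine (this.congr_deriv (by ring)).congr_of_eventuallyEq
        (Filter.Eventually.of_forall fun y => div_eq_mul_inv _ _)
    have e2 := ((contDiff_cutProfile.differentiable (by simp) (S / s)).hasDerivAt.comp s e1)
    have e3 := e2.comp_hasFDerivAt x (hsc.differentiable (by simp) x).hasFDerivAt
    have e4 : fderiv ℝ η x = (deriv cutProfile (S / s) * (-S / s ^ 2)) •
        fderiv ℝ (coshSum a : Sp d → ℝ) x := e3.fderiv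
    have e5 : ‖fderiv ℝ η x‖ ≤ |deriv cutProfile (S / s) * (S / s)| * a := by
      rw [e4, norm_smul, Real.norm_eq_abs]
      calc |deriv cutProfile (S / s) * (-S / s ^ 2)| * ‖fderiv ℝ (coshSum a : Sp d → ℝ) x‖
          ≤ |deriv cutProfile (S / s) * (-S / s ^ 2)| * (a * s) := by
            gcongr; exact norm_fderiv_coshSum_le ha.le x
        _ = |deriv cutProfile (S / s) * (S / s)| * a := by
            have : deriv cutProfile (S / s) * (-S / s ^ 2) =
              -(deriv cutProfile (S / s) * (S / s)) * s⁻¹ := by field_simp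
            rw [this, abs_mul, abs_neg, abs_of_pos (inv_pos.2 hspos)]
            field_simp
    rw [norm_gradient]
    calc ‖fderiv ℝ η x‖ ^ 2 ≤ (|deriv cutProfile (S / s) * (S / s)| * a) ^ 2 := by gcongr
      _ = (deriv cutProfile (S / s) * (S / s)) ^ 2 * a ^ 2 := by rw [mul_pow, sq_abs]
      _ ≤ C * (cutProfile (S / s) ^ 2 + 4) * a ^ 2 := by
          gcongr; exact hCb _ hq
      _ = C * a ^ 2 * (η x ^ 2 + 4) := by simp only [hη, ← hsx]; ring
  · have hdpos : (0 : ℝ) < d := by exact_mod_cast (by omega : 0 < d)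
    have h1 : coshSum a x ≤ d * Real.exp (a * L) := by
      calc coshSum a x ≤ ∑ _i : Fin d, Real.exp (a * L) := by
            refine Finset.sum_le_sum fun i _ => ?_
            have h2 : |a * x i| ≤ |a * L| := by
              rw [abs_mul, abs_mul, abs_of_pos hL]
              exact mul_le_mul_of_nonneg_left (hx i).le (abs_nonneg _)
            refine (Real.cosh_le_cosh.2 h2).trans ?_
            rw [Real.cosh_eq]
            have : Real.exp (-(a * L)) ≤ Real.exp (a * L) :=
              Real.exp_le_exp.2 (by nlinarith [mul_pos ha hL])
            linarith
        _ = d * Real.exp (a * L) := by simp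
    have h2 : Real.exp (a * R) / 2 ≤ S := by
      rw [hS, Real.cosh_eq]
      have := Real.exp_pos (-(a * R))
      linarith
    have h3 : Real.exp (a * (R - L)) / (2 * d) ≤ S / coshSum a x := by
      rw [mul_sub, Real.exp_sub, div_div, div_le_div_iff₀ (by positivity) (hs x)]
      have hE := Real.exp_pos (a * R)
      calc Real.exp (a * R) * coshSum a x ≤ Real.exp (a * R) * (d * Real.exp (a * L)) := by gcongr
        _ = Real.exp (a * R) / 2 * (Real.exp (a * L) * (2 * d)) := by ring
        _ ≤ S * (Real.exp (a * L) * (2 * d)) := by gcongr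
    -- The condition `4 d ≤ exp (a (R - L))` brings the quotient into the range where the profile is
    -- the identity.
    have h4 : (2 : ℝ) ≤ Real.exp (a * (R - L)) / (2 * d) := by
      rw [le_div_iff₀ (by positivity)]; linarith
    simp only [hη]
    rw [cutProfile_of_two_le (h4.trans h3)]
    exact h3

/-! ### Energy estimates and decay -/

lemma volume_real_box {R : ℝ} (hR : 0 ≤ R) : (volume : Measure (Sp d)).real (box d R) = (2 * R) ^ d := by
  rw [measureReal_def, volume_box hR, ENNReal.toReal_ofReal (by positivity)]

/-- The solution is tested with itself and the source is absorbed by Young's inequality. -/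
lemma IsRegular.IsSolution.energy_le {α β : ℝ} {A : Field d} {hA : IsRegular α β A}
    {s : Set (Sp d)} {hs : volume s < ⊤} {S : Submodule ℝ (Sp d → ℝ)} {ξ : Sp d} {τ : ℝ}
    {u : sobolev (volume.restrict s) S} (hu : hA.IsSolution hs S ξ τ u) :
    τ * ‖u.1.fst‖ ^ 2 + α / 2 * ‖u.1.snd‖ ^ 2 ≤
      β ^ 2 / (2 * α) * ‖ξ‖ ^ 2 * (volume : Measure (Sp d)).real s := by
  have h1 : τ * massForm _ u.1 u.1 + hA.energyForm s u.1 u.1 = hA.source hs ξ u.1 := hu u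
  have h2 : massForm _ u.1 u.1 = ‖u.1.fst‖ ^ 2 := by
    rw [massForm_apply]; exact real_inner_self_eq_norm_sq _
  have h3 := hA.energyForm_self s u.1
  have hα := hA.pos
  have hfin : IsFiniteMeasure ((volume : Measure (Sp d)).restrict s) := ⟨by simpa using hs⟩
  have i1 : Integrable (fun x => α / 2 * ‖u.1.snd x‖ ^ 2) (volume.restrict s) :=
    (integrable_norm_sq (Lp.memLp u.1.snd)).const_mul _
  have h4 : hA.source hs ξ u.1 ≤ α / 2 * ‖u.1.snd‖ ^ 2 +
      β ^ 2 / (2 * α) * ‖ξ‖ ^ 2 * (volume : Measure (Sp d)).real s := by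
    rw [hA.source_apply, ← integral_neg, norm_sq_eq_integral, ← integral_const_mul]
    have h5 : β ^ 2 / (2 * α) * ‖ξ‖ ^ 2 * (volume : Measure (Sp d)).real s =
        ∫ _ in s, β ^ 2 / (2 * α) * ‖ξ‖ ^ 2 := by
      rw [setIntegral_const, smul_eq_mul]; ring
    rw [h5, ← integral_add i1 (integrable_const _)]
    refine integral_mono (integrable_inner_of_memLp (Lp.memLp _)
      (hA.memLp_act (memLp_two_const hs ξ))).neg (i1.add (integrable_const _)) fun x => ?_
    simp only
    have h6 := hA.abs_inner_act_le x (u.1.snd x) ξ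
    have h7 : 0 ≤ α / 2 * (‖u.1.snd x‖ - β / α * ‖ξ‖) ^ 2 := by positivity
    have h8 : α / 2 * (‖u.1.snd x‖ - β / α * ‖ξ‖) ^ 2 = α / 2 * ‖u.1.snd x‖ ^ 2 +
        β ^ 2 / (2 * α) * ‖ξ‖ ^ 2 - β * (‖u.1.snd x‖ * ‖ξ‖) := by field_simp; ring
    rw [h8] at h7
    have h9 := neg_abs_le (inner ℝ (u.1.snd x) (act (A x) ξ))
    linarith
  rw [h2] at h1
  linarith

lemma integral_box_le {f : Sp d → ℝ} (hf : LatPeriodic f) (h0 : ∀ x, 0 ≤ f x)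
    (hi : IntegrableOn f (cell d)) {R : ℝ} (hR : 0 ≤ R) :
    ∫ x in box d R, f x ≤ (R + 2) ^ d * ∫ x in cell d, f x := by
  have hm := hf.aestronglyMeasurable hi.aestronglyMeasurable
  have h1 := lintegral_box_le (fun x => ENNReal.ofReal (f x)) (fun x n => by simp only [hf x n])
    hm.aemeasurable.ennreal_ofReal hR
  have h2 : ∫⁻ x in cell d, ENNReal.ofReal (f x) ≠ ⊤ := hi.lintegral_lt_top.ne
  rw [integral_eq_lintegral_of_nonneg_ae (Filter.Eventually.of_forall h0) hm.restrict,
    integral_eq_lintegral_of_nonneg_ae (Filter.Eventually.of_forall h0) hm.restrict]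
  refine (ENNReal.toReal_mono (ENNReal.mul_ne_top ENNReal.ofReal_ne_top h2) h1).trans_eq ?_
  rw [ENNReal.toReal_mul, ENNReal.toReal_ofReal (by positivity)]

lemma integrableOn_norm_sq_perExt (u : PairSpace (volume.restrict (box d 1))) :
    IntegrableOn (fun x => ‖(perExt u).1 x‖ ^ 2) (cell d) ∧
      IntegrableOn (fun x => ‖(perExt u).2 x‖ ^ 2) (cell d) := by
  constructor <;> rw [IntegrableOn, ← restrict_box_one]
  · exact integrable_norm_sq (memLp_perExt u 1).1
  · exact integrable_norm_sq (memLp_perExt u 1).2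

lemma integral_perExt_le (u : PairSpace (volume.restrict (box d 1))) {R : ℝ} (hR : 0 ≤ R) :
    ∫ x in box d R, ‖(perExt u).1 x‖ ^ 2 ≤ (R + 2) ^ d * ‖u.fst‖ ^ 2 ∧
      ∫ x in box d R, ‖(perExt u).2 x‖ ^ 2 ≤ (R + 2) ^ d * ‖u.snd‖ ^ 2 := by
  constructor
  · refine (integral_box_le (fun x n => by simp only [latPeriodic_perExt_fst u x n])
      (fun x => by positivity) (integrableOn_norm_sq_perExt u).1 hR).trans_eq ?_
    rw [norm_sq_eq_integral, ← restrict_box_one]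
    congr 1
    exact integral_congr_ae ((perExt_ae_eq u).1.mono fun x hx => by simp only [hx])
  · refine (integral_box_le (fun x n => by simp only [latPeriodic_perExt_snd u x n])
      (fun x => by positivity) (integrableOn_norm_sq_perExt u).2 hR).trans_eq ?_
    rw [norm_sq_eq_integral, ← restrict_box_one]
    congr 1
    exact integral_congr_ae ((perExt_ae_eq u).2.mono fun x hx => by simp only [hx])

lemma IsRegCorrector.energy_le {α β : ℝ} {A : Field d} (hA : IsRegular α β A) {ξ : Sp d}
    {T R : ℝ} (hR : 0 ≤ R) {w : FunGrad d} (hw : IsRegCorrector A ξ T R w) :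
    T⁻¹ * (∫ x in box d R, ‖w.1 x‖ ^ 2) + α / 2 * (∫ x in box d R, ‖w.2 x‖ ^ 2) ≤
      β ^ 2 / (2 * α) * ‖ξ‖ ^ 2 * (2 * R) ^ d := by
  obtain ⟨u, hu, h1, h2⟩ := (hA.weak_iff_exists_isSolution (volume_box_lt_top R)
    (S := testSubmodule (box d R)) contDiff_of_mem_testSubmodule ξ T⁻¹ w).1 hw
  have := hu.energy_le
  rw [volume_real_box hR, norm_sq_eq_integral, norm_sq_eq_integral,
    integral_congr_ae (h1.mono fun x hx => by simp only [hx] :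
      (fun x => ‖u.1.fst x‖ ^ 2) =ᵐ[volume.restrict (box d R)] fun x => ‖w.1 x‖ ^ 2),
    integral_congr_ae (h2.mono fun x hx => by simp only [hx] :
      (fun x => ‖u.1.snd x‖ ^ 2) =ᵐ[volume.restrict (box d R)] fun x => ‖w.2 x‖ ^ 2)] at this
  exact this

lemma integral_norm_sq_sub_le {E : Type*} [NormedAddCommGroup E] {ν : Measure (Sp d)}
    {F G : Sp d → E} (hF : MemLp F 2 ν) (hG : MemLp G 2 ν) :
    ∫ x, ‖F x - G x‖ ^ 2 ∂ν ≤ 2 * ((∫ x, ‖F x‖ ^ 2 ∂ν) + ∫ x, ‖G x‖ ^ 2 ∂ν) := by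
  rw [← integral_add (integrable_norm_sq hF) (integrable_norm_sq hG), ← integral_const_mul]
  refine integral_mono (integrable_norm_sq (hF.sub hG))
    (((integrable_norm_sq hF).add (integrable_norm_sq hG)).const_mul 2) fun x => ?_
  simp only
  have := norm_sub_le (F x) (G x)
  nlinarith [norm_nonneg (F x), norm_nonneg (G x), norm_nonneg (F x - G x),
    sq_nonneg (‖F x‖ - ‖G x‖)]

lemma IsRegCorrector.integral_le {α β : ℝ} {A : Field d} (hA : IsRegular α β A) {ξ : Sp d}
    (hξ : ‖ξ‖ = 1) {T R : ℝ} (hT : 0 < T) (hR : 0 ≤ R) {w : FunGrad d}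
    (hw : IsRegCorrector A ξ T R w) :
    T⁻¹ * (∫ x in box d R, ‖w.1 x‖ ^ 2) ≤ β ^ 2 / (2 * α) * (2 * R + 4) ^ d ∧
      α / 2 * (∫ x in box d R, ‖w.2 x‖ ^ 2) ≤ β ^ 2 / (2 * α) * (2 * R + 4) ^ d := by
  have h := hw.energy_le hA hR
  rw [hξ, one_pow, mul_one] at h
  have hα := hA.pos
  have hpow : β ^ 2 / (2 * α) * (2 * R) ^ d ≤ β ^ 2 / (2 * α) * (2 * R + 4) ^ d := by
    gcongr; linarith
  have n1 : 0 ≤ ∫ x in box d R, ‖w.1 x‖ ^ 2 := integral_nonneg fun x => by positivity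
  have n2 : 0 ≤ ∫ x in box d R, ‖w.2 x‖ ^ 2 := integral_nonneg fun x => by positivity
  have m1 := mul_nonneg (inv_pos.2 hT).le n1
  have m2 := mul_nonneg (half_pos hα).le n2
  constructor <;> linarith

/-- The energy on one cell of volume `2^d` is multiplied by the cell count `(R + 2)^d`; hence `(2R +
4)^d`. The Dirichlet solution obeys the same bound. -/
lemma IsRegular.IsPerSolution.integral_le {α β : ℝ} {A : Field d} {hA : IsRegular α β A}
    {ξ : Sp d} (hξ : ‖ξ‖ = 1) {T R : ℝ} (hT : 0 < T) (hR : 0 ≤ R) {u : PerSpace d}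
    (hu : hA.IsPerSolution ξ T⁻¹ u) :
    T⁻¹ * (∫ x in box d R, ‖(perExt u.1).1 x‖ ^ 2) ≤ β ^ 2 / (2 * α) * (2 * R + 4) ^ d ∧
      α / 2 * (∫ x in box d R, ‖(perExt u.1).2 x‖ ^ 2) ≤ β ^ 2 / (2 * α) * (2 * R + 4) ^ d := by
  have h := hu.energy_le
  rw [hξ, one_pow, mul_one, volume_real_box zero_le_one] at h
  have hα := hA.pos
  have m1 : 0 ≤ T⁻¹ * ‖u.1.fst‖ ^ 2 := by positivity
  have m2 : 0 ≤ α / 2 * ‖u.1.snd‖ ^ 2 := by positivity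
  obtain ⟨p1, p2⟩ := integral_perExt_le u.1 hR
  have hpow : (R + 2) ^ d * (β ^ 2 / (2 * α) * (2 * 1) ^ d) =
      β ^ 2 / (2 * α) * (2 * R + 4) ^ d := by
    rw [mul_left_comm, ← mul_pow]; congr 2; ring
  have hR2 : 0 ≤ (R + 2) ^ d := by positivity
  rw [← hpow]
  constructor
  · refine (mul_le_mul_of_nonneg_left p1 (inv_pos.2 hT).le).trans ?_
    rw [mul_left_comm]
    exact mul_le_mul_of_nonneg_left (by linarith) hR2
  · refine (mul_le_mul_of_nonneg_left p2 (half_pos hα).le).trans ?_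
    rw [mul_left_comm]
    exact mul_le_mul_of_nonneg_left (by linarith) hR2

lemma IsRegCorrector.integral_sub_perExt_le {α β : ℝ} {A : Field d} (hA : IsRegular α β A)
    {ξ : Sp d} (hξ : ‖ξ‖ = 1) {T R : ℝ} (hT : 0 < T) (hR : 0 ≤ R) {w : FunGrad d}
    (hw : IsRegCorrector A ξ T R w) {u : PerSpace d} (hu : hA.IsPerSolution ξ T⁻¹ u) :
    T⁻¹ * (∫ x in box d R, (w - perExt u.1).1 x ^ 2) ≤
        4 * (β ^ 2 / (2 * α) * (2 * R + 4) ^ d) ∧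
      α / 2 * (∫ x in box d R, ‖(w - perExt u.1).2 x‖ ^ 2) ≤
        4 * (β ^ 2 / (2 * α) * (2 * R + 4) ^ d) := by
  obtain ⟨a1, a2⟩ := hw.integral_le hA hξ hT hR
  obtain ⟨b1, b2⟩ := hu.integral_le hξ hT hR
  obtain ⟨p1, p2⟩ := memLp_perExt u.1 R
  have hα := hA.pos
  constructor
  · have hz1 : ∫ x in box d R, (w - perExt u.1).1 x ^ 2 ≤
        2 * ((∫ x in box d R, ‖w.1 x‖ ^ 2) + ∫ x in box d R, ‖(perExt u.1).1 x‖ ^ 2) := by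
      refine le_trans (le_of_eq ?_) (integral_norm_sq_sub_le hw.1.1 p1)
      refine integral_congr_ae (Filter.Eventually.of_forall fun x => ?_)
      simp only
      rw [Real.norm_eq_abs, sq_abs]; rfl
    have := mul_le_mul_of_nonneg_left hz1 (inv_pos.2 hT).le
    linarith
  · have hz2 : ∫ x in box d R, ‖(w - perExt u.1).2 x‖ ^ 2 ≤
        2 * ((∫ x in box d R, ‖w.2 x‖ ^ 2) + ∫ x in box d R, ‖(perExt u.1).2 x‖ ^ 2) :=
      integral_norm_sq_sub_le hw.1.2.1 p2
    have := mul_le_mul_of_nonneg_left hz2 (half_pos hα).le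
    linarith

/-- The source `A ξ` is common to both equations and cancels. The difference need not vanish on the
boundary, only the test functions do. -/
lemma IsRegCorrector.sub_perExt_weak {α β : ℝ} {A : Field d} (hA : IsRegular α β A)
    {ξ : Sp d} {T R : ℝ} {w : FunGrad d} (hw : IsRegCorrector A ξ T R w) {u : PerSpace d}
    (hu : hA.IsPerSolution ξ T⁻¹ u) {v : FunGrad d} (hv : MemH10 R v) :
    ∫ x in box d R, (T⁻¹ * (v.1 x * (w - perExt u.1).1 x) +
      inner ℝ (v.2 x) (act (A x) ((w - perExt u.1).2 x))) = 0 := by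
  obtain ⟨p1, p2⟩ := memLp_perExt u.1 R
  have h1 := hw.2 v hv
  have h2 := hu.integral_memH10_eq_zero hv
  have hξm := memLp_two_const (volume_box_lt_top (d := d) R) ξ
  have i1 : IntegrableOn (fun x => T⁻¹ * (v.1 x * w.1 x) +
      inner ℝ (v.2 x) (act (A x) (ξ + w.2 x))) (box d R) :=
    ((hv.1.integrable_mul hw.1.1).const_mul _).add
      (integrable_inner_of_memLp hv.2.1 (hA.memLp_act (hξm.add hw.1.2.1)))
  have i2 : IntegrableOn (fun x => T⁻¹ * (v.1 x * (perExt u.1).1 x) +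
      inner ℝ (v.2 x) (act (A x) (ξ + (perExt u.1).2 x))) (box d R) :=
    ((hv.1.integrable_mul p1).const_mul _).add
      (integrable_inner_of_memLp hv.2.1 (hA.memLp_act (hξm.add p2)))
  have h3 := integral_sub i1 i2
  rw [h1, h2, sub_zero] at h3
  rw [← h3]
  refine integral_congr_ae (Filter.Eventually.of_forall fun x => ?_)
  simp only
  have e1 : (w - perExt u.1).1 x = w.1 x - (perExt u.1).1 x := rfl
  have e2 : (w - perExt u.1).2 x = w.2 x - (perExt u.1).2 x := rfl
  rw [e1, e2, act_sub, act_add, act_add, inner_sub_right, inner_add_right, inner_add_right]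
  ring

lemma integrableOn_weight_mul {R : ℝ} {G : Sp d → Sp d} (hG : MemLp G 2 (volume.restrict (box d R)))
    {η : Sp d → ℝ} (hη : η ∈ testFunctions (box d R)) :
    IntegrableOn (fun x => η x ^ 2 * ‖G x‖ ^ 2) (box d R) := by
  obtain ⟨M, hM, hb⟩ := exists_bound_of_mem_testFunctions hη
  have h2 : MemLp (fun x => η x • G x) 2 (volume.restrict (box d R)) :=
    hG.of_le_mul (c := M) (hη.1.continuous.aestronglyMeasurable.smul hG.1)
      (Filter.Eventually.of_forall fun x => by
        rw [norm_smul]; exact mul_le_mul_of_nonneg_right (hb x).1 (norm_nonneg _))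
  refine (integrable_norm_sq h2).congr (Filter.Eventually.of_forall fun x => ?_)
  simp only
  rw [norm_smul, mul_pow, Real.norm_eq_abs, sq_abs]

lemma mul_integral_le_integral_weight {L R ε : ℝ} (hLR : L ≤ R) (hε : 0 ≤ ε) {G : Sp d → Sp d}
    (hG : MemLp G 2 (volume.restrict (box d R))) {η : Sp d → ℝ}
    (hη : η ∈ testFunctions (box d R)) (hL : ∀ x ∈ box d L, ε ≤ η x) :
    ε ^ 2 * ∫ x in box d L, ‖G x‖ ^ 2 ≤ ∫ x in box d R, η x ^ 2 * ‖G x‖ ^ 2 := by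
  have hsub : box d L ⊆ box d R := fun x hx i => (hx i).trans_le hLR
  have iη := integrableOn_weight_mul hG hη
  rw [← integral_const_mul]
  refine (setIntegral_mono_on (((integrable_norm_sq hG).mono_measure
    (Measure.restrict_mono hsub le_rfl)).const_mul _) (iη.mono_set hsub)
    (measurableSet_box L) fun x hx => ?_).trans (setIntegral_mono_set iη
      (Filter.Eventually.of_forall fun x => by positivity) hsub.eventuallyLE)
  exact mul_le_mul_of_nonneg_right (pow_le_pow_left₀ hε (hL x hx) 2) (by positivity)

/-- Exponential decay, away from the boundary of `Q_R`, of the difference between the Dirichlet and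
the periodic regularized correctors. -/
lemma exists_decay (hd : 2 ≤ d) {α β : ℝ} (hα : 0 < α) (hαβ : α ≤ β) :
    ∃ c, 0 < c ∧ ∃ C, 0 < C ∧ ∀ {A : Field d} (hA : IsRegular α β A) {ξ : Sp d}, ‖ξ‖ = 1 →
      ∀ {T R L : ℝ}, 0 < T → 0 < R → 0 < L → L ≤ R → ∀ {u : PerSpace d},
        hA.IsPerSolution ξ T⁻¹ u → ∀ {w : FunGrad d}, IsRegCorrector A ξ T R w →
          ∫ x in box d L, ‖w.2 x - (perExt u.1).2 x‖ ^ 2 ≤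
            C * (2 * R + 4) ^ d * Real.exp (-(2 * (c * ((R - L) / Real.sqrt T)))) := by
  obtain ⟨W, hW, hweight⟩ := exists_weight d hd
  have hβ : 0 < β := hα.trans_le hαβ
  have hdpos : (0 : ℝ) < d := by exact_mod_cast (by omega : 0 < d)
  -- With `a = c / √T` this value makes `2 β² / α * W * a² = T⁻¹`, as the Caccioppoli inequality
  -- requires of the weight.
  obtain ⟨c, hcpos, hc2⟩ : ∃ c : ℝ, 0 < c ∧ c ^ 2 = α / (2 * β ^ 2 * W) :=
    ⟨Real.sqrt (α / (2 * β ^ 2 * W)), Real.sqrt_pos.2 (by positivity), Real.sq_sqrt (by positivity)⟩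
  refine ⟨c, hcpos, 128 * d ^ 2 * (β ^ 2 / (2 * α) / α), by positivity, ?_⟩
  intro A hA ξ hξ T R L hT hR hL hLR u hu w hw
  have hsT : 0 < Real.sqrt T := Real.sqrt_pos.2 hT
  obtain ⟨a, hapos, ha2, haE⟩ : ∃ a : ℝ, 0 < a ∧ a ^ 2 = c ^ 2 / T ∧
      c * ((R - L) / Real.sqrt T) = a * (R - L) :=
    ⟨c / Real.sqrt T, by positivity, by rw [div_pow, Real.sq_sqrt hT.le], by ring⟩
  have hexp : Real.exp (-(2 * (a * (R - L)))) = (Real.exp (a * (R - L)) ^ 2)⁻¹ := by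
    rw [← Real.exp_nat_mul, ← Real.exp_neg]; congr 1
  rw [haE, hexp]
  have hepos : 0 < Real.exp (a * (R - L)) := Real.exp_pos _
  obtain ⟨z1, z2⟩ := hw.integral_sub_perExt_le hA hξ hT hR.le hu
  have mz2 : MemLp (w - perExt u.1).2 2 (volume.restrict (box d R)) :=
    hw.1.2.1.sub (memLp_perExt u.1 R).2
  change ∫ x in box d L, ‖(w - perExt u.1).2 x‖ ^ 2 ≤ _
  have hsub : box d L ⊆ box d R := fun x hx i => (hx i).trans_le hLR
  have hLRz : ∫ x in box d L, ‖(w - perExt u.1).2 x‖ ^ 2 ≤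
      ∫ x in box d R, ‖(w - perExt u.1).2 x‖ ^ 2 :=
    setIntegral_mono_set (integrable_norm_sq mz2) (Filter.Eventually.of_forall fun x => by positivity)
      hsub.eventuallyLE
  have main : α / 2 * (∫ x in box d L, ‖(w - perExt u.1).2 x‖ ^ 2) *
      Real.exp (a * (R - L)) ^ 2 ≤ 64 * d ^ 2 * (β ^ 2 / (2 * α) * (2 * R + 4) ^ d) := by
    -- Below the threshold `4 d` the exponential is bounded, and the global energy estimate on `Q_R`
    -- suffices. Both cases give the factor `64 d²`.
    rcases le_or_gt (4 * (d : ℝ)) (Real.exp (a * (R - L))) with hcase | hcase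
    · obtain ⟨η, hη, hηg, hηL⟩ := hweight a R hapos hR
      have hsmooth : MemH1Closure (box d R) (smoothSubmodule d : Set (Sp d → ℝ)) (w - perExt u.1) :=
        MemH1Closure.sub (fun ψ hψ => hψ) (hw.1.mono fun ψ hψ => hψ.1) (memH1Closure_perExt u hR.le)
      have hcac := hA.caccioppoli hsmooth (fun v hv => hw.sub_perExt_weak hA hu hv) hη fun x => by
        calc 2 * β ^ 2 / α * ‖gradient η x‖ ^ 2
            ≤ 2 * β ^ 2 / α * (W * a ^ 2 * (η x ^ 2 + 4)) :=
              mul_le_mul_of_nonneg_left (hηg x) (by positivity)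
          _ = T⁻¹ * (η x ^ 2 + 4) := by rw [ha2, hc2]; field_simp
      have hin := mul_integral_le_integral_weight hLR (by positivity) mz2 hη (hηL L hL hcase)
      have h5 := mul_le_mul_of_nonneg_left hin (half_pos hα).le
      rw [mul_assoc (4 : ℝ)] at hcac
      generalize (∫ x in box d R, η x ^ 2 * ‖(w - perExt u.1).2 x‖ ^ 2) = I1 at *
      generalize (∫ x in box d L, ‖(w - perExt u.1).2 x‖ ^ 2) = I2 at *
      generalize T⁻¹ * (∫ x in box d R, (w - perExt u.1).1 x ^ 2) = I3 at *
      generalize β ^ 2 / (2 * α) * (2 * R + 4) ^ d = P at *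
      generalize Real.exp (a * (R - L)) = e at *
      have h6 : α / 2 * I2 * e ^ 2 = 4 * d ^ 2 * (α / 2 * ((e / (2 * d)) ^ 2 * I2)) := by
        field_simp; ring
      rw [h6]
      have h7 : α / 2 * ((e / (2 * d)) ^ 2 * I2) ≤ 16 * P := by linarith
      refine (mul_le_mul_of_nonneg_left h7 (by positivity)).trans_eq ?_
      ring
    · have he2 := pow_le_pow_left₀ hepos.le hcase.le 2
      have h4 := (mul_le_mul_of_nonneg_left hLRz (half_pos hα).le).trans z2
      refine (mul_le_mul h4 he2 (by positivity) (by positivity)).trans_eq ?_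
      ring
  rw [← div_eq_mul_inv, le_div_iff₀ (by positivity)]
  generalize (∫ x in box d L, ‖(w - perExt u.1).2 x‖ ^ 2) = I2 at *
  generalize Real.exp (a * (R - L)) = e at *
  have h8 : I2 * e ^ 2 = 2 / α * (α / 2 * I2 * e ^ 2) := by field_simp
  rw [h8]
  refine (mul_le_mul_of_nonneg_left main (by positivity)).trans_eq ?_
  field_simp; ring

/-! ### The mean of a gradient -/

/-- The cell integral of `ψ (x + v) - ψ x` vanishes by translation invariance. Written as an
integral of the derivative along the segment, it equals, again by translation invariance, the
integral of the derivative. -/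
lemma integral_fderiv_cell_eq_zero {ψ : Sp d → ℝ} (hψ : ContDiff ℝ ∞ ψ) (hp : LatPeriodic ψ)
    (v : Sp d) : ∫ x in cell d, fderiv ℝ ψ x v = 0 := by
  have hfd : Continuous (fderiv ℝ ψ) := hψ.continuous_fderiv (by simp)
  have hfv : Continuous fun x => fderiv ℝ ψ x v := hfd.clm_apply continuous_const
  have hper : LatPeriodic fun x => fderiv ℝ ψ x v := by
    intro x n
    have h1 : (fun y => ψ (y + lat n)) = ψ := funext fun y => hp y n
    have h2 : fderiv ℝ ψ (x + lat n) = fderiv ℝ ψ x := by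
      conv_rhs => rw [← h1]
      rw [fderiv_comp_add_right]
    simp only [h2]
  have hFT : ∀ x, ∫ t in (0 : ℝ)..1, fderiv ℝ ψ (x + t • v) v = ψ (x + v) - ψ x := by
    intro x
    have hd : ∀ t : ℝ, HasDerivAt (fun t : ℝ => ψ (x + t • v)) (fderiv ℝ ψ (x + t • v) v) t := by
      intro t
      have h1 : HasDerivAt (fun t : ℝ => x + t • v) v t := by
        simpa using ((hasDerivAt_id t).smul_const v).const_add x
      exact (hψ.differentiable (by simp) _).hasFDerivAt.comp_hasDerivAt t h1
    have hcont : Continuous fun t : ℝ => fderiv ℝ ψ (x + t • v) v := hfv.comp (by fun_prop)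
    have := intervalIntegral.integral_eq_sub_of_hasDerivAt (a := 0) (b := 1) (fun t _ => hd t)
      (hcont.intervalIntegrable _ _)
    simpa using this
  have h1 : ∫ x in cell d, (ψ (x + v) - ψ x) = 0 := by
    have hc' : Continuous fun x => ψ (x + v) := hψ.continuous.comp (continuous_add_const v)
    rw [integral_sub (integrableOn_cell_of_continuous hc')
      (integrableOn_cell_of_continuous hψ.continuous), integral_cell_translate hp hψ.continuous,
      sub_self]
  have hF : Continuous fun q : Sp d × ℝ => fderiv ℝ ψ (q.1 + q.2 • v) v := hfv.comp (by fun_prop)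
  have hcell : cell d ⊆ Metric.closedBall 0 (Real.sqrt (d * 2 ^ 2)) := fun x hx =>
    box_subset_closedBall 2 fun i => (abs_le_one_of_mem_cell hx i).trans_lt (by norm_num)
  have hint : Integrable (fun q : Sp d × ℝ => fderiv ℝ ψ (q.1 + q.2 • v) v)
      ((volume.restrict (cell d)).prod (volume.restrict (Set.Ioc (0 : ℝ) 1))) := by
    rw [Measure.prod_restrict]
    have hK : IsCompact ((Metric.closedBall (0 : Sp d) (Real.sqrt (d * 2 ^ 2))) ×ˢ
        Set.Icc (0 : ℝ) 1) := (isCompact_closedBall _ _).prod isCompact_Icc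
    exact (hF.continuousOn.integrableOn_compact hK).mono_set
      (Set.prod_mono hcell Set.Ioc_subset_Icc_self)
  have h2 : ∫ x in cell d, (ψ (x + v) - ψ x) =
      ∫ t in Set.Ioc (0 : ℝ) 1, ∫ x in cell d, fderiv ℝ ψ (x + t • v) v := by
    rw [← integral_integral_swap hint]
    refine integral_congr_ae (Filter.Eventually.of_forall fun x => ?_)
    simp only
    rw [← hFT x, intervalIntegral.integral_of_le zero_le_one]
  have h3 : ∀ t : ℝ, ∫ x in cell d, fderiv ℝ ψ (x + t • v) v = ∫ x in cell d, fderiv ℝ ψ x v :=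
    fun t => integral_cell_translate hper hfv (t • v)
  simp_rw [h3] at h2
  rw [h1, setIntegral_const] at h2
  simpa using h2.symm

/-- The gradient of an element of `H¹_per(Q)` has zero mean. -/
lemma integral_snd_eq_zero (u : PerSpace d) : ∫ x in box d 1, u.1.snd x = 0 := by
  set ν := (volume : Measure (Sp d)).restrict (box d 1) with hν
  have hfin : IsFiniteMeasure ν := ⟨by simpa [hν] using volume_box_lt_top (d := d) 1⟩
  have hint : Integrable u.1.snd ν := (Lp.memLp u.1.snd).integrable (by norm_num)
  refine ext_inner_left ℝ fun v => ?_
  rw [inner_zero_right, ← integral_inner hint]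
  have h1 : MemLp (fun _ : Sp d => v) 2 ν := memLp_const v
  have hin : ∀ h : PairSpace ν, inner ℝ (h1.toLp _) h.snd = ∫ x, inner ℝ v (h.snd x) ∂ν := by
    intro h
    rw [L2.inner_def]
    refine integral_congr_ae ?_
    filter_upwards [h1.coeFn_toLp] with x hx
    rw [hx]
  have hcl : IsClosed {h : PairSpace ν | inner ℝ (h1.toLp _) h.snd = 0} :=
    isClosed_eq ((continuous_const.inner (WithLp.sndL 2 ℝ _ _).continuous)) continuous_const
  have hmem := closure_minimal (s := (gradPairs ν (periodicSubmodule d) : Set (PairSpace ν)))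
    (fun g hg => ?_) hcl u.2
  · rw [← hin]; exact hmem
  · obtain ⟨ψ, ⟨hc, hp, -⟩, -, -, g2⟩ := hg
    change inner ℝ (h1.toLp _) g.snd = 0
    rw [hin]
    have hcongr : ∫ x, inner ℝ v (g.snd x) ∂ν = ∫ x in box d 1, fderiv ℝ ψ x v := by
      refine integral_congr_ae (g2.mono fun x hx => ?_)
      simp only
      rw [hx, real_inner_comm, inner_gradient_left]
    rw [hcongr, restrict_box_one, integral_fderiv_cell_eq_zero hc hp.latPeriodic v]

/-! ### Approximation of the extrapolated correctors by periodic functions -/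

lemma perExt_sum_ae (s : Finset ℕ) (a : ℕ → ℝ) (u : ℕ → PerSpace d) :
    (perExt (∑ j ∈ s, a j • u j : PerSpace d).1).2 =ᵐ[volume]
      fun x => ∑ j ∈ s, a j • (perExt (u j).1).2 x := by
  set ν := (volume : Measure (Sp d)).restrict (box d 1)
  have h1 : (∑ j ∈ s, a j • u j : PerSpace d).1.snd = ∑ j ∈ s, a j • (u j).1.snd := by
    have := map_sum ((WithLp.sndL 2 ℝ (Lp ℝ 2 ν) (Lp (Sp d) 2 ν)).comp
      (Submodule.subtypeL (sobolev ν (periodicSubmodule d)))) (fun j => a j • u j) s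
    simp only [map_smul] at this
    exact this
  have h2 : ∀ᵐ x ∂ν, (∑ j ∈ s, a j • u j : PerSpace d).1.snd x =
      ∑ j ∈ s, a j • (u j).1.snd x := by
    rw [h1]
    have h3 : ∀ᵐ x ∂ν, ∀ j ∈ s, (a j • (u j).1.snd : Lp (Sp d) 2 ν) x = a j • (u j).1.snd x :=
      (Finset.eventually_all s).2 fun j _ => Lp.coeFn_smul _ _
    filter_upwards [Lp.coeFn_fun_finsetSum s fun j => a j • (u j).1.snd, h3] with x e1 e2
    rw [e1]
    exact Finset.sum_congr rfl e2
  rw [show ν = volume.restrict (cell d) from restrict_box_one] at h2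
  exact ae_rep h2

lemma gradExtrap_apply (A : Field d) (ξ : Sp d) (T : ℝ) (k : ℕ) (R : ℝ) (x : Sp d) :
    gradExtrap A ξ T k R x =
      ∑ j ∈ Finset.range k, richardsonCoeff k j • (regCorrector A ξ (2 ^ j * T) R).2 x := by
  rw [gradExtrap, richardson_eq_sum, Prod.snd_sum, Finset.sum_apply]
  rfl

lemma IsRegular.memLp_gradExtrap {α β : ℝ} {A : Field d} (hA : IsRegular α β A) (ξ : Sp d) {T : ℝ}
    (hT : 0 < T) (k : ℕ) (R : ℝ) : MemLp (gradExtrap A ξ T k R) 2 (volume.restrict (box d R)) := by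
  have h : gradExtrap A ξ T k R = fun x =>
      ∑ j ∈ Finset.range k, richardsonCoeff k j • (regCorrector A ξ (2 ^ j * T) R).2 x :=
    funext fun x => gradExtrap_apply A ξ T k R x
  rw [h]
  exact memLp_finsetSum _ fun j _ =>
    ((hA.isRegCorrector_regCorrector ξ (by positivity : 0 < 2 ^ j * T) R).1.2.1).const_smul
      (richardsonCoeff k j)

/-- The Cauchy–Schwarz inequality over the finite index set, used for the extrapolation
coefficients. -/
lemma integral_norm_sum_smul_sq_le {ν : Measure (Sp d)} (s : Finset ℕ) (a : ℕ → ℝ)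
    (y : ℕ → Sp d → Sp d) (hy : ∀ j ∈ s, MemLp (y j) 2 ν) {B : ℝ}
    (hB : ∀ j ∈ s, ∫ x, ‖y j x‖ ^ 2 ∂ν ≤ B) :
    ∫ x, ‖∑ j ∈ s, a j • y j x‖ ^ 2 ∂ν ≤ (∑ j ∈ s, a j ^ 2) * (s.card * B) := by
  have hint : ∀ j ∈ s, Integrable (fun x => ‖y j x‖ ^ 2) ν := fun j hj => integrable_norm_sq (hy j hj)
  have h1 : ∫ x, ‖∑ j ∈ s, a j • y j x‖ ^ 2 ∂ν ≤
      ∫ x, (∑ j ∈ s, a j ^ 2) * ∑ j ∈ s, ‖y j x‖ ^ 2 ∂ν := by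
    refine integral_mono (integrable_norm_sq (memLp_finsetSum _ fun j hj => (hy j hj).const_smul (a j)))
      ((integrable_finsetSum _ hint).const_mul _) fun x => ?_
    calc ‖∑ j ∈ s, a j • y j x‖ ^ 2 ≤ (∑ j ∈ s, |a j| * ‖y j x‖) ^ 2 := by
          gcongr
          refine (norm_sum_le _ _).trans_eq (Finset.sum_congr rfl fun j _ => ?_)
          rw [norm_smul, Real.norm_eq_abs]
      _ ≤ (∑ j ∈ s, |a j| ^ 2) * ∑ j ∈ s, ‖y j x‖ ^ 2 := Finset.sum_mul_sq_le_sq_mul_sq _ _ _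
      _ = _ := by simp_rw [sq_abs]
  refine h1.trans ?_
  rw [integral_const_mul, integral_finsetSum _ hint]
  refine mul_le_mul_of_nonneg_left ?_ (Finset.sum_nonneg fun j _ => sq_nonneg _)
  refine (Finset.sum_le_sum hB).trans_eq ?_
  rw [Finset.sum_const, nsmul_eq_mul]

lemma IsRegular.IsPerSolution.norm_sq_le {α β : ℝ} {A : Field d} {hA : IsRegular α β A} {ξ : Sp d}
    (hξ : ‖ξ‖ = 1) {u : PerSpace d} (hu : hA.IsPerSolution ξ 0 u) :
    ‖u‖ ^ 2 ≤ (d + 1) * (β ^ 2 / α ^ 2 * 2 ^ d) := by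
  have h := hu.energy_le
  rw [hξ, one_pow, mul_one, volume_real_box zero_le_one, zero_mul, zero_add, mul_one] at h
  have hα := hA.pos
  have h1 := norm_fst_sq_le_of_mem_periodic u.2
  rw [Submodule.coe_norm, WithLp.prod_norm_sq_eq_of_L2 u.1]
  have h2 : ‖u.1.snd‖ ^ 2 ≤ β ^ 2 / α ^ 2 * 2 ^ d := by
    have h3 := mul_le_mul_of_nonneg_left h (by positivity : 0 ≤ 2 / α)
    have h4 : 2 / α * (α / 2 * ‖u.1.snd‖ ^ 2) = ‖u.1.snd‖ ^ 2 := by field_simp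
    have h5 : 2 / α * (β ^ 2 / (2 * α) * 2 ^ d) = β ^ 2 / α ^ 2 * 2 ^ d := by field_simp
    rwa [h4, h5] at h3
  calc ‖u.1.fst‖ ^ 2 + ‖u.1.snd‖ ^ 2 ≤ (d + 1) * ‖u.1.snd‖ ^ 2 := by linarith
    _ ≤ _ := by gcongr

/-- `g` is a periodic approximation, up to `δ`, of the gradient of the corrector. -/
structure IsCellApprox (A : Field d) (ξ : Sp d) (δ K : ℝ) (g : Sp d → Sp d) (z : FunGrad d) :
    Prop where
  periodic : LatPeriodic g
  memLp : ∀ R, MemLp g 2 (volume.restrict (box d R))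
  mem_per : MemH1per z
  ae_eq : g =ᵐ[volume.restrict (box d 1)] fun x => (corrector A ξ).2 x + z.2 x
  error_le : ∫ x in box d 1, ‖z.2 x‖ ^ 2 ≤ δ ^ 2
  mean : ∫ x in cell d, g x = 0
  bound : ∫ x in cell d, ‖ξ + g x‖ ^ 2 ≤ K
  bound' : ∫ x in cell d, ‖g x‖ ^ 2 ≤ K

/-- The periodic regularized solution with parameter `T⁻¹` (junk for `T < 0`). -/
def IsRegular.perSolution {α β : ℝ} {A : Field d} (hA : IsRegular α β A) (ξ : Sp d) (T : ℝ) :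
    PerSpace d :=
  (hA.exists_isPerSolution ξ (inv_nonneg.2 (abs_nonneg T))).choose

lemma IsRegular.isPerSolution_perSolution {α β : ℝ} {A : Field d} (hA : IsRegular α β A)
    (ξ : Sp d) {T : ℝ} (hT : 0 < T) : hA.IsPerSolution ξ T⁻¹ (hA.perSolution ξ T) := by
  have h : hA.IsPerSolution ξ |T|⁻¹ (hA.perSolution ξ T) :=
    (hA.exists_isPerSolution ξ (inv_nonneg.2 (abs_nonneg T))).choose_spec
  rwa [abs_of_pos hT] at h

/-- The abstract rate on the torus. The energy bound for the corrector makes the constant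
independent of `A` and `ξ`. -/
lemma IsRegular.norm_richardson_perSolution_sub_le {α β : ℝ} {A : Field d} (hA : IsRegular α β A)
    {ξ : Sp d} (hξ : ‖ξ‖ = 1) {u : PerSpace d} (hu : hA.IsPerSolution ξ 0 u) {k : ℕ} (hk : 1 ≤ k)
    {T : ℝ} (hT : 0 < T) :
    ‖richardson (hA.perSolution ξ) k T - u‖ ≤
      richardsonNorm k * ((α / (d + 1))⁻¹ * β * ((α / (d + 1))⁻¹ ^ k *
        Real.sqrt ((d + 1) * (β ^ 2 / α ^ 2 * 2 ^ d)))) * (T ^ k)⁻¹ := by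
  have hα := hA.pos
  have hβ := hA.beta_pos
  have h := norm_richardson_solution_sub_le (V := PerSpace d) (k := k) (T := T)
    (m := restrictForm (massForm _) _)
    (a := restrictForm (hA.energyForm (box d 1)) _) (c := α / (d + 1)) (M := β) (by positivity)
    hA.energyForm_coercive (fun u => massForm_self_nonneg u.1) (fun u v => abs_massForm_le u.1 v.1)
    (fun u v => hA.abs_energyForm_le _ u.1 v.1) (u := u)
    (ℓ := (hA.source (volume_box_lt_top 1) ξ).comp (Submodule.subtypeL _))
    (fun v => by have := hu v; rwa [zero_mul, zero_add] at this)
    (f := hA.perSolution ξ) (fun S hS v => hA.isPerSolution_perSolution ξ hS v) hk hT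
  refine h.trans ?_
  have h1 : ‖u‖ ≤ Real.sqrt ((d + 1) * (β ^ 2 / α ^ 2 * 2 ^ d)) :=
    Real.le_sqrt_of_sq_le (hu.norm_sq_le hξ)
  have h2 := richardsonNorm_nonneg k
  gcongr

/-- The hypothesis is assumed for every periodic solution so that it can be applied to the one
representing the chosen `corrector`. The error `z` is the difference of the two. -/
lemma IsRegular.isCellApprox {α β : ℝ} {A : Field d} (hA : IsRegular α β A) {ξ : Sp d}
    (hξ : ‖ξ‖ = 1) {u : PerSpace d} {δ N : ℝ} (hv : ∀ v, hA.IsPerSolution ξ 0 v →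
      ‖v‖ ≤ N ∧ ‖u - v‖ ≤ δ) :
    ∃ z, IsCellApprox A ξ δ (2 * (2 ^ d + (N + δ) ^ 2)) (perExt u.1).2 z := by
  obtain ⟨v, hvs, e1, e2⟩ := (hA.isCorrector_iff ξ _).1 (hA.isCorrector_corrector ξ)
  obtain ⟨n1, n2⟩ := hv v hvs
  have hint : IntegrableOn (fun x => ‖(perExt u.1).2 x‖ ^ 2) (cell d) :=
    (integrableOn_norm_sq_perExt u.1).2
  have hδ : 0 ≤ δ := (norm_nonneg _).trans n2
  have hu : ‖u‖ ≤ N + δ := by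
    have : u = v + (u - v) := by abel
    rw [this]; exact (norm_add_le _ _).trans (add_le_add n1 n2)
  have hb : ∫ x in cell d, ‖(perExt u.1).2 x‖ ^ 2 ≤ (N + δ) ^ 2 := by
    rw [← restrict_box_one,
      ← integral_congr_ae ((perExt_ae_eq u.1).2.mono fun x hx => by simp only [hx] :
        (fun x => ‖u.1.snd x‖ ^ 2) =ᵐ[volume.restrict (box d 1)] fun x => ‖(perExt u.1).2 x‖ ^ 2),
      ← norm_sq_eq_integral]
    exact pow_le_pow_left₀ (norm_nonneg _) ((norm_snd_le _).trans hu) 2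
  have hsq : 0 ≤ (N + δ) ^ 2 := sq_nonneg _
  refine ⟨toFunGrad (u - v).1, latPeriodic_perExt_snd _, fun R => (memLp_perExt u.1 R).2,
    memH1Closure_of_mem_sobolev (u - v).2 .rfl .rfl, ?_, ?_, ?_, ?_, ?_⟩
  · filter_upwards [(perExt_ae_eq u.1).2, e2, Lp.coeFn_sub u.1.snd v.1.snd] with x h1 h2 h3
    have h4 : (toFunGrad (u - v).1).2 x = (u.1.snd - v.1.snd : Lp (Sp d) 2 _) x := rfl
    rw [h4, h3, Pi.sub_apply, ← h1, ← h2]; abel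
  · have h4 := norm_sq_eq_integral (u - v).1.snd
    have h5 : ∫ x in box d 1, ‖(toFunGrad (u - v).1).2 x‖ ^ 2 = ‖(u - v).1.snd‖ ^ 2 := h4.symm
    rw [h5]
    exact pow_le_pow_left₀ (norm_nonneg _) ((norm_snd_le _).trans n2) 2
  · rw [← restrict_box_one, ← integral_congr_ae (perExt_ae_eq u.1).2, integral_snd_eq_zero]
  · have hfin : IsFiniteMeasure ((volume : Measure (Sp d)).restrict (cell d)) := by
      rw [← restrict_box_one]; exact ⟨by simpa using volume_box_lt_top (d := d) 1⟩
    have h6 : ∫ x in cell d, ‖ξ + (perExt u.1).2 x‖ ^ 2 ≤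
        ∫ x in cell d, (2 + 2 * ‖(perExt u.1).2 x‖ ^ 2) := by
      refine integral_mono_of_nonneg (Filter.Eventually.of_forall fun x => by positivity)
        ((integrable_const _).add (hint.const_mul 2)) (Filter.Eventually.of_forall fun x => ?_)
      simp only
      have h7 := norm_add_le ξ ((perExt u.1).2 x)
      rw [hξ] at h7
      nlinarith [norm_nonneg (ξ + (perExt u.1).2 x), sq_nonneg (1 - ‖(perExt u.1).2 x‖)]
    rw [integral_add (integrable_const _) (hint.const_mul 2), integral_const_mul,
      setIntegral_const, volume_real_cell, smul_eq_mul] at h6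
    linarith
  · have : (0 : ℝ) ≤ 2 ^ d := by positivity
    linarith

/-- The extrapolated correctors are exponentially close to periodic functions which approximate the
corrector at the rate `T^{-k}`. -/
lemma exists_isCellApprox (hd : 2 ≤ d) {α β : ℝ} (hα : 0 < α) (hαβ : α ≤ β) :
    ∃ c, 0 < c ∧ ∀ k : ℕ, 1 ≤ k → ∀ T₀ : ℝ, 0 < T₀ → ∃ C, 0 < C ∧
      ∀ {A : Field d}, IsRegular α β A → ∀ {ξ : Sp d}, ‖ξ‖ = 1 → ∀ {T : ℝ}, T₀ ≤ T →
        ∃ g z, IsCellApprox A ξ (C * (T ^ k)⁻¹) C g z ∧ ∀ R L, 0 < R → 0 < L → L ≤ R →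
          ∫ x in box d L, ‖gradExtrap A ξ T k R x - g x‖ ^ 2 ≤
            C * (2 * R + 4) ^ d *
              Real.exp (-(2 * (c * ((R - L) / Real.sqrt (2 ^ (k - 1) * T))))) := by
  obtain ⟨c, hc, C₁, hC₁, hdecay⟩ := exists_decay hd hα hαβ
  refine ⟨c, hc, fun k hk T₀ hT₀ => ?_⟩
  have hβ : 0 < β := hα.trans_le hαβ
  set N : ℝ := Real.sqrt ((d + 1) * (β ^ 2 / α ^ 2 * 2 ^ d)) with hN
  set C₂ : ℝ := richardsonNorm k * ((α / (d + 1))⁻¹ * β * ((α / (d + 1))⁻¹ ^ k * N)) with hC₂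
  have hN0 : 0 ≤ N := Real.sqrt_nonneg _
  have hC₂0 : 0 ≤ C₂ := by
    have := richardsonNorm_nonneg k
    positivity
  set C₃ : ℝ := 2 * (2 ^ d + (N + C₂ * (T₀ ^ k)⁻¹) ^ 2) with hC₃
  set C₄ : ℝ := (∑ j ∈ Finset.range k, richardsonCoeff k j ^ 2) * (k * C₁) with hC₄
  have hC₃0 : 0 < C₃ := by positivity
  have hC₄0 : 0 ≤ C₄ := by
    have := Finset.sum_nonneg fun j (_ : j ∈ Finset.range k) => sq_nonneg (richardsonCoeff k j)
    positivity
  refine ⟨C₂ + C₃ + C₄, by positivity, ?_⟩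
  intro A hA ξ hξ T hT
  have hTpos : 0 < T := hT₀.trans_le hT
  obtain ⟨z, hz⟩ := hA.isCellApprox hξ (u := richardson (hA.perSolution ξ) k T)
    (δ := C₂ * (T ^ k)⁻¹) fun v hv =>
      ⟨Real.le_sqrt_of_sq_le (hv.norm_sq_le hξ),
        hA.norm_richardson_perSolution_sub_le hξ hv hk hTpos⟩
  have hKle : 2 * (2 ^ d + (N + C₂ * (T ^ k)⁻¹) ^ 2) ≤ C₂ + C₃ + C₄ := by
    have : 2 * (2 ^ d + (N + C₂ * (T ^ k)⁻¹) ^ 2) ≤ C₃ := by rw [hC₃]; gcongr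
    linarith
  refine ⟨_, z, ⟨hz.periodic, hz.memLp, hz.mem_per, hz.ae_eq, hz.error_le.trans ?_, hz.mean,
    hz.bound.trans hKle, hz.bound'.trans hKle⟩, ?_⟩
  · have : C₂ ≤ C₂ + C₃ + C₄ := by linarith
    gcongr
  intro R L hR hL hLR
  set B := C₁ * (2 * R + 4) ^ d *
    Real.exp (-(2 * (c * ((R - L) / Real.sqrt (2 ^ (k - 1) * T))))) with hB
  have hsub : box d L ⊆ box d R := fun x hx i => (hx i).trans_le hLR
  have hmem : ∀ j ∈ Finset.range k, MemLp (fun x => (regCorrector A ξ (2 ^ j * T) R).2 x -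
      (perExt (hA.perSolution ξ (2 ^ j * T)).1).2 x) 2 (volume.restrict (box d L)) := fun j _ =>
    (((hA.isRegCorrector_regCorrector ξ (by positivity : 0 < 2 ^ j * T) R).1.2.1).mono_measure
      (Measure.restrict_mono hsub le_rfl)).sub (memLp_perExt _ L).2
  have hbd : ∀ j ∈ Finset.range k, ∫ x in box d L, ‖(regCorrector A ξ (2 ^ j * T) R).2 x -
      (perExt (hA.perSolution ξ (2 ^ j * T)).1).2 x‖ ^ 2 ≤ B := by
    intro j hj
    have hTj : 0 < 2 ^ j * T := by positivity
    refine (hdecay hA hξ hTj hR hL hLR (hA.isPerSolution_perSolution ξ hTj)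
      (hA.isRegCorrector_regCorrector ξ hTj R)).trans ?_
    -- Among the parameters `2^j T` with `j < k` the largest decays most slowly; its rate bounds all
    -- the others.
    have hjk : (2 : ℝ) ^ j ≤ 2 ^ (k - 1) :=
      pow_le_pow_right₀ one_le_two (by have := Finset.mem_range.1 hj; omega)
    have hs : Real.sqrt (2 ^ j * T) ≤ Real.sqrt (2 ^ (k - 1) * T) := Real.sqrt_le_sqrt (by gcongr)
    have hs0 : 0 < Real.sqrt (2 ^ j * T) := Real.sqrt_pos.2 hTj
    have hRL : 0 ≤ R - L := sub_nonneg.2 hLR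
    rw [hB]
    gcongr
  have h := integral_norm_sum_smul_sq_le (Finset.range k) (richardsonCoeff k) _ hmem hbd
  rw [Finset.card_range] at h
  have hcongr : ∫ x in box d L,
      ‖gradExtrap A ξ T k R x - (perExt (richardson (hA.perSolution ξ) k T).1).2 x‖ ^ 2 =
      ∫ x in box d L, ‖∑ j ∈ Finset.range k, richardsonCoeff k j •
        ((regCorrector A ξ (2 ^ j * T) R).2 x -
          (perExt (hA.perSolution ξ (2 ^ j * T)).1).2 x)‖ ^ 2 := by
    have h1 := perExt_sum_ae (Finset.range k) (richardsonCoeff k)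
      fun j => hA.perSolution ξ (2 ^ j * T)
    rw [← richardson_eq_sum] at h1
    refine integral_congr_ae ((ae_restrict_of_ae h1).mono fun x hx => ?_)
    simp only
    rw [hx, gradExtrap_apply, ← Finset.sum_sub_distrib]
    simp only [smul_sub]
  rw [hcongr]
  refine h.trans ?_
  have h2 : (∑ j ∈ Finset.range k, richardsonCoeff k j ^ 2) * (k * B) = C₄ * (2 * R + 4) ^ d *
      Real.exp (-(2 * (c * ((R - L) / Real.sqrt (2 ^ (k - 1) * T))))) := by rw [hB, hC₄]; ring
  rw [h2]
  have : C₄ ≤ C₂ + C₃ + C₄ := by linarith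
  gcongr

/-! ### Perturbation of weighted bilinear forms -/

/-- The `L²(s)` norm. -/
def l2norm (s : Set (Sp d)) (X : Sp d → Sp d) : ℝ := Real.sqrt (∫ x in s, ‖X x‖ ^ 2)

lemma l2norm_nonneg (s : Set (Sp d)) (X : Sp d → Sp d) : 0 ≤ l2norm s X := Real.sqrt_nonneg _

lemma l2norm_le {s : Set (Sp d)} {X : Sp d → Sp d} {b : ℝ} (hb : 0 ≤ b)
    (h : ∫ x in s, ‖X x‖ ^ 2 ≤ b ^ 2) : l2norm s X ≤ b := Real.sqrt_le_iff.2 ⟨hb, h⟩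

lemma l2norm_eq_norm_toLp {s : Set (Sp d)} {X : Sp d → Sp d}
    (hX : MemLp X 2 (volume.restrict s)) : l2norm s X = ‖hX.toLp X‖ := by
  rw [l2norm, ← Real.sqrt_sq (norm_nonneg (hX.toLp X)), norm_sq_eq_integral]
  congr 1
  exact integral_congr_ae (hX.coeFn_toLp.mono fun x hx => by simp only [hx])

lemma l2norm_sub_le {s : Set (Sp d)} {X Y : Sp d → Sp d} (hX : MemLp X 2 (volume.restrict s))
    (hY : MemLp Y 2 (volume.restrict s)) :
    l2norm s (fun x => X x - Y x) ≤ l2norm s X + l2norm s Y := by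
  have h : l2norm s (fun x => X x - Y x) = ‖(hX.sub hY).toLp (X - Y)‖ :=
    l2norm_eq_norm_toLp (hX.sub hY)
  rw [h, l2norm_eq_norm_toLp hX, l2norm_eq_norm_toLp hY, MemLp.toLp_sub]
  exact norm_sub_le _ _

lemma l2norm_const {s : Set (Sp d)} (b : Sp d) :
    l2norm s (fun _ => b) = Real.sqrt ((volume : Measure (Sp d)).real s) * ‖b‖ := by
  rw [l2norm, setIntegral_const, smul_eq_mul, Real.sqrt_mul measureReal_nonneg,
    Real.sqrt_sq (norm_nonneg b)]

lemma integral_norm_mul_norm_le {s : Set (Sp d)} {X Y : Sp d → Sp d}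
    (hX : MemLp X 2 (volume.restrict s)) (hY : MemLp Y 2 (volume.restrict s)) :
    ∫ x in s, ‖X x‖ * ‖Y x‖ ≤ l2norm s X * l2norm s Y := by
  have h1 := real_inner_le_norm (hX.norm.toLp _) (hY.norm.toLp _)
  rw [L2.inner_def] at h1
  have h2 : ∫ x in s, inner ℝ (hX.norm.toLp _ x) (hY.norm.toLp _ x) = ∫ x in s, ‖X x‖ * ‖Y x‖ := by
    refine integral_congr_ae ?_
    filter_upwards [hX.norm.coeFn_toLp, hY.norm.coeFn_toLp] with x e1 e2
    rw [e1, e2]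
    simp [mul_comm]
  have h3 : ∀ {Z : Sp d → Sp d} (hZ : MemLp Z 2 (volume.restrict s)),
      ‖hZ.norm.toLp _‖ = l2norm s Z := fun hZ => by
    rw [l2norm_eq_norm_toLp hZ, Lp.norm_toLp, Lp.norm_toLp, eLpNorm_norm]
  rw [h2, h3 hX, h3 hY] at h1
  exact h1

section Weighted

variable {α β : ℝ} {A : Field d} {s : Set (Sp d)} {m : Sp d → ℝ} {M : ℝ}

lemma integrable_mul_weight (hm : Measurable m) (h0 : ∀ x, 0 ≤ m x) (hM : ∀ x, m x ≤ M)
    {f : Sp d → ℝ} (hf : IntegrableOn f s) : IntegrableOn (fun x => f x * m x) s :=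
  hf.mul_bdd (c := M) hm.aestronglyMeasurable (Filter.Eventually.of_forall fun x => by
    rw [Real.norm_of_nonneg (h0 x)]; exact hM x)

lemma IsRegular.integrableOn_inner_act (hA : IsRegular α β A) {X Y : Sp d → Sp d}
    (hX : MemLp X 2 (volume.restrict s)) (hY : MemLp Y 2 (volume.restrict s)) :
    IntegrableOn (fun x => inner ℝ (X x) (act (A x) (Y x))) s :=
  integrable_inner_of_memLp hX (hA.memLp_act hY)

lemma IsRegular.abs_integral_inner_mul_le (hA : IsRegular α β A) (hm : Measurable m)
    (h0 : ∀ x, 0 ≤ m x) (hM : ∀ x, m x ≤ M) {X Y : Sp d → Sp d}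
    (hX : MemLp X 2 (volume.restrict s)) (hY : MemLp Y 2 (volume.restrict s)) :
    |∫ x in s, inner ℝ (X x) (act (A x) (Y x)) * m x| ≤ β * M * (l2norm s X * l2norm s Y) := by
  have hβ := hA.beta_pos
  have hM0 : 0 ≤ M := (h0 0).trans (hM 0)
  have i1 : IntegrableOn (fun x => ‖X x‖ * ‖Y x‖) s := hX.norm.integrable_mul hY.norm
  have i2 := integrable_mul_weight hm h0 hM
    (hA.integrableOn_inner_act (s := s) hX hY)
  calc |∫ x in s, inner ℝ (X x) (act (A x) (Y x)) * m x|
      ≤ ∫ x in s, |inner ℝ (X x) (act (A x) (Y x)) * m x| := abs_integral_le_integral_abs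
    _ ≤ ∫ x in s, β * M * (‖X x‖ * ‖Y x‖) := by
        refine integral_mono i2.abs (i1.const_mul _) fun x => ?_
        simp only
        rw [abs_mul, abs_of_nonneg (h0 x)]
        refine (mul_le_mul (hA.abs_inner_act_le x (X x) (Y x)) (hM x) (h0 x)
          (by positivity)).trans_eq ?_
        ring
    _ ≤ _ := by
        rw [integral_const_mul]
        exact mul_le_mul_of_nonneg_left (integral_norm_mul_norm_le hX hY) (by positivity)

/-- Bilinear expansion: two mixed terms of size `a b` and one of size `b²`. -/
lemma IsRegular.abs_integral_add_sub_le (hA : IsRegular α β A) (hm : Measurable m)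
    (h0 : ∀ x, 0 ≤ m x) (hM : ∀ x, m x ≤ M) {X X' Y Y' : Sp d → Sp d}
    (hX : MemLp X 2 (volume.restrict s)) (hX' : MemLp X' 2 (volume.restrict s))
    (hY : MemLp Y 2 (volume.restrict s)) (hY' : MemLp Y' 2 (volume.restrict s)) {a b : ℝ}
    (hXa : l2norm s X ≤ a) (hXa' : l2norm s X' ≤ a) (hYb : l2norm s Y ≤ b)
    (hYb' : l2norm s Y' ≤ b) :
    |(∫ x in s, inner ℝ (X' x + Y' x) (act (A x) (X x + Y x)) * m x) -
      ∫ x in s, inner ℝ (X' x) (act (A x) (X x)) * m x| ≤ β * M * (2 * (a * b) + b * b) := by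
  have hβ := hA.beta_pos
  have hM0 : 0 ≤ M := (h0 0).trans (hM 0)
  have ha : 0 ≤ a := (l2norm_nonneg _ _).trans hXa
  have hb : 0 ≤ b := (l2norm_nonneg _ _).trans hYb
  have hi : ∀ {U V : Sp d → Sp d}, MemLp U 2 (volume.restrict s) →
      MemLp V 2 (volume.restrict s) →
      IntegrableOn (fun x => inner ℝ (U x) (act (A x) (V x)) * m x) s := fun hU hV =>
    integrable_mul_weight hm h0 hM (hA.integrableOn_inner_act hU hV)
  have hle : ∀ {U V : Sp d → Sp d} {p q : ℝ}, MemLp U 2 (volume.restrict s) →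
      MemLp V 2 (volume.restrict s) → l2norm s U ≤ p → l2norm s V ≤ q →
      |∫ x in s, inner ℝ (U x) (act (A x) (V x)) * m x| ≤ β * M * (p * q) := by
    intro U V p q hU hV hp hq
    refine (hA.abs_integral_inner_mul_le hm h0 hM hU hV).trans ?_
    exact mul_le_mul_of_nonneg_left (mul_le_mul hp hq (l2norm_nonneg _ _)
      ((l2norm_nonneg _ _).trans hp)) (by positivity)
  have h1 : (∫ x in s, inner ℝ (X' x + Y' x) (act (A x) (X x + Y x)) * m x) -
      ∫ x in s, inner ℝ (X' x) (act (A x) (X x)) * m x =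
      (∫ x in s, inner ℝ (X' x) (act (A x) (Y x)) * m x) +
        (∫ x in s, inner ℝ (Y' x) (act (A x) (X x)) * m x) +
        ∫ x in s, inner ℝ (Y' x) (act (A x) (Y x)) * m x := by
    have e1 : ∫ x in s, inner ℝ (X' x + Y' x) (act (A x) (X x + Y x)) * m x =
        ∫ x in s, (inner ℝ (X' x) (act (A x) (X x)) * m x +
          (inner ℝ (X' x) (act (A x) (Y x)) * m x + inner ℝ (Y' x) (act (A x) (X x)) * m x +
            inner ℝ (Y' x) (act (A x) (Y x)) * m x)) := by
      refine integral_congr_ae (Filter.Eventually.of_forall fun x => ?_)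
      simp only
      rw [act_add, inner_add_left, inner_add_right, inner_add_right]
      ring
    have i1 := hi hX' hX
    have i2 := hi hX' hY
    have i3 := hi hY' hX
    have i4 := hi hY' hY
    have i23 : IntegrableOn (fun x => inner ℝ (X' x) (act (A x) (Y x)) * m x +
      inner ℝ (Y' x) (act (A x) (X x)) * m x) s := i2.add i3
    have i234 : IntegrableOn (fun x => inner ℝ (X' x) (act (A x) (Y x)) * m x +
      inner ℝ (Y' x) (act (A x) (X x)) * m x + inner ℝ (Y' x) (act (A x) (Y x)) * m x) s :=
      i23.add i4
    rw [e1, integral_add i1 i234, integral_add i23 i4, integral_add i2 i3, add_sub_cancel_left]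
  rw [h1]
  refine (abs_add_three _ _ _).trans ((add_le_add (add_le_add (hle hX' hY hXa' hYb)
    (hle hY' hX hYb' hXa)) (hle hY' hY hYb' hYb)).trans_eq ?_)
  ring

end Weighted

/-! ### The periodic part of the error -/

/-- The error is quadratic in `δ`: each error is an admissible test function for the corrector
equation of the other problem, so both first-order terms vanish. -/
lemma IsCellApprox.abs_average_sub_homForm_le {α β : ℝ} {A : Field d} (hA : IsRegular α β A)
    {ξ ξ' : Sp d} {δ K : ℝ} {g g' : Sp d → Sp d} {z z' : FunGrad d}
    (h : IsCellApprox A ξ δ K g z) (h' : IsCellApprox (adj A) ξ' δ K g' z') :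
    |(⨍ x in cell d, inner ℝ (ξ' + g' x) (act (A x) (ξ + g x))) - homForm A ξ' ξ| ≤ β * δ ^ 2 := by
  have hβ := hA.beta_pos
  obtain ⟨m1, c1⟩ := hA.isCorrector_corrector ξ
  obtain ⟨m2, c2⟩ := hA.adj.isCorrector_corrector ξ'
  set P : Sp d → Sp d := fun x => ξ + (corrector A ξ).2 x with hP
  set P' : Sp d → Sp d := fun x => ξ' + (corrector (adj A) ξ').2 x with hP'
  have hPm : MemLp P 2 (volume.restrict (box d 1)) :=
    (memLp_two_const (volume_box_lt_top 1) ξ).add m1.2.1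
  have hPm' : MemLp P' 2 (volume.restrict (box d 1)) :=
    (memLp_two_const (volume_box_lt_top 1) ξ').add m2.2.1
  have hz := h.mem_per.2.1
  have hz' := h'.mem_per.2.1
  have hi : ∀ {U V : Sp d → Sp d}, MemLp U 2 (volume.restrict (box d 1)) →
      MemLp V 2 (volume.restrict (box d 1)) →
      IntegrableOn (fun x => inner ℝ (U x) (act (A x) (V x))) (box d 1) := fun hU hV =>
    integrable_inner_of_memLp hU (hA.memLp_act hV)
  have k1 : ∫ x in box d 1, inner ℝ (z'.2 x) (act (A x) (P x)) = 0 := c1 z' h'.mem_per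
  -- Transposition turns this term into the adjoint corrector equation tested with `z`.
  have k2 : ∫ x in box d 1, inner ℝ (P' x) (act (A x) (z.2 x)) = 0 := by
    rw [← c2 z h.mem_per]
    exact integral_congr_ae (Filter.Eventually.of_forall fun x =>
      (inner_act_transpose (A x) (z.2 x) (P' x)).symm)
  have k3 : ∫ x in box d 1, inner ℝ (ξ' + g' x) (act (A x) (ξ + g x)) =
      (∫ x in box d 1, inner ℝ (P' x) (act (A x) (P x))) +
        ∫ x in box d 1, inner ℝ (z'.2 x) (act (A x) (z.2 x)) := by
    have e1 : ∫ x in box d 1, inner ℝ (ξ' + g' x) (act (A x) (ξ + g x)) =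
        ∫ x in box d 1, ((inner ℝ (P' x) (act (A x) (P x)) + inner ℝ (z'.2 x) (act (A x) (P x))) +
          (inner ℝ (P' x) (act (A x) (z.2 x)) + inner ℝ (z'.2 x) (act (A x) (z.2 x)))) := by
      refine integral_congr_ae ?_
      filter_upwards [h.ae_eq, h'.ae_eq] with x e1 e2
      rw [e1, e2, ← add_assoc, ← add_assoc, act_add _ (ξ + _), inner_add_left, inner_add_right,
        inner_add_right]
      simp only [hP, hP']
      ring
    have i1 := hi hPm' hPm
    have i2 := hi hz' hPm
    have i3 := hi hPm' hz
    have i4 := hi hz' hz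
    have i12 : IntegrableOn (fun x => inner ℝ (P' x) (act (A x) (P x)) +
      inner ℝ (z'.2 x) (act (A x) (P x))) (box d 1) := i1.add i2
    have i34 : IntegrableOn (fun x => inner ℝ (P' x) (act (A x) (z.2 x)) +
      inner ℝ (z'.2 x) (act (A x) (z.2 x))) (box d 1) := i3.add i4
    rw [e1, integral_add i12 i34, integral_add i1 i2, integral_add i3 i4, k1, k2]
    ring
  have k4 : |∫ x in box d 1, inner ℝ (z'.2 x) (act (A x) (z.2 x))| ≤ β * δ ^ 2 := by
    have e1 := hA.abs_integral_inner_mul_le (m := fun _ => 1) (M := 1) measurable_const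
      (fun _ => zero_le_one) (fun _ => le_rfl) hz' hz
    simp only [mul_one] at e1
    refine e1.trans (mul_le_mul_of_nonneg_left ?_ hβ.le)
    have e2 : l2norm (box d 1) z.2 ≤ |δ| := l2norm_le (abs_nonneg _) (by
      rw [sq_abs]; exact h.error_le)
    have e3 : l2norm (box d 1) z'.2 ≤ |δ| := l2norm_le (abs_nonneg _) (by
      rw [sq_abs]; exact h'.error_le)
    refine (mul_le_mul e3 e2 (l2norm_nonneg _ _) (abs_nonneg _)).trans_eq ?_
    rw [← sq, sq_abs]
  rw [homForm, ← restrict_box_one, average_eq, average_eq, k3, ← smul_sub, add_sub_cancel_left,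
    smul_eq_mul, abs_mul]
  have hvol : ((volume : Measure (Sp d)).restrict (box d 1)).real Set.univ = 2 ^ d := by
    rw [restrict_box_one, measureReal_restrict_apply_univ, volume_real_cell]
  rw [hvol, abs_of_nonneg (by positivity)]
  have h2 : ((2 : ℝ) ^ d)⁻¹ ≤ 1 := inv_le_one_of_one_le₀ (one_le_pow₀ one_le_two)
  calc ((2 : ℝ) ^ d)⁻¹ * _ ≤ 1 * _ := mul_le_mul_of_nonneg_right h2 (abs_nonneg _)
    _ ≤ _ := by rw [one_mul]; exact k4

/-! ### The error estimate for everywhere elliptic and periodic coefficients -/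

/-- Nothing is known about `μ` outside `[-1,1]`; the zero extension is measurable, nonnegative and
bounded everywhere. -/
lemma setIntegral_scaledFilter {E : Type*} [NormedAddCommGroup E] [NormedSpace ℝ E] (μ : ℝ → ℝ)
    {L : ℝ} (hL : 0 < L) (F : ℝ → Sp d → E) :
    ∫ x in box d L, F (scaledFilter d μ L x) x = ∫ x in box d L, F (zextFilter d μ L x) x := by
  refine setIntegral_congr_fun (measurableSet_box L) fun x hx => ?_
  simp only [zextFilter_eq_indicator μ hL, Set.indicator_of_mem hx]

lemma memLp_cell_iff {E : Type*} [NormedAddCommGroup E] {f : Sp d → E} :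
    MemLp f 2 (volume.restrict (cell d)) ↔ MemLp f 2 (volume.restrict (box d 1)) := by
  rw [restrict_box_one]

/-- `G` is split into its periodic approximation, whose filtered mean is at most `η`, and the
difference, handled by the Cauchy–Schwarz inequality. -/
lemma norm_filteredMean_le {p : ℕ} {μ : ℝ → ℝ} (hμ : IsFilter p μ) {L : ℝ} (hL : 0 < L)
    {G g : Sp d → Sp d} (hG : MemLp G 2 (volume.restrict (box d L)))
    (hg : MemLp g 2 (volume.restrict (box d L))) {ξ : Sp d} (hξ : ‖ξ‖ = 1) {η : ℝ}
    (hη : ‖(∫ x in box d L, scaledFilter d μ L x • g x)‖ ≤ η) :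
    ‖filteredMean μ L G‖ ≤ μ 0 ^ d * (L ^ d)⁻¹ *
      (l2norm (box d L) (fun x => G x - g x) * Real.sqrt ((2 * L) ^ d)) + η := by
  have hfin : IsFiniteMeasure ((volume : Measure (Sp d)).restrict (box d L)) :=
    ⟨by simpa using volume_box_lt_top (d := d) L⟩
  set m := zextFilter d μ L with hm
  have hmm : Measurable m := hμ.measurable_zextFilter L
  have h0 : ∀ x, 0 ≤ m x := hμ.zextFilter_nonneg hL
  have hM : ∀ x, m x ≤ μ 0 ^ d * (L ^ d)⁻¹ := hμ.zextFilter_le hL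
  have hM0 : 0 ≤ μ 0 ^ d * (L ^ d)⁻¹ := (h0 0).trans (hM 0)
  have hi : ∀ {F : Sp d → Sp d}, MemLp F 2 (volume.restrict (box d L)) →
      IntegrableOn (fun x => m x • F x) (box d L) := fun hF =>
    (hF.integrable (by norm_num)).bdd_smul (μ 0 ^ d * (L ^ d)⁻¹) hmm.aestronglyMeasurable
      (Filter.Eventually.of_forall fun x => by rw [Real.norm_of_nonneg (h0 x)]; exact hM x)
  have hD : MemLp (fun x => G x - g x) 2 (volume.restrict (box d L)) := hG.sub hg
  have h1 : filteredMean μ L G = (∫ x in box d L, m x • (G x - g x)) +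
      ∫ x in box d L, scaledFilter d μ L x • g x := by
    rw [filteredMean, setIntegral_scaledFilter μ hL fun t x => t • G x,
      setIntegral_scaledFilter μ hL fun t x => t • g x, ← integral_add (hi hD) (hi hg)]
    refine integral_congr_ae (Filter.Eventually.of_forall fun x => ?_)
    simp only
    rw [smul_sub, sub_add_cancel]
  rw [h1]
  refine (norm_add_le _ _).trans (add_le_add ?_ hη)
  have h2 : ∫ x in box d L, ‖G x - g x‖ ≤
      l2norm (box d L) (fun x => G x - g x) * Real.sqrt ((2 * L) ^ d) := by
    -- The unit vector `ξ` serves only as a constant field of norm one.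
    have := integral_norm_mul_norm_le hD (memLp_two_const (volume_box_lt_top L) ξ)
    simpa only [hξ, mul_one, l2norm_const, volume_real_box hL.le] using this
  calc ‖∫ x in box d L, m x • (G x - g x)‖
      ≤ ∫ x in box d L, μ 0 ^ d * (L ^ d)⁻¹ * ‖G x - g x‖ := by
        refine norm_integral_le_of_norm_le ((hD.integrable (by norm_num)).norm.const_mul _)
          (Filter.Eventually.of_forall fun x => ?_)
        rw [norm_smul, Real.norm_of_nonneg (h0 x)]
        exact mul_le_mul_of_nonneg_right (hM x) (norm_nonneg _)
    _ ≤ _ := by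
        rw [integral_const_mul]
        exact mul_le_mul_of_nonneg_left h2 hM0

/-- The three errors in turn: removal of the perturbations, replacement of the filter by the cell
average, and replacement of the periodic approximations by the correctors. `Y` and `Y'` are left
free in order to treat the formulas with and without subtracted means together. -/
lemma IsCellApprox.abs_integral_sub_homForm_le {α β : ℝ} {A : Field d} (hA : IsRegular α β A)
    {ξ ξ' : Sp d} {δ K : ℝ} {g g' : Sp d → Sp d} {z z' : FunGrad d}
    (h : IsCellApprox A ξ δ K g z) (h' : IsCellApprox (adj A) ξ' δ K g' z') {p : ℕ} {μ : ℝ → ℝ}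
    (hμ : IsFilter p μ) {L : ℝ} (hL : 0 < L) {Cf : ℝ} (hCf : 0 ≤ Cf)
    (hf : ∀ ψ : Sp d → ℝ, LatPeriodic ψ → IntegrableOn ψ (cell d) →
      ‖(∫ x in box d L, scaledFilter d μ L x • ψ x) - ⨍ x in cell d, ψ x‖ ≤
        Cf * (L ^ (p + 1))⁻¹ * ∫ x in cell d, ‖ψ x‖)
    {Y Y' : Sp d → Sp d} (hY : MemLp Y 2 (volume.restrict (box d L)))
    (hY' : MemLp Y' 2 (volume.restrict (box d L))) {a b : ℝ}
    (hXa : l2norm (box d L) (fun x => ξ + g x) ≤ a)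
    (hXa' : l2norm (box d L) (fun x => ξ' + g' x) ≤ a)
    (hYb : l2norm (box d L) Y ≤ b) (hYb' : l2norm (box d L) Y' ≤ b) :
    |(∫ x in box d L, inner ℝ (ξ' + g' x + Y' x) (act (A x) (ξ + g x + Y x)) *
        scaledFilter d μ L x) - homForm A ξ' ξ| ≤
      β * (μ 0 ^ d * (L ^ d)⁻¹) * (2 * (a * b) + b * b) + Cf * (L ^ (p + 1))⁻¹ * (β * K) +
        β * δ ^ 2 := by
  have hβ := hA.beta_pos
  have hconst : ∀ (R : ℝ) (v : Sp d), MemLp (fun _ : Sp d => v) 2 (volume.restrict (box d R)) :=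
    fun R v => memLp_two_const (volume_box_lt_top R) v
  have h1 := hA.abs_integral_add_sub_le (hμ.measurable_zextFilter L) (hμ.zextFilter_nonneg hL)
    (hμ.zextFilter_le hL) ((hconst L ξ).add (h.memLp L)) ((hconst L ξ').add (h'.memLp L)) hY hY'
    hXa hXa' hYb hYb'
  simp only [Pi.add_apply] at h1
  rw [← setIntegral_scaledFilter μ hL
      fun t x => inner ℝ (ξ' + g' x + Y' x) (act (A x) (ξ + g x + Y x)) * t,
    ← setIntegral_scaledFilter μ hL
      fun t x => inner ℝ (ξ' + g' x) (act (A x) (ξ + g x)) * t] at h1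
  have hX1 : MemLp (fun x => ξ + g x) 2 (volume.restrict (cell d)) :=
    memLp_cell_iff.2 ((hconst 1 ξ).add (h.memLp 1))
  have hX1' : MemLp (fun x => ξ' + g' x) 2 (volume.restrict (cell d)) :=
    memLp_cell_iff.2 ((hconst 1 ξ').add (h'.memLp 1))
  have hψp : LatPeriodic fun x => inner ℝ (ξ' + g' x) (act (A x) (ξ + g x)) := fun x n => by
    simp only [h.periodic x n, h'.periodic x n, hA.periodic x n]
  have hψi : IntegrableOn (fun x => inner ℝ (ξ' + g' x) (act (A x) (ξ + g x))) (cell d) :=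
    hA.integrableOn_inner_act hX1' hX1
  have h2 := hf _ hψp hψi
  have h3 : ∫ x in cell d, ‖inner ℝ (ξ' + g' x) (act (A x) (ξ + g x))‖ ≤ β * K := by
    have i1 : IntegrableOn (fun x => ‖ξ + g x‖ ^ 2) (cell d) := integrable_norm_sq hX1
    have i2 : IntegrableOn (fun x => ‖ξ' + g' x‖ ^ 2) (cell d) := integrable_norm_sq hX1'
    have e1 : ∫ x in cell d, ‖inner ℝ (ξ' + g' x) (act (A x) (ξ + g x))‖ ≤
        ∫ x in cell d, β / 2 * (‖ξ + g x‖ ^ 2 + ‖ξ' + g' x‖ ^ 2) := by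
      refine integral_mono hψi.norm ((i1.add i2).const_mul _) fun x => ?_
      simp only
      refine (hA.abs_inner_act_le x _ _).trans ?_
      nlinarith [sq_nonneg (‖ξ + g x‖ - ‖ξ' + g' x‖)]
    rw [integral_const_mul, integral_add i1 i2] at e1
    refine e1.trans ?_
    have := add_le_add h.bound h'.bound
    calc β / 2 * _ ≤ β / 2 * (K + K) := mul_le_mul_of_nonneg_left this (by positivity)
      _ = β * K := by ring
  have h4 := h2.trans (mul_le_mul_of_nonneg_left h3 (by positivity))
  have h5 := h.abs_average_sub_homForm_le hA h'
  simp only [smul_eq_mul, Real.norm_eq_abs] at h4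
  simp_rw [mul_comm (scaledFilter d μ L _)] at h4
  have := abs_add_three
    ((∫ x in box d L, inner ℝ (ξ' + g' x + Y' x) (act (A x) (ξ + g x + Y x)) *
        scaledFilter d μ L x) -
      ∫ x in box d L, inner ℝ (ξ' + g' x) (act (A x) (ξ + g x)) * scaledFilter d μ L x)
    ((∫ x in box d L, inner ℝ (ξ' + g' x) (act (A x) (ξ + g x)) * scaledFilter d μ L x) -
      ⨍ x in cell d, inner ℝ (ξ' + g' x) (act (A x) (ξ + g x)))
    ((⨍ x in cell d, inner ℝ (ξ' + g' x) (act (A x) (ξ + g x))) - homForm A ξ' ξ)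
  rw [sub_add_sub_cancel, sub_add_sub_cancel] at this
  linarith

/-- `Λ`, of order `(R + 2)^{d/2}`, is the common scale of all `L²` norms on `Q_L`. Its square times
the bound of the filter is at most `S`, which will be chosen independently of `L` and `R`. The
filtered mean is small since `g` has zero mean. -/
lemma IsCellApprox.l2norm_bounds {A : Field d} {ξ : Sp d} (hξ : ‖ξ‖ = 1) {δ K : ℝ}
    {g : Sp d → Sp d} {z : FunGrad d} (h : IsCellApprox A ξ δ K g z) (hK : 0 ≤ K) {p : ℕ}
    {μ : ℝ → ℝ} (hμ : IsFilter p μ) {R L : ℝ} (hL : 0 < L) (hLR : L ≤ R) {Cf : ℝ} (hCf : 0 ≤ Cf)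
    (hf : ∀ ψ : Sp d → Sp d, LatPeriodic ψ → IntegrableOn ψ (cell d) →
      ‖(∫ x in box d L, scaledFilter d μ L x • ψ x) - ⨍ x in cell d, ψ x‖ ≤
        Cf * (L ^ (p + 1))⁻¹ * ∫ x in cell d, ‖ψ x‖)
    {G : Sp d → Sp d} (hG : MemLp G 2 (volume.restrict (box d L))) {Λ E S : ℝ} (hΛ0 : 0 ≤ Λ)
    (hE : 0 ≤ E) (hΛ : Λ ^ 2 = (K + 1) * (2 * R + 4) ^ d)
    (hS : μ 0 ^ d * (L ^ d)⁻¹ * Λ ^ 2 ≤ S)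
    (hD : ∫ x in box d L, ‖G x - g x‖ ^ 2 ≤ (Λ * E) ^ 2) :
    l2norm (box d L) (fun x => ξ + g x) ≤ Λ ∧ l2norm (box d L) (fun x => G x - g x) ≤ Λ * E ∧
      l2norm (box d L) (fun x => G x - g x - filteredMean μ L G) ≤
        Λ * (E + (S * E + Cf * (2 ^ d + K) * (L ^ (p + 1))⁻¹)) := by
  have hg := h.memLp L
  have hR : 0 < R := hL.trans_le hLR
  have m1 : MemLp (fun x => ξ + g x) 2 (volume.restrict (box d 1)) :=
    (memLp_two_const (volume_box_lt_top 1) ξ).add (h.memLp 1)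
  have hgc : MemLp g 2 (volume.restrict (cell d)) := memLp_cell_iff.2 (h.memLp 1)
  have hfin : IsFiniteMeasure ((volume : Measure (Sp d)).restrict (cell d)) := by
    rw [← restrict_box_one]; exact ⟨by simpa using volume_box_lt_top (d := d) 1⟩
  have hD' : l2norm (box d L) (fun x => G x - g x) ≤ Λ * E := l2norm_le (mul_nonneg hΛ0 hE) hD
  refine ⟨l2norm_le hΛ0 ?_, hD', ?_⟩
  · have e1 := integral_box_le (f := fun x => ‖ξ + g x‖ ^ 2)
      (fun x n => by simp only [h.periodic x n]) (fun x => by positivity)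
      (integrable_norm_sq (memLp_cell_iff.2 m1)) hL.le
    refine e1.trans ?_
    rw [hΛ]
    calc (L + 2) ^ d * ∫ x in cell d, ‖ξ + g x‖ ^ 2 ≤ (2 * R + 4) ^ d * (K + 1) := by
          refine mul_le_mul (pow_le_pow_left₀ (by positivity) (by linarith) d)
            (h.bound.trans (by linarith)) (integral_nonneg fun x => by positivity) (by positivity)
      _ = _ := mul_comm _ _
  · have hsq : Real.sqrt ((2 * L) ^ d) ≤ Λ := by
      refine Real.sqrt_le_iff.2 ⟨hΛ0, ?_⟩
      rw [hΛ]
      calc (2 * L) ^ d ≤ 1 * (2 * R + 4) ^ d := by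
            rw [one_mul]; exact pow_le_pow_left₀ (by positivity) (by linarith) d
        _ ≤ (K + 1) * (2 * R + 4) ^ d := by gcongr; linarith
    have hg1 : ∫ x in cell d, ‖g x‖ ≤ 2 ^ d + K := by
      have e1 : ∫ x in cell d, ‖g x‖ ≤ ∫ x in cell d, (1 + ‖g x‖ ^ 2) := by
        refine integral_mono (hgc.integrable (by norm_num)).norm
          ((integrable_const _).add (integrable_norm_sq hgc)) fun x => ?_
        simp only
        nlinarith [sq_nonneg (‖g x‖ - 1), norm_nonneg (g x)]
      rw [integral_add (integrable_const _) (integrable_norm_sq hgc), setIntegral_const,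
        volume_real_cell, smul_eq_mul, mul_one] at e1
      linarith [h.bound']
    have hη : ‖(∫ x in box d L, scaledFilter d μ L x • g x)‖ ≤
        Cf * (2 ^ d + K) * (L ^ (p + 1))⁻¹ := by
      have e1 := hf g h.periodic (hgc.integrable (by norm_num))
      rw [setAverage_eq, h.mean, smul_zero, sub_zero] at e1
      refine e1.trans ?_
      calc Cf * (L ^ (p + 1))⁻¹ * ∫ x in cell d, ‖g x‖ ≤ Cf * (L ^ (p + 1))⁻¹ * (2 ^ d + K) := by
            gcongr
        _ = _ := by ring
    have hb := norm_filteredMean_le hμ hL hG hg hξ hη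
    have hμ0 : 0 ≤ μ 0 := hμ.nonneg 0 (by norm_num)
    have hb' : ‖filteredMean μ L G‖ ≤ S * E + Cf * (2 ^ d + K) * (L ^ (p + 1))⁻¹ := by
      refine hb.trans (add_le_add ?_ le_rfl)
      calc μ 0 ^ d * (L ^ d)⁻¹ *
            (l2norm (box d L) (fun x => G x - g x) * Real.sqrt ((2 * L) ^ d))
          ≤ μ 0 ^ d * (L ^ d)⁻¹ * ((Λ * E) * Λ) := by
            gcongr
        _ = μ 0 ^ d * (L ^ d)⁻¹ * Λ ^ 2 * E := by ring
        _ ≤ S * E := by gcongr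
    have e1 := l2norm_sub_le (X := fun x => G x - g x) (hG.sub hg)
      (memLp_two_const (volume_box_lt_top L) (filteredMean μ L G))
    refine e1.trans ?_
    rw [mul_add, l2norm_const, volume_real_box hL.le]
    exact add_le_add hD' (mul_le_mul hsq hb' (norm_nonneg _) hΛ0)

/-- From `R ≤ κ T ≤ κ² R²` follows `R ≥ κ⁻²`, hence lower bounds for `T` and `L`. The additive `4`
is then absorbed into a multiple of `L`. -/
lemma parameter_bounds {κ T R L : ℝ} (hκ : 0 < κ) (hR : 0 < R)
    (h1 : T ≤ κ * R ^ 2) (h2 : R ≤ κ * T) (h3 : R ≤ κ * L) :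
    (κ ^ 3)⁻¹ ≤ T ∧ (κ ^ 3)⁻¹ ≤ L ∧ 2 * R + 4 ≤ (2 * κ + 4 * κ ^ 3) * L := by
  have e1 : 1 ≤ κ ^ 2 * R := by
    have : R * 1 ≤ R * (κ ^ 2 * R) := by
      calc R * 1 ≤ κ * T := by linarith
        _ ≤ κ * (κ * R ^ 2) := by gcongr
        _ = _ := by ring
    exact le_of_mul_le_mul_left this hR
  have e2 : 1 ≤ κ ^ 3 * T := by
    calc (1 : ℝ) ≤ κ ^ 2 * R := e1
      _ ≤ κ ^ 2 * (κ * T) := by gcongr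
      _ = _ := by ring
  have e3 : 1 ≤ κ ^ 3 * L := by
    calc (1 : ℝ) ≤ κ ^ 2 * R := e1
      _ ≤ κ ^ 2 * (κ * L) := by gcongr
      _ = _ := by ring
  refine ⟨(inv_le_iff_one_le_mul₀' (by positivity)).2 e2,
    (inv_le_iff_one_le_mul₀' (by positivity)).2 e3, ?_⟩
  linarith

/-- The quadratic term in `η` becomes linear through `η ≤ B`, and the scale `Λ²` disappears into
`S`. -/
lemma error_sum_le {β S M Λ η B E q X Y T₂ C₅ P₃ P₄ : ℝ} (hβ : 0 ≤ β) (hS : 0 ≤ S) (hη : 0 ≤ η)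
    (hB : η ≤ B) (hMS : M * Λ ^ 2 ≤ S) (hE : E ≤ q * X) (hηE : η = E + (S * E + C₅ * Y))
    (hq : 0 ≤ q) (hX : 0 ≤ X) (hY : 0 ≤ Y) (hT : 0 ≤ T₂) (hC₅ : 0 ≤ C₅) (hP₃ : 0 ≤ P₃)
    (hP₄ : 0 ≤ P₄) :
    β * M * (2 * (Λ * (Λ * η)) + Λ * η * (Λ * η)) + P₃ * Y + P₄ * T₂ ≤
      (β * S * (2 + B) * ((1 + S) * q + C₅) + P₃ + P₄ + 1) * (Y + T₂ + X) := by
  have hB0 : 0 ≤ B := hη.trans hB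
  have h1 : β * M * (2 * (Λ * (Λ * η)) + Λ * η * (Λ * η)) ≤ β * S * (2 + B) * η := by
    calc β * M * (2 * (Λ * (Λ * η)) + Λ * η * (Λ * η))
        = β * (M * Λ ^ 2) * ((2 + η) * η) := by ring
      _ ≤ β * S * ((2 + B) * η) := by gcongr
      _ = _ := by ring
  have h2 : η ≤ (1 + S) * (q * X) + C₅ * Y := by
    have := mul_le_mul_of_nonneg_left hE (by positivity : 0 ≤ 1 + S)
    linarith
  have h3 := mul_le_mul_of_nonneg_left h2 (by positivity : 0 ≤ β * S * (2 + B))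
  have h4 : 0 ≤ β * S * (2 + B) * ((1 + S) * q) * (Y + T₂) + β * S * (2 + B) * C₅ * (T₂ + X) +
    P₃ * (T₂ + X) + P₄ * (Y + X) + (Y + T₂ + X) := by positivity
  linarith

/-- The error estimate for everywhere elliptic and periodic coefficients. -/
lemma exists_error_bound_of_isRegular (hd : 2 ≤ d) {α β : ℝ} (hα : 0 < α) (hαβ : α ≤ β) :
    ∃ c : ℝ, 0 < c ∧ ∀ (k p : ℕ) (μ : ℝ → ℝ) (κ : ℝ), 1 ≤ k → IsFilter p μ → 0 < κ →
      ∃ C : ℝ, 0 < C ∧ ∀ A : Field d, IsRegular α β A →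
        ∀ T R L : ℝ, 0 < T → 0 < R → 0 < L →
          T ≤ κ * R ^ 2 → R ≤ κ * T → L ≤ R → R ≤ κ * L →
          ∀ ξ ξ' : Sp d, ‖ξ‖ = 1 → ‖ξ'‖ = 1 →
            |approxForm A μ T k R L ξ' ξ - homForm A ξ' ξ| ≤
                C * ((L ^ (p + 1))⁻¹ + (T ^ (2 * k))⁻¹ +
                  T ^ (1 / 4 : ℝ) * Real.exp (-(c * ((R - L) / Real.sqrt (2 ^ (k - 1) * T))))) ∧
            |approxForm' A μ T k R L ξ' ξ - homForm A ξ' ξ| ≤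
                C * ((L ^ (p + 1))⁻¹ + (T ^ (2 * k))⁻¹ +
                  T ^ (1 / 4 : ℝ) *
                    Real.exp (-(c * ((R - L) / Real.sqrt (2 ^ (k - 1) * T))))) := by
  obtain ⟨c, hc, hcell⟩ := exists_isCellApprox hd hα hαβ
  refine ⟨c, hc, fun k p μ κ hk hμ hκ => ?_⟩
  have hβ : 0 < β := hα.trans_le hαβ
  have hT₀ : 0 < (κ ^ 3)⁻¹ := by positivity
  obtain ⟨K, hK, happrox⟩ := hcell k hk _ hT₀
  obtain ⟨Cf, hCf, hf⟩ := hμ.exists_average_bound d hT₀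
  have hμ0 : 0 ≤ μ 0 := hμ.nonneg 0 (by norm_num)
  obtain ⟨S, hSdef⟩ : ∃ S, S = μ 0 ^ d * (2 * κ + 4 * κ ^ 3) ^ d * (K + 1) := ⟨_, rfl⟩
  have hS : 0 ≤ S := by rw [hSdef]; positivity
  obtain ⟨C₅, hC₅⟩ : ∃ C₅, C₅ = Cf * (2 ^ d + K) := ⟨_, rfl⟩
  have hC₅0 : 0 ≤ C₅ := by rw [hC₅]; positivity
  -- The largest value of the perturbation size `η` below, given `E ≤ 1` and `L ≥ κ⁻³`.
  obtain ⟨B, hB⟩ : ∃ B, B = 1 + (S * 1 + C₅ * (((κ ^ 3)⁻¹) ^ (p + 1))⁻¹) := ⟨_, rfl⟩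
  have hB0 : 0 ≤ B := by rw [hB]; positivity
  obtain ⟨q, hq⟩ : ∃ q, q = (((κ ^ 3)⁻¹) ^ (1 / 4 : ℝ))⁻¹ := ⟨_, rfl⟩
  have hq0 : 0 ≤ q := by rw [hq]; positivity
  refine ⟨β * S * (2 + B) * ((1 + S) * q + C₅) + Cf * (β * K) + β * K ^ 2 + 1, by positivity, ?_⟩
  intro A hA T R L hT hR hL h1 h2 hLR h3 ξ ξ' hξ hξ'
  obtain ⟨hTT, hLL, hRL⟩ := parameter_bounds hκ hR h1 h2 h3
  obtain ⟨g, z, hg, hgd⟩ := happrox hA hξ hTT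
  obtain ⟨g', z', hg', hgd'⟩ := happrox hA.adj hξ' hTT
  obtain ⟨E, hE⟩ : ∃ E, E = Real.exp (-(c * ((R - L) / Real.sqrt (2 ^ (k - 1) * T)))) := ⟨_, rfl⟩
  have hE0 : 0 ≤ E := hE ▸ (Real.exp_pos _).le
  have hE1 : E ≤ 1 := by
    rw [hE, Real.exp_le_one_iff, neg_nonpos]
    have : 0 ≤ R - L := sub_nonneg.2 hLR
    positivity
  -- The decay estimate concerns squared norms, so the norms themselves carry the exponential `E` of
  -- the theorem.
  have hE2 : Real.exp (-(2 * (c * ((R - L) / Real.sqrt (2 ^ (k - 1) * T))))) = E ^ 2 := by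
    rw [hE, ← Real.exp_nat_mul]; congr 1; push_cast; ring
  obtain ⟨Λ, hΛ0, hΛ⟩ : ∃ Λ : ℝ, 0 ≤ Λ ∧ Λ ^ 2 = (K + 1) * (2 * R + 4) ^ d :=
    ⟨Real.sqrt ((K + 1) * (2 * R + 4) ^ d), Real.sqrt_nonneg _, Real.sq_sqrt (by positivity)⟩
  have hMS : μ 0 ^ d * (L ^ d)⁻¹ * Λ ^ 2 ≤ S := by
    rw [hΛ, hSdef]
    calc μ 0 ^ d * (L ^ d)⁻¹ * ((K + 1) * (2 * R + 4) ^ d)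
        ≤ μ 0 ^ d * (L ^ d)⁻¹ * ((K + 1) * ((2 * κ + 4 * κ ^ 3) * L) ^ d) := by gcongr
      _ = _ := by rw [mul_pow]; field_simp
  have hsub : box d L ⊆ box d R := fun x hx i => (hx i).trans_le hLR
  have hmem : ∀ {A : Field d} (_ : IsRegular α β A) (ξ : Sp d),
      MemLp (gradExtrap A ξ T k R) 2 (volume.restrict (box d L)) := fun hA ξ =>
    (hA.memLp_gradExtrap ξ hT k R).mono_measure (Measure.restrict_mono hsub le_rfl)
  have hDle : K * (2 * R + 4) ^ d * E ^ 2 ≤ (Λ * E) ^ 2 := by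
    rw [mul_pow, hΛ]; gcongr; linarith
  have hG := hmem hA ξ
  have hG' := hmem hA.adj ξ'
  have hd1 := (hgd R L hR hL hLR).trans ((congrArg _ hE2).le.trans hDle)
  have hd1' := (hgd' R L hR hL hLR).trans ((congrArg _ hE2).le.trans hDle)
  obtain ⟨a1, a2, a3⟩ := hg.l2norm_bounds hξ hK.le hμ hL hLR hCf
    (fun ψ hψ hi => hf ψ hψ hi L hLL) hG hΛ0 hE0 hΛ hMS hd1
  obtain ⟨b1, b2, b3⟩ := hg'.l2norm_bounds hξ' hK.le hμ hL hLR hCf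
    (fun ψ hψ hi => hf ψ hψ hi L hLL) hG' hΛ0 hE0 hΛ hMS hd1'
  rw [← hC₅] at a3 b3
  obtain ⟨η, hη⟩ : ∃ η, η = E + (S * E + C₅ * (L ^ (p + 1))⁻¹) := ⟨_, rfl⟩
  rw [← hη] at a3 b3
  have hηE : E ≤ η := by
    have : 0 ≤ S * E + C₅ * (L ^ (p + 1))⁻¹ := by positivity
    linarith
  have hηB : η ≤ B := by rw [hη, hB]; gcongr
  -- Because `T ≥ κ⁻³`, the prefactor `T^{1/4}` is bounded below by `q⁻¹`.
  have hEq : E ≤ q * (T ^ (1 / 4 : ℝ) * E) := by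
    have hpos : 0 < ((κ ^ 3)⁻¹ : ℝ) ^ (1 / 4 : ℝ) := Real.rpow_pos_of_pos hT₀ _
    have : 1 ≤ q * T ^ (1 / 4 : ℝ) := by
      rw [hq, ← div_eq_inv_mul, one_le_div hpos]
      exact Real.rpow_le_rpow hT₀.le hTT (by norm_num)
    calc E = 1 * E := (one_mul E).symm
      _ ≤ q * T ^ (1 / 4 : ℝ) * E := by gcongr
      _ = _ := by ring
  have hT4 : 0 ≤ T ^ (1 / 4 : ℝ) * E := by positivity
  have hsum := error_sum_le (P₃ := Cf * (β * K)) (P₄ := β * K ^ 2) (Y := (L ^ (p + 1))⁻¹)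
    (T₂ := (T ^ (2 * k))⁻¹) hβ.le hS (hE0.trans hηE) hηB hMS hEq hη hq0 hT4 (by positivity)
    (by positivity) hC₅0 (by positivity) (by positivity)
  have hδ : β * (K * (T ^ k)⁻¹) ^ 2 = β * K ^ 2 * (T ^ (2 * k))⁻¹ := by
    rw [mul_pow, inv_pow, ← pow_mul, mul_comm k 2]; ring
  -- Used twice: with `Y` the extrapolated gradient minus `g`, and with its filtered mean subtracted
  -- in addition.
  have hmain : ∀ {Y Y' : Sp d → Sp d}, MemLp Y 2 (volume.restrict (box d L)) →
      MemLp Y' 2 (volume.restrict (box d L)) → l2norm (box d L) Y ≤ Λ * η →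
      l2norm (box d L) Y' ≤ Λ * η →
      |(∫ x in box d L, inner ℝ (ξ' + g' x + Y' x) (act (A x) (ξ + g x + Y x)) *
        scaledFilter d μ L x) - homForm A ξ' ξ| ≤
      (β * S * (2 + B) * ((1 + S) * q + C₅) + Cf * (β * K) + β * K ^ 2 + 1) *
        ((L ^ (p + 1))⁻¹ + (T ^ (2 * k))⁻¹ + T ^ (1 / 4 : ℝ) * E) := by
    intro Y Y' hY hY' l1 l2
    have := hg.abs_integral_sub_homForm_le hA hg' hμ hL hCf (fun ψ hψ hi => hf ψ hψ hi L hLL)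
      hY hY' a1 b1 l1 l2
    rw [hδ] at this
    refine this.trans (le_trans (le_of_eq ?_) hsum)
    ring
  rw [← hE]
  have hDm : MemLp (fun x => gradExtrap A ξ T k R x - g x) 2 (volume.restrict (box d L)) :=
    hG.sub (hg.memLp L)
  have hDm' : MemLp (fun x => gradExtrap (adj A) ξ' T k R x - g' x) 2
      (volume.restrict (box d L)) := hG'.sub (hg'.memLp L)
  constructor
  · refine le_of_eq_of_le ?_ (hmain
      (hDm.sub (memLp_two_const (volume_box_lt_top L) (filteredMean μ L (gradExtrap A ξ T k R))))
      (hDm'.sub (memLp_two_const (volume_box_lt_top L)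
        (filteredMean μ L (gradExtrap (adj A) ξ' T k R)))) a3 b3)
    rw [approxForm]
    congr 3
    funext x
    have e : ∀ a b c e : Sp d, a + b - c = a + e + (b - e - c) := fun a b c e => by abel
    rw [e _ _ _ (g' x), e _ (gradExtrap A ξ T k R x) _ (g x)]
    rfl
  · have hle : Λ * E ≤ Λ * η := mul_le_mul_of_nonneg_left hηE hΛ0
    refine le_of_eq_of_le ?_ (hmain hDm hDm' (a2.trans hle) (b2.trans hle))
    rw [approxForm']
    congr 3
    funext x
    have e : ∀ a b e : Sp d, a + b = a + e + (b - e) := fun a b e => by abel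
    rw [e _ _ (g' x), e _ (gradExtrap A ξ T k R x) (g x)]

/-! ### Reduction to everywhere elliptic and periodic coefficients -/

lemma isElliptic_smul_one {α β : ℝ} (hα : 0 < α) (hαβ : α ≤ β) :
    IsElliptic α β (α • (1 : Matrix (Fin d) (Fin d) ℝ)) := by
  intro ξ
  have h : act (α • (1 : Matrix (Fin d) (Fin d) ℝ)) ξ = α • ξ := by
    ext i
    simp [act_apply, Matrix.one_apply]
  rw [h, inner_smul_right, real_inner_self_eq_norm_sq, norm_smul, Real.norm_of_nonneg hα.le]
  exact ⟨le_rfl, mul_le_mul_of_nonneg_right hαβ (norm_nonneg ξ)⟩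

/-- The almost everywhere periods form a subgroup, and the vectors `2 e_i` generate the lattice. -/
lemma IsPeriodicField.ae_lat {A : Field d} (h : IsPeriodicField A) (n : Fin d → ℤ) :
    ∀ᵐ x, A (x + lat n) = A x := by
  have hq : ∀ {v : Sp d} {P : Sp d → Prop}, (∀ᵐ x, P x) → ∀ᵐ x, P (x + v) := fun hP =>
    (measurePreserving_add_right volume _).quasiMeasurePreserving.ae hP
  let S : AddSubgroup (Sp d) :=
    { carrier := {v | ∀ᵐ x, A (x + v) = A x}
      zero_mem' := by
        change ∀ᵐ x, A (x + 0) = A x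
        exact Filter.Eventually.of_forall fun x => by rw [add_zero]
      add_mem' := fun {a b} ha hb => by
        filter_upwards [ha, hq (v := a) hb] with x e1 e2
        rw [← add_assoc, e2, e1]
      neg_mem' := fun {a} ha => by
        filter_upwards [hq (v := -a) ha] with x e1
        rw [← e1, neg_add_cancel_right] }
  have hlat : lat n = ∑ i, n i • (EuclideanSpace.single i (2 : ℝ) : Sp d) := by
    ext j
    simp [Finset.sum_apply, Pi.single_apply, mul_comm]
  have : lat n ∈ S := by
    rw [hlat]
    exact S.sum_mem fun i _ => S.zsmul_mem (h i) _
  exact this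

/-- The matrix `α I` replaces `A` where ellipticity fails, and the values on the cell are then
repeated periodically. The lattice is countable, so the exceptional sets remain null. -/
lemma exists_isRegular_ae_eq {α β : ℝ} (hα : 0 < α) (hαβ : α ≤ β) {A : Field d}
    (hA : IsCoefficient α β A) (hp : IsPeriodicField A) :
    ∃ B : Field d, IsRegular α β B ∧ A =ᵐ[volume] B := by
  classical
  set F : Field d := fun y => if IsElliptic α β (A y) then A y else α • 1 with hF
  have hae : A =ᵐ[volume] fun x => F (rep x) := by
    filter_upwards [ae_all_iff.2 fun n => hp.ae_lat n, ae_rep (ae_restrict_of_ae hA.2)] with x h1 h2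
    simp only [hF]
    rw [if_pos h2]
    conv_lhs => rw [← rep_add_lat_cellIndex x]
    have h3 := h1 (-cellIndex x)
    have h4 : x + lat (-cellIndex x) = rep x := by rw [lat_neg, rep, sub_eq_add_neg]
    rw [rep_add_lat_cellIndex, ← h3, h4]
  refine ⟨fun x => F (rep x), ⟨hα, hαβ, fun i j => (hA.1 i j).congr (hae.mono fun x hx => by
    simp only [hx]), fun x => ?_, latPeriodic_comp_rep F⟩, hae⟩
  simp only [hF]
  split_ifs with h
  · exact h
  · exact isElliptic_smul_one hα hαβ

lemma adj_congr_ae {A B : Field d} (h : A =ᵐ[volume] B) : adj A =ᵐ[volume] adj B := h.mono fun x hx => by simp only [adj, hx]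

/-- The defining predicates coincide, so `Classical.epsilon` selects the same pair; the equality
holds exactly, not just almost everywhere. -/
lemma corrector_congr {A B : Field d} (h : A =ᵐ[volume] B) (ξ : Sp d) : corrector A ξ = corrector B ξ := by
  have : IsCorrector A ξ = IsCorrector B ξ := by
    funext w
    refine propext (and_congr_right fun _ => forall₂_congr fun v _ => ?_)
    rw [integral_congr_ae (ae_restrict_of_ae (h.mono fun x hx => by simp only [hx]) :
      (fun x => inner ℝ (v.2 x) (act (A x) (ξ + w.2 x))) =ᵐ[volume.restrict (box d 1)]
        fun x => inner ℝ (v.2 x) (act (B x) (ξ + w.2 x)))]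
  simp only [corrector, this]

lemma regCorrector_congr {A B : Field d} (h : A =ᵐ[volume] B) (ξ : Sp d) (T R : ℝ) : regCorrector A ξ T R = regCorrector B ξ T R := by
  have : IsRegCorrector A ξ T R = IsRegCorrector B ξ T R := by
    funext w
    refine propext (and_congr_right fun _ => forall₂_congr fun v _ => ?_)
    rw [integral_congr_ae (ae_restrict_of_ae (h.mono fun x hx => by simp only [hx]) :
      (fun x => T⁻¹ * (v.1 x * w.1 x) + inner ℝ (v.2 x) (act (A x) (ξ + w.2 x)))
        =ᵐ[volume.restrict (box d R)]
        fun x => T⁻¹ * (v.1 x * w.1 x) + inner ℝ (v.2 x) (act (B x) (ξ + w.2 x)))]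
  simp only [regCorrector, this]

lemma gradExtrap_congr {A B : Field d} (h : A =ᵐ[volume] B) (ξ : Sp d) (T : ℝ) (k : ℕ) (R : ℝ) :
    gradExtrap A ξ T k R = gradExtrap B ξ T k R := by
  simp only [gradExtrap, regCorrector_congr h]

lemma homForm_congr {A B : Field d} (h : A =ᵐ[volume] B) (ξ' ξ : Sp d) : homForm A ξ' ξ = homForm B ξ' ξ := by
  rw [homForm, homForm, corrector_congr h, corrector_congr (adj_congr_ae h)]
  exact average_congr (ae_restrict_of_ae (h.mono fun x hx => by simp only [hx]))

lemma approxForm'_congr {A B : Field d} (h : A =ᵐ[volume] B) (μ : ℝ → ℝ) (T : ℝ) (k : ℕ) (R L : ℝ) (ξ' ξ : Sp d) :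
    approxForm' A μ T k R L ξ' ξ = approxForm' B μ T k R L ξ' ξ := by
  rw [approxForm', approxForm', gradExtrap_congr h, gradExtrap_congr (adj_congr_ae h)]
  exact integral_congr_ae (ae_restrict_of_ae (h.mono fun x hx => by simp only [hx]))

lemma approxForm_congr {A B : Field d} (h : A =ᵐ[volume] B) (μ : ℝ → ℝ) (T : ℝ) (k : ℕ) (R L : ℝ) (ξ' ξ : Sp d) :
    approxForm A μ T k R L ξ' ξ = approxForm B μ T k R L ξ' ξ := by
  rw [approxForm, approxForm, gradExtrap_congr h, gradExtrap_congr (adj_congr_ae h)]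
  exact integral_congr_ae (ae_restrict_of_ae (h.mono fun x hx => by simp only [hx]))

end PeriodicHom

end

theorem theorem7 (d : ℕ) (hd : 2 ≤ d) (α β : ℝ) (hα : 0 < α) (hαβ : α ≤ β) :
    ∃ c : ℝ, 0 < c ∧
      ∀ (k p : ℕ) (μ : ℝ → ℝ) (κ : ℝ), 1 ≤ k → PeriodicHom.IsFilter p μ → 0 < κ →
        ∃ C : ℝ, 0 < C ∧
          ∀ A : PeriodicHom.Field d,
            PeriodicHom.IsCoefficient α β A → PeriodicHom.IsPeriodicField A →
            ∀ T R L : ℝ, 0 < T → 0 < R → 0 < L →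
              T ≤ κ * R ^ 2 → R ≤ κ * T → L ≤ R → R ≤ κ * L → R ≤ κ * (R - L) →
              ∀ ξ ξ' : PeriodicHom.Sp d, ‖ξ‖ = 1 → ‖ξ'‖ = 1 →
                |PeriodicHom.approxForm A μ T k R L ξ' ξ - PeriodicHom.homForm A ξ' ξ| ≤
                    C * ((L ^ (p + 1))⁻¹ + (T ^ (2 * k))⁻¹ +
                      T ^ (1 / 4 : ℝ) *
                        Real.exp (-(c * ((R - L) / Real.sqrt (2 ^ (k - 1) * T))))) ∧
                |PeriodicHom.approxForm' A μ T k R L ξ' ξ - PeriodicHom.homForm A ξ' ξ| ≤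
                    C * ((L ^ (p + 1))⁻¹ + (T ^ (2 * k))⁻¹ +
                      T ^ (1 / 4 : ℝ) *
                        Real.exp (-(c * ((R - L) / Real.sqrt (2 ^ (k - 1) * T))))) := by
  obtain ⟨c, hc, h⟩ := PeriodicHom.exists_error_bound_of_isRegular hd hα hαβ
  refine ⟨c, hc, fun k p μ κ hk hμ hκ => ?_⟩
  obtain ⟨C, hC, hC'⟩ := h k p μ κ hk hμ hκ
  refine ⟨C, hC, fun A hA hp T R L hT hR hL h1 h2 hLR h3 _ ξ ξ' hξ hξ' => ?_⟩
  obtain ⟨B, hB, hAB⟩ := PeriodicHom.exists_isRegular_ae_eq hα hαβ hA hp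
  rw [PeriodicHom.approxForm_congr hAB, PeriodicHom.approxForm'_congr hAB,
    PeriodicHom.homForm_congr hAB]
  exact hC' B hB T R L hT hR hL h1 h2 hLR h3 ξ ξ' hξ hξ'
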